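/- **Setting.** A data set is a finite multiset of elements $e=(e.\mathrm{key},e.\mathrm{val})$ with real values; $\nu_x$ is the sum of the values of the elements with key $x$. Keys come from any totally ordered set (e.g. strings), and $\mathrm{KeyHash}$ maps the keys that occur injectively to $[n]=\{1,\dots,n\}$, $n\ge 2$. Let $0<p\le 2$, $k\ge 1$, let $r_x\sim\mathrm{Exp}[1]$ be independent over keys $x$, and $\nu^*_x=\nu_x/r_x^{1/p}$. The $p$-ppswor sample of size $k$ according to $\nu$ consists of the $k$ keys with largest $|\nu^*_x|$ (all keys, if there are fewer), with their frequencies $\nu_x$, and the threshold $\tau$, the $(k+1)$-st largest $|\nu^*_x|$. **Method (two-pass WORp).** Pass I feeds the elements $(\mathrm{KeyHash}(e.\mathrm{key}),\,e.\mathrm{val}/r_{e.\mathrm{key}}^{1/p})$ to a composable sketch $R$ for $(k+1,\psi)$ residual heavy hitters. Pass II uses a composable structure $T$ that collects the exact frequencies of the $Bk$ keys with the largest estimates $|R.\mathrm{Est}(\mathrm{KeyHash}(x))|$. The method returns the $k$ keys $x$ of $T$ with largest $|\nu^*_x|$, their $\nu_x$, and the $(k+1)$-st largest $|\nu^*_x|$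 over $T$. In both passes the data may be processed and merged along any binary aggregation tree, fixed in advance. $R$ is one of: * CountSketch (values of any sign), with $\lceil A_2\log(n/\delta)\rceil$ rows of $\lceil A_1(k+1)/\psi\rceil$ counters, median estimates, independent rows, and in each row a bucket hash and a sign hash that are independent of each other, each uniform and pairwise independent; all these hashes are independent of $(r_x)$; * Counters (positive values), the mergeable Misra–Gries summary with at most $\lceil A_1(k+1)/\psi\rceil$ counters. The sketch size is the number of memory words of $R$ and $T$ together (hash functions are not counted), with the number of key strings stored in $T$ counted separately. **Theorem.** There are universal constants $A_1,A_2>0$ and $B\ge 1$ such that the following holds. 1. (Signed data.) For every $p\in(0,2]$ there are $\psi=\psi_p(n,k)>0$ such that for every $c>0$ there is a constant $C=C(p,c)$ for which, for all $n\ge 2$, $k\ge 1$, two-pass WORp with CountSketch and $\delta=n^{-c}$ has sketch size at most $Ck\log n$ words if $p<2$ and at most $Ck\log^2 n$ words if $p=2$, and stores at most $Ck$ key strings; and it returns the exact $p$-ppswor sample of size $k$ with probability at least $(1-n^{-c})(1-3e^{-k})$. 2. (Positive data.) For every $p\in(0,1]$ there are $\psi=\psi_p(n,k)>0$ and a constant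 $C=C(p)$ such that, for all $n\ge 2$, $k\ge 1$, two-pass WORp with Counters has sketch size at most $Ck$ words if $p<1$ and at most $Ck\log n$ words if $p=1$, and stores at most $Ck$ key strings; and it returns the exact $p$-ppswor sample of size $k$ with probability at least $1-3e^{-k}$. The size bounds hold for the sketches at every node of every aggregation tree. Both probability bounds hold for every data set and all aggregation trees, and they also hold conditioned on the top $k$ keys by $|\nu^*|$, in order, being any particular $k$-tuple (for which this event has positive probability). -/

import Mathlib

open MeasureTheory ProbabilityTheory
open scoped NNReal

noncomputable section

namespace WORp

open scoped Classical in
/-- `rank s f x` is the number of keys of `s` that come before `x` when the keys are listed by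
decreasing value of `f`, ties being broken by the linear order of the keys. -/
def rank {κ : Type*} [LinearOrder κ] (s : Finset κ) (f : κ → ℝ≥0) (x : κ) : ℕ :=
  (s.filter fun y => f x < f y ∨ (f y = f x ∧ y < x)).card

/-- The `m` keys of `s` with largest `f` (all of `s` if `s` has at most `m` keys). -/
def topKeys {κ : Type*} [LinearOrder κ] (m : ℕ) (s : Finset κ) (f : κ → ℝ≥0) : Finset κ :=
  s.filter fun x => rank s f x < m

/-- The `(m+1)`-st largest value of `f` on `s` (and `0` if `s` has at most `m` keys). -/
def nextLargest {κ : Type*} [LinearOrder κ] (m : ℕ) (s : Finset κ) (f : κ → ℝ≥0) : ℝ≥0 :=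
  (s \ topKeys m s f).sup f

/-! ### Data sets, and their distributed aggregation -/

/-- A data element: a key together with a value. -/
structure DataElement (κ : Type*) where
  key : κ
  val : ℝ

/-- The frequency of the key `x`: the sum of the values of the elements with key `x`. -/
def freq {κ : Type*} [DecidableEq κ] (D : Multiset (DataElement κ)) (x : κ) : ℝ :=
  ((D.filter fun e => e.key = x).map DataElement.val).sum

/-- The keys that occur in a data set. -/
def keys {κ : Type*} [DecidableEq κ] (D : Multiset (DataElement κ)) : Finset κ :=
  (D.map DataElement.key).toFinset

/-- A way of aggregating a data set with a composable sketch: start from empty sketches, feed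
single elements to sketches, and merge sketches, in any order and along any binary tree. -/
inductive Aggregation (κ : Type*) where
  | empty : Aggregation κ
  | process (a : Aggregation κ) (e : DataElement κ) : Aggregation κ
  | merge (a b : Aggregation κ) : Aggregation κ

/-- The data set that is aggregated. -/
def Aggregation.dataset {κ : Type*} : Aggregation κ → Multiset (DataElement κ)
  | .empty => 0
  | .process a e => e ::ₘ a.dataset
  | .merge a b => a.dataset + b.dataset

/-- Replace every element by its image under `g`, locally. -/
def Aggregation.map {κ κ' : Type*} (g : DataElement κ → DataElement κ') :
    Aggregation κ → Aggregation κ'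
  | .empty => .empty
  | .process a e => .process (a.map g) (g e)
  | .merge a b => .merge (a.map g) (b.map g)

/-- A composable sketch of elements with keys in `κ`, with states in `σ`. -/
structure ComposableSketch (κ σ : Type*) where
  empty : σ
  process : σ → DataElement κ → σ
  merge : σ → σ → σ

/-- The sketch that an aggregation produces. -/
def ComposableSketch.run {κ σ : Type*} (S : ComposableSketch κ σ) : Aggregation κ → σ
  | .empty => S.empty
  | .process a e => S.process (S.run a) e
  | .merge a b => S.merge (S.run a) (S.run b)

/-- A composable sketch of elements with keys in `Fin n` that also returns frequency estimates;
`words` is the number of memory words that a state occupies. -/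
structure FrequencySketch (n : ℕ) (σ : Type*) extends ComposableSketch (Fin n) σ where
  est : σ → Fin n → ℝ
  words : σ → ℕ

/-! ### CountSketch -/

/-- The median of `d` numbers: the entry of index `d / 2` (from `0`) in increasing order. -/
def median {d : ℕ} (f : Fin d → ℝ) : ℝ :=
  if hd : 0 < d then f (Tuple.sort f ⟨d / 2, Nat.div_lt_self hd one_lt_two⟩) else 0

/-- The number `1` or `-1` that is encoded by a bit. -/
def sgn (b : Bool) : ℝ := if b then 1 else -1

/-- `CountSketch` with `d` rows of `w` counters, bucket hashes `h i : Fin n → Fin w` and sign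
hashes `s i : Fin n → {1, -1}`. An element `(x, v)` adds `s i x * v` to the counter `h i x` of every
row `i`; sketches are merged by adding the tables; the estimate for `x` is the median over the
rows `i` of `s i x` times the counter `h i x`. -/
def countSketch {n : ℕ} (d w : ℕ) (h : Fin d → Fin n → Fin w) (s : Fin d → Fin n → Bool) :
    FrequencySketch n (Fin d → Fin w → ℝ) where
  empty := fun _ _ => 0
  process := fun T e i b => T i b + if h i e.key = b then sgn (s i e.key) * e.val else 0
  merge := fun T T' i b => T i b + T' i b
  est := fun T x => median fun i => sgn (s i x) * T i (h i x)
  words := fun _ => d * w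

/-- The random hashes of `CountSketch`: in every row the bucket hash and the sign hash are uniform
and pairwise independent, and independent of each other; the rows are independent. -/
structure IsCountSketchHash {Ω : Type*} [MeasurableSpace Ω] (P : Measure Ω) {n d w : ℕ}
    (h : Fin d → Fin n → Ω → Fin w) (s : Fin d → Fin n → Ω → Bool) : Prop where
  measurable_h : ∀ i x, Measurable (h i x)
  measurable_s : ∀ i x, Measurable (s i x)
  uniform_h : ∀ i x b, P.real {ω | h i x ω = b} = 1 / (w : ℝ)
  uniform_s : ∀ i x b, P.real {ω | s i x ω = b} = 1 / 2
  pairwise_h : ∀ i x y, x ≠ y → IndepFun (h i x) (h i y) P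
  pairwise_s : ∀ i x y, x ≠ y → IndepFun (s i x) (s i y) P
  indep_h_s : ∀ i, IndepFun (fun ω x => h i x ω) (fun ω x => s i x ω) P
  indep_rows : iIndepFun (fun i ω => ((fun x => h i x ω), (fun x => s i x ω))) P

/-! ### Counters -/

/-- Subtract the `(m+1)`-st largest counter from all counters, and drop those that do not stay
positive (subtraction in `ℝ≥0` is truncated at `0`). -/
def reduceCounters {n : ℕ} (m : ℕ) (c : Fin n → ℝ≥0) : Fin n → ℝ≥0 :=
  fun x => c x - nextLargest m Finset.univ c

/-- The deterministic counter-based sketch (Misra-Gries) for elements of positive value, with at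
most `m` stored counters. An element adds its value to the counter of its key, merging adds the
counters, and then the `(m+1)`-st largest counter is subtracted from all. A key that has no counter
is represented by the value `0`. A stored counter takes two words: the key and the count. -/
def counters (n m : ℕ) : FrequencySketch n (Fin n → ℝ≥0) where
  empty := fun _ => 0
  process := fun c e =>
    reduceCounters m fun x => c x + if e.key = x then e.val.toNNReal else 0
  merge := fun c c' => reduceCounters m fun x => c x + c' x
  est := fun c x => (c x : ℝ)
  words := fun c => 2 * (Finset.univ.filter fun x => c x ≠ 0).card

/-! ### The structure of the second pass -/

/-- Stored keys, with the total value collected for each of them (nothing for other keys). -/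
structure TopState (κ : Type*) where
  keys : Finset κ
  val : κ → ℝ
  val_eq_zero : ∀ x, x ∉ keys → val x = 0

/-- Keep the `m` keys of highest priority, and eject the others with their values. -/
def retain {κ : Type*} [LinearOrder κ] (m : ℕ) (prio : κ → ℝ≥0) (s : Finset κ) (v : κ → ℝ) :
    TopState κ where
  keys := topKeys m s prio
  val := fun x => if x ∈ topKeys m s prio then v x else 0
  val_eq_zero := fun _ hx => if_neg hx

/-- The composable top-`m` structure: it collects the total values of the `m` keys of highest
priority. -/
def topSketch {κ : Type*} [LinearOrder κ] (m : ℕ) (prio : κ → ℝ≥0) :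
    ComposableSketch κ (TopState κ) where
  empty := ⟨∅, fun _ => 0, fun _ _ => rfl⟩
  process := fun T e =>
    retain m prio (insert e.key T.keys) fun x => T.val x + if e.key = x then e.val else 0
  merge := fun T T' => retain m prio (T.keys ∪ T'.keys) fun x => T.val x + T'.val x

/-- The memory words of the top structure: a value and a priority for each stored key (the key
strings themselves are counted separately). -/
def TopState.words {κ : Type*} (T : TopState κ) : ℕ := 2 * T.keys.card

/-! ### The two-pass method -/

/-- The element that is generated from `e`:
`(keyHash(e.key), e.val / r_{e.key}^(1/p))`. -/
def outputElement {κ : Type*} {n : ℕ} (p : ℝ) (keyHash : κ → Fin n) (r : κ → ℝ)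
    (e : DataElement κ) : DataElement (Fin n) :=
  ⟨keyHash e.key, e.val / r e.key ^ (1 / p)⟩

/-- The state of the frequency sketch `R` after a first pass along `a₁`. -/
def passOne {κ σ : Type*} {n : ℕ} (R : FrequencySketch n σ) (p : ℝ) (keyHash : κ → Fin n)
    (r : κ → ℝ) (a₁ : Aggregation κ) : σ :=
  R.run (a₁.map (outputElement p keyHash r))

/-- The state of the top-`m` structure after a first pass along `a₁` and a second pass along `a₂`:
the priority of a key is the magnitude of its estimate from the first pass. -/
def passTwo {κ σ : Type*} [LinearOrder κ] {n : ℕ} (R : FrequencySketch n σ) (p : ℝ) (m : ℕ)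
    (keyHash : κ → Fin n) (r : κ → ℝ) (a₁ a₂ : Aggregation κ) : TopState κ :=
  (topSketch m fun x => ‖R.est (passOne R p keyHash r a₁) (keyHash x)‖₊).run a₂

/-- The transformed frequency `v_x / r_x^(1/p)`, in magnitude. -/
def transformed {κ : Type*} (p : ℝ) (r : κ → ℝ) (v : κ → ℝ) (x : κ) : ℝ≥0 :=
  ‖v x / r x ^ (1 / p)‖₊

/-- A sample: the sampled keys, each with its reported frequency, and a threshold. -/
structure Sample (κ : Type*) where
  keys : Finset κ
  val : κ → ℝ
  threshold : ℝ≥0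

/-- The sample that the two-pass method returns: the `k` stored keys of largest transformed
frequency with the values collected for them, and the `(k+1)`-st largest transformed frequency of
a stored key. -/
def twoPassSample {κ σ : Type*} [LinearOrder κ] {n : ℕ} (R : FrequencySketch n σ) (p : ℝ)
    (k m : ℕ) (keyHash : κ → Fin n) (r : κ → ℝ) (a₁ a₂ : Aggregation κ) : Sample κ :=
  let T := passTwo R p m keyHash r a₁ a₂
  { keys := topKeys k T.keys (transformed p r T.val)
    val := T.val
    threshold := nextLargest k T.keys (transformed p r T.val) }

/-- The words that the sketches occupy together during the two passes. -/
def twoPassWords {κ σ : Type*} [LinearOrder κ] {n : ℕ} (R : FrequencySketch n σ) (p : ℝ)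
    (m : ℕ) (keyHash : κ → Fin n) (r : κ → ℝ) (a₁ a₂ : Aggregation κ) : ℕ :=
  R.words (passOne R p keyHash r a₁) + (passTwo R p m keyHash r a₁ a₂).words

/-- The number of key strings that are stored. -/
def twoPassKeyStrings {κ σ : Type*} [LinearOrder κ] {n : ℕ} (R : FrequencySketch n σ) (p : ℝ)
    (m : ℕ) (keyHash : κ → Fin n) (r : κ → ℝ) (a₁ a₂ : Aggregation κ) : ℕ :=
  (passTwo R p m keyHash r a₁ a₂).keys.card

/-! ### The exact sample -/

/-- `S` is the exact bottom-`k` sample of the data set `D` for the randomization `r`: its keys are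
`k` keys of `D` (all keys, if there are fewer) of largest transformed frequency, reported with
their exact frequencies, and its threshold is the largest transformed frequency of the remaining
keys, that is, the `(k+1)`-st largest overall. If the `r x` are independent `Exp[1]` variables,
this is the `p`-ppswor sample. -/
structure IsExactSample {κ : Type*} [LinearOrder κ] (p : ℝ) (k : ℕ) (r : κ → ℝ)
    (D : Multiset (DataElement κ)) (S : Sample κ) : Prop where
  subset : S.keys ⊆ keys D
  card : S.keys.card = min k (keys D).card
  top : ∀ x ∈ S.keys, ∀ y ∈ keys D, y ∉ S.keys →
    transformed p r (freq D) y ≤ transformed p r (freq D) x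
  val : ∀ x ∈ S.keys, S.val x = freq D x
  threshold : S.threshold = (keys D \ S.keys).sup (transformed p r (freq D))

/-- The keys `t 0, t 1, …, t (k-1)`, in this order, are the top `k` keys of `D` by transformed
frequency. -/
structure IsTopTuple {κ : Type*} [LinearOrder κ] (p : ℝ) {k : ℕ} (r : κ → ℝ)
    (D : Multiset (DataElement κ)) (t : Fin k → κ) : Prop where
  injective : Function.Injective t
  mem : ∀ i, t i ∈ keys D
  antitone : Antitone fun i => transformed p r (freq D) (t i)
  top : ∀ y ∈ keys D, y ∉ Set.range t → ∀ i,
    transformed p r (freq D) y ≤ transformed p r (freq D) (t i)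

/-- `r` assigns independent `Exp[1]` variables to the keys. -/
structure IsExpHash {Ω κ : Type*} [MeasurableSpace Ω] (P : Measure Ω) (r : κ → Ω → ℝ) : Prop where
  measurable : ∀ x, Measurable (r x)
  law : ∀ x, P.map (r x) = expMeasure 1
  indep : iIndepFun r P

/-- The success probability is at least `β`, also conditioned on any particular `k`-tuple of
(ordered) top `k` keys. Here `R ω` is the frequency sketch with its randomization. -/
def SucceedsWithProb {Ω κ σ : Type*} [MeasurableSpace Ω] [LinearOrder κ] {n : ℕ} (P : Measure Ω)
    (β : ℝ) (R : Ω → FrequencySketch n σ) (p : ℝ) (k m : ℕ) (keyHash : κ → Fin n)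
    (r : κ → Ω → ℝ) (D : Multiset (DataElement κ)) (a₁ a₂ : Aggregation κ) : Prop :=
  let success : Set Ω :=
    {ω | IsExactSample p k (fun x => r x ω) D
      (twoPassSample (R ω) p k m keyHash (fun x => r x ω) a₁ a₂)}
  β ≤ P.real success ∧
    ∀ t : Fin k → κ, P {ω | IsTopTuple p (fun x => r x ω) D t} ≠ 0 →
      β ≤ (P[|{ω | IsTopTuple p (fun x => r x ω) D t}]).real success

/-- The dimensions of a sketch for `(k, ψ)` residual heavy hitters: `⌈A k / ψ⌉` counters per row. -/
def sketchWidth (A : ℝ) (k : ℕ) (ψ : ℝ) : ℕ := ⌈A * k / ψ⌉₊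

/-- The number of rows of `CountSketch` for error probability `δ`: `⌈A log (n / δ)⌉`. -/
def sketchDepth (A : ℝ) (n : ℕ) (δ : ℝ) : ℕ := ⌈A * Real.log (n / δ)⌉₊

end WORp

end

/-!
Suppose that, for some `ε > 0`, every estimate of a transformed frequency `ν*_x` is within `ε` of
the truth, at least `k + 1` keys have `|ν*_x| > 3ε`, and fewer than `Bk` keys have `|ν*_x| > ε`.
Then every key with `|ν*_x| > 3ε` has an estimate above `2ε`, only keys with `|ν*_x| > ε` can have
one, and the `Bk` largest estimates include the top `k + 1` keys; the second pass is then exact.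

Both sketches reach the error `ε` once their width exceeds a multiple of the number of keys with
`|ν*_x| > ε` plus `ε ^ (-q)` times the sum of `|ν*_x| ^ q` over the other keys, with `q = 2` for
`CountSketch` (Chebyshev's inequality in each row, Chernoff's bound for the median of the rows) and
`q = 1` for `Counters`.

It remains to find such an `ε` for the random `ν*`, given that the top `k` keys, in order, form the
tuple `t`. The variables `r_x / |ν_x| ^ p` are independent exponentials of rate `|ν_x| ^ p`, and the
top keys are those where they are smallest. By memorylessness the variables outside `t`, measured
from the largest one in `t`, keep their original law. Let `W` be the sum of `|ν_x| ^ p` outside `t`,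
`M = 16k / W` and `ε = M ^ (-1 / p) / 4`. Tail bounds then show that, except with probability
`3 * exp (-k)`, the variables of `t` and one more are at most `M`, `O(k)` variables are below `16M`,
and the sum of `|ν*_x| ^ q` over the other keys is `O(k ε ^ q)`, with a factor `q / (q - p)` if
`p < q` and `log n` if `p = q`. If `W = 0`, the estimates are exact.
-/

namespace WORp

/-! ### Tail bounds and independence -/

section Chernoff

variable {Ω : Type*} [MeasurableSpace Ω] {P : Measure Ω} [IsProbabilityMeasure P]

theorem integrable_of_mem_Icc_zero_one {X : Ω → ℝ} (hX : Measurable X)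
    (h01 : ∀ ω, X ω ∈ Set.Icc (0 : ℝ) 1) : Integrable X P := by
  refine Integrable.of_bound hX.aestronglyMeasurable 1 (.of_forall fun ω => ?_)
  rw [Real.norm_eq_abs, abs_of_nonneg (h01 ω).1]
  exact (h01 ω).2

theorem mgf_le_exp_of_mem_Icc_zero_one {X : Ω → ℝ} (hX : Measurable X)
    (h01 : ∀ ω, X ω ∈ Set.Icc (0 : ℝ) 1) {θ : ℝ} :
    mgf X P θ ≤ Real.exp ((Real.exp θ - 1) * ∫ ω, X ω ∂P) := by
  have hint := integrable_of_mem_Icc_zero_one (P := P) hX h01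
  have hchord (ω) : Real.exp (θ * X ω) ≤ 1 + (Real.exp θ - 1) * X ω := by
    have := convexOn_exp.2 (Set.mem_univ 0) (Set.mem_univ θ)
      (sub_nonneg.2 (h01 ω).2) (h01 ω).1 (by ring)
    simp only [smul_eq_mul, mul_zero, zero_add, Real.exp_zero, mul_one] at this
    rw [mul_comm θ]
    linarith
  calc mgf X P θ ≤ ∫ ω, (1 + (Real.exp θ - 1) * X ω) ∂P :=
        integral_mono_of_nonneg (.of_forall fun ω => (Real.exp_pos _).le)
          ((integrable_const _).add (hint.const_mul _)) (.of_forall hchord)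
    _ = (Real.exp θ - 1) * ∫ ω, X ω ∂P + 1 := by
        rw [integral_add (integrable_const _) (hint.const_mul _), integral_const_mul]
        simp [add_comm]
    _ ≤ _ := Real.add_one_le_exp _

theorem measureReal_le_sum_le_exp {ι : Type*} {X : ι → Ω → ℝ} (hX : ∀ i, Measurable (X i))
    (h01 : ∀ i ω, X i ω ∈ Set.Icc (0 : ℝ) 1) (hind : iIndepFun X P) (s : Finset ι) {μ θ : ℝ}
    (hμ : ∑ i ∈ s, ∫ ω, X i ω ∂P ≤ μ) (hθ : 0 ≤ θ) (t : ℝ) :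
    P.real {ω | t ≤ ∑ i ∈ s, X i ω} ≤ Real.exp ((Real.exp θ - 1) * μ - θ * t) := by
  have hint : Integrable (fun ω => Real.exp (θ * (∑ i ∈ s, X i) ω)) P := by
    refine Integrable.of_bound (by fun_prop) (Real.exp (θ * s.card)) (.of_forall fun ω => ?_)
    rw [Real.norm_eq_abs, abs_of_pos (Real.exp_pos _), Finset.sum_apply]
    gcongr
    exact (Finset.sum_le_card_nsmul s _ 1 fun i _ => (h01 i ω).2).trans_eq (by simp)
  have hmgf : mgf (∑ i ∈ s, X i) P θ ≤ Real.exp ((Real.exp θ - 1) * μ) :=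
    calc mgf (∑ i ∈ s, X i) P θ
        ≤ ∏ i ∈ s, Real.exp ((Real.exp θ - 1) * ∫ ω, X i ω ∂P) := by
          rw [hind.mgf_sum hX]
          exact Finset.prod_le_prod (fun i _ => mgf_nonneg) fun i _ =>
            mgf_le_exp_of_mem_Icc_zero_one (hX i) (h01 i)
      _ ≤ _ := by
          rw [← Real.exp_sum, ← Finset.mul_sum]
          gcongr
          linarith [Real.add_one_le_exp θ]
  calc P.real {ω | t ≤ ∑ i ∈ s, X i ω}
      ≤ Real.exp (-θ * t) * mgf (∑ i ∈ s, X i) P θ := by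
        simpa only [Finset.sum_apply] using measure_ge_le_exp_mul_mgf t hθ hint
    _ ≤ Real.exp (-θ * t) * Real.exp ((Real.exp θ - 1) * μ) := by gcongr
    _ = _ := by rw [← Real.exp_add]; ring_nf

end Chernoff

section Independence

open scoped ENNReal

theorem measure_le_mul_of_indepFun {Ω α β : Type*} [MeasurableSpace Ω] [MeasurableSpace α]
    [MeasurableSpace β] {P : Measure Ω} [IsProbabilityMeasure P] {X : Ω → α} {Y : Ω → β}
    (hX : Measurable X) (hY : Measurable Y) (hXY : IndepFun X Y P) {V : Set α}
    (hV : MeasurableSet V) {A : Set (α × β)} (hA : MeasurableSet A) {δ : ℝ≥0∞}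
    (hδ : ∀ a ∈ V, P {ω | (a, Y ω) ∈ A} ≤ δ) :
    P {ω | X ω ∈ V ∧ (X ω, Y ω) ∈ A} ≤ δ * P {ω | X ω ∈ V} := by
  have hlaw := (indepFun_iff_map_prod_eq_prod_map_map hX.aemeasurable hY.aemeasurable).1 hXY
  have hVA : MeasurableSet (Prod.fst ⁻¹' V ∩ A) := (measurable_fst hV).inter hA
  have := Measure.isProbabilityMeasure_map (μ := P) hY.aemeasurable
  have hsection (a : α) :
      P.map Y (Prod.mk a ⁻¹' (Prod.fst ⁻¹' V ∩ A)) ≤ V.indicator (fun _ => δ) a := by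
    by_cases ha : a ∈ V
    · rw [Set.indicator_of_mem ha, Measure.map_apply hY (measurable_prodMk_left hVA)]
      exact (measure_mono fun ω hω => hω.2).trans (hδ a ha)
    · rw [Set.indicator_of_notMem ha]
      exact (measure_mono_null (t := ∅) (fun b hb => ha hb.1) measure_empty).le
  calc P {ω | X ω ∈ V ∧ (X ω, Y ω) ∈ A}
      = P.map (fun ω => (X ω, Y ω)) (Prod.fst ⁻¹' V ∩ A) := by
        rw [Measure.map_apply (hX.prodMk hY) hVA]; rfl
    _ = ∫⁻ a, P.map Y (Prod.mk a ⁻¹' (Prod.fst ⁻¹' V ∩ A)) ∂P.map X := by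
        rw [hlaw, Measure.prod_apply hVA]
    _ ≤ ∫⁻ a, V.indicator (fun _ => δ) a ∂P.map X := lintegral_mono hsection
    _ = δ * P {ω | X ω ∈ V} := by
        rw [lintegral_indicator_const hV, Measure.map_apply hX hV]; rfl

theorem one_sub_mul_measureReal_le_of_indepFun {Ω α β : Type*} [MeasurableSpace Ω]
    [MeasurableSpace α] [MeasurableSpace β] {P : Measure Ω} [IsProbabilityMeasure P] {X : Ω → α}
    {Y : Ω → β} (hX : Measurable X) (hY : Measurable Y) (hXY : IndepFun X Y P) {V : Set α}
    (hV : MeasurableSet V) {A : Set (α × β)} (hA : MeasurableSet A) {δ : ℝ} (hδ : 0 ≤ δ)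
    (h : ∀ a ∈ V, P.real {ω | (a, Y ω) ∈ A} ≤ δ) :
    (1 - δ) * P.real {ω | X ω ∈ V} ≤ P.real ({ω | X ω ∈ V} \ {ω | (X ω, Y ω) ∈ A}) := by
  have hbad : P.real ({ω | X ω ∈ V} ∩ {ω | (X ω, Y ω) ∈ A}) ≤ δ * P.real {ω | X ω ∈ V} := by
    have hle := measure_le_mul_of_indepFun hX hY hXY hV hA (δ := ENNReal.ofReal δ) fun a ha => by
      rw [← ofReal_measureReal]
      exact ENNReal.ofReal_le_ofReal (h a ha)
    have := ENNReal.toReal_mono (by finiteness) hle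
    rwa [ENNReal.toReal_mul, ENNReal.toReal_ofReal hδ] at this
  have hAm : MeasurableSet {ω | (X ω, Y ω) ∈ A} := (hX.prodMk hY) hA
  have hsplit := measureReal_sdiff_add_inter (μ := P) (s := {ω | X ω ∈ V}) hAm
  linarith

end Independence

section TotalProbability

theorem le_measureReal_of_mul_le_measureReal_inter {Ω ι : Type*} [MeasurableSpace Ω] [Finite ι]
    {P : Measure Ω} [IsProbabilityMeasure P] {E : ι → Set Ω} (hE : ∀ i, MeasurableSet (E i))
    (hdisj : Pairwise (Function.onFun (AEDisjoint P) E)) (hcover : ⋃ i, E i = Set.univ)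
    {A : Set Ω} {β : ℝ} (h : ∀ i, β * P.real (E i) ≤ P.real (E i ∩ A)) : β ≤ P.real A := by
  have := Fintype.ofFinite ι
  have htotal (Q : Measure Ω) [IsFiniteMeasure Q] (hQ : Q ≪ P) :
      ∑ i, Q.real (E i) = Q.real Set.univ :=
    calc ∑ i, Q.real (E i) = Q.real (⋃ i ∈ Finset.univ, E i) :=
          (measureReal_biUnion_finset₀ (fun i _ j _ hij => hQ (hdisj hij))
            fun i _ => (hE i).nullMeasurableSet).symm
      _ = Q.real Set.univ := by simp only [Finset.mem_univ, Set.iUnion_true, hcover]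
  calc β = ∑ i, β * P.real (E i) := by
        rw [← Finset.mul_sum, htotal P .rfl, probReal_univ, mul_one]
    _ ≤ ∑ i, (P.restrict A).real (E i) := Finset.sum_le_sum fun i _ => by
        rw [measureReal_restrict_apply (hE i)]
        exact h i
    _ = P.real A := by
        rw [htotal _ Measure.restrict_le_self.absolutelyContinuous,
          measureReal_restrict_apply_univ]

end TotalProbability

/-! ### Exponential variables -/

section Exponential

open scoped ENNReal

instance : IsProbabilityMeasure (expMeasure 1) := isProbabilityMeasure_expMeasure one_pos

theorem expMeasure_eq_withDensity (r : ℝ) :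
    expMeasure r = volume.withDensity (exponentialPDF r) := rfl

theorem measurable_exponentialPDF (r : ℝ) : Measurable (exponentialPDF r) :=
  (measurable_exponentialPDFReal r).ennreal_ofReal

theorem expMeasure_one_le : expMeasure 1 ≤ volume.restrict (Set.Ioi 0) := by
  rw [Measure.restrict_congr_set Ioi_ae_eq_Ici, expMeasure_eq_withDensity,
    ← withDensity_indicator_one measurableSet_Ici]
  refine withDensity_mono (.of_forall fun x => ?_)
  by_cases hx : 0 ≤ x
  · rw [exponentialPDF_of_nonneg hx, Set.indicator_of_mem (by exact hx)]
    simpa using hx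
  · rw [exponentialPDF_of_neg (not_le.1 hx)]
    exact zero_le

theorem ae_expMeasure_one_pos : ∀ᵐ x ∂expMeasure 1, 0 < x :=
  (Measure.absolutelyContinuous_of_le expMeasure_one_le).ae_le
    (ae_restrict_mem measurableSet_Ioi)

instance (r : ℝ) : NullSingletonClass (expMeasure r) :=
  ⟨fun x => withDensity_absolutelyContinuous _ _ (measure_singleton x)⟩

theorem exponentialPDF_eq_mul_sub {r a y : ℝ} (ha : 0 ≤ a) (hy : a ≤ y) :
    exponentialPDF r y = ENNReal.ofReal (Real.exp (-(r * a))) * exponentialPDF r (y - a) := by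
  rw [exponentialPDF_of_nonneg (ha.trans hy), exponentialPDF_of_nonneg (sub_nonneg.2 hy),
    ← ENNReal.ofReal_mul (Real.exp_pos _).le, mul_left_comm, ← Real.exp_add]
  ring_nf

theorem expMeasure_shift (r : ℝ) {a : ℝ} (ha : 0 ≤ a) {A : Set ℝ} (hA : MeasurableSet A) :
    expMeasure r {y | a ≤ y ∧ y - a ∈ A} =
      ENNReal.ofReal (Real.exp (-(r * a))) * expMeasure r A := by
  have hS : MeasurableSet {y : ℝ | a ≤ y ∧ y - a ∈ A} :=
    measurableSet_Ici.inter ((measurable_id.sub_const a) hA)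
  rw [expMeasure_eq_withDensity, withDensity_apply _ hA, withDensity_apply _ hS,
    ← lintegral_indicator hS, ← lintegral_indicator hA,
    ← lintegral_const_mul _ ((measurable_exponentialPDF r).indicator hA),
    ← lintegral_sub_right_eq_self
      (fun y => ENNReal.ofReal (Real.exp (-(r * a))) * A.indicator (exponentialPDF r) y) a]
  refine lintegral_congr fun y => ?_
  by_cases hy : a ≤ y <;> by_cases hyA : y - a ∈ A
  · rw [Set.indicator_of_mem (by exact ⟨hy, hyA⟩), Set.indicator_of_mem hyA,
      exponentialPDF_eq_mul_sub ha hy]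
  · rw [Set.indicator_of_notMem fun h => hyA h.2, Set.indicator_of_notMem hyA, mul_zero]
  · rw [Set.indicator_of_notMem fun h => hy h.1, Set.indicator_of_mem hyA,
      exponentialPDF_of_neg (by linarith), mul_zero]
  · rw [Set.indicator_of_notMem fun h => hy h.1, Set.indicator_of_notMem hyA, mul_zero]

theorem exponentialPDF_two_mul_le {r : ℝ} (hr : 0 ≤ r) (y : ℝ) :
    exponentialPDF r (2 * y) ≤ exponentialPDF r y := by
  rcases lt_or_ge y 0 with hy | hy
  · rw [exponentialPDF_of_neg (by linarith)]
    exact zero_le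
  · rw [exponentialPDF_of_nonneg hy, exponentialPDF_of_nonneg (by positivity)]
    refine ENNReal.ofReal_le_ofReal (mul_le_mul_of_nonneg_left (Real.exp_le_exp.2 ?_) hr)
    nlinarith [mul_nonneg hr hy]

theorem map_half_expMeasure_le {r : ℝ} (hr : 0 ≤ r) :
    (expMeasure r).map (fun y => y / 2) ≤ (2 : ℝ≥0) • expMeasure r := by
  refine Measure.le_iff.2 fun A hA => ?_
  have hm : Measurable fun y : ℝ => y / 2 := measurable_id.div_const 2
  have hvol : (volume : Measure ℝ) = (2 : ℝ≥0∞) • volume.map (fun x => 2 * x) := by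
    simpa using (Real.smul_map_volume_mul_left two_ne_zero).symm
  calc (expMeasure r).map (fun y => y / 2) A
      = ∫⁻ y, ((fun y => y / 2) ⁻¹' A).indicator (exponentialPDF r) y := by
        rw [Measure.map_apply hm hA, expMeasure_eq_withDensity, withDensity_apply _ (hm hA),
          ← lintegral_indicator (hm hA)]
    _ = 2 * ∫⁻ y, ((fun y => y / 2) ⁻¹' A).indicator (exponentialPDF r) (2 * y) := by
        conv_lhs => rw [hvol]
        rw [lintegral_smul_measure, smul_eq_mul,
          lintegral_map ((measurable_exponentialPDF r).indicator (hm hA)) (measurable_const_mul 2)]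
    _ ≤ 2 * ∫⁻ y, A.indicator (exponentialPDF r) y := by
        gcongr with y
        by_cases hyA : y ∈ A
        · rw [Set.indicator_of_mem (by simpa using hyA), Set.indicator_of_mem hyA]
          exact exponentialPDF_two_mul_le hr y
        · rw [Set.indicator_of_notMem (by simpa using hyA)]
          exact zero_le
    _ = ((2 : ℝ≥0) • expMeasure r) A := by
        rw [Measure.smul_apply, expMeasure_eq_withDensity, withDensity_apply _ hA,
          lintegral_indicator hA, ENNReal.smul_def]
        rfl

end Exponential

section Products

variable {ι : Type*} [Fintype ι]

theorem measure_pi_mono {α : ι → Type*} [∀ i, MeasurableSpace (α i)]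
    {μ ν : ∀ i, Measure (α i)} [∀ i, SigmaFinite (μ i)] (h : ∀ i, μ i ≤ ν i) :
    Measure.pi μ ≤ Measure.pi ν := by
  refine Measure.le_iff.2 fun A hA => ?_
  have hbox : (Measure.pi μ).toOuterMeasure ≤
      OuterMeasure.pi fun i => (ν i).toOuterMeasure := by
    refine OuterMeasure.le_pi.2 fun s _ => ?_
    change Measure.pi μ (Set.univ.pi s) ≤ _
    rw [Measure.pi_pi]
    exact Finset.prod_le_prod' fun i _ => h i (s i)
  refine (hbox A).trans_eq ?_
  rw [Measure.pi, toMeasure_apply _ _ hA]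

theorem measure_pi_const_smul {α : Type*} [MeasurableSpace α] (c : ℝ≥0) (μ : Measure α)
    [SigmaFinite μ] :
    Measure.pi (fun _ : ι => c • μ) = c ^ Fintype.card ι • Measure.pi fun _ : ι => μ := by
  refine Measure.pi_eq fun s _ => ?_
  simp only [Measure.smul_apply, Measure.pi_pi, ENNReal.smul_def, smul_eq_mul,
    Finset.prod_mul_distrib, Finset.prod_const, Finset.card_univ, ENNReal.coe_pow]

end Products

section ExponentialFamilies

open scoped ENNReal

/-- The joint law of independent `Exp[1]` variables indexed by `ι`. -/
noncomputable abbrev expPi (ι : Type*) [Fintype ι] : Measure (ι → ℝ) :=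
  Measure.pi fun _ => expMeasure 1

variable {α ι : Type*} [Fintype ι]

theorem map_half_expPi_le :
    (expPi ι).map (fun a i => a i / 2) ≤ (2 : ℝ≥0) ^ Fintype.card ι • expPi ι := by
  have hm : Measurable fun y : ℝ => y / 2 := measurable_id.div_const 2
  have := Measure.isProbabilityMeasure_map (μ := expMeasure 1) hm.aemeasurable
  rw [Measure.pi_map_pi (f := fun _ y => y / 2) fun _ => hm.aemeasurable, ← measure_pi_const_smul]
  exact measure_pi_mono fun _ => map_half_expMeasure_le zero_le_one

theorem expPi_restrict_map_sub {v : ι → ℝ} (hv : ∀ x, 0 ≤ v x) :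
    ((expPi ι).restrict {b | ∀ x, v x ≤ b x}).map (fun b x => b x - v x) =
      ENNReal.ofReal (Real.exp (-∑ x, v x)) • expPi ι := by
  set E : ℝ≥0∞ := ENNReal.ofReal (Real.exp (-∑ x, v x)) with hE
  have hE0 : E ≠ 0 := (ENNReal.ofReal_pos.2 (Real.exp_pos _)).ne'
  have hf : Measurable fun (b : ι → ℝ) x => b x - v x := by fun_prop
  suffices expPi ι = E⁻¹ • ((expPi ι).restrict {b | ∀ x, v x ≤ b x}).map (fun b x => b x - v x) by
    conv_rhs => rw [this]
    rw [smul_smul, ENNReal.mul_inv_cancel hE0 ENNReal.ofReal_ne_top, one_smul]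
  refine Measure.pi_eq fun A hA => ?_
  have hbox : (fun (b : ι → ℝ) x => b x - v x) ⁻¹' Set.univ.pi A ∩ {b | ∀ x, v x ≤ b x} =
      Set.univ.pi fun x => {y | v x ≤ y ∧ y - v x ∈ A x} := by
    ext b
    simp only [Set.mem_inter_iff, Set.mem_preimage, Set.mem_univ_pi, Set.mem_ofPred_eq,
      ← forall_and]
    exact forall_congr' fun x => and_comm
  have hprod : ∏ x, ENNReal.ofReal (Real.exp (-(1 * v x))) = E := by
    rw [← ENNReal.ofReal_prod_of_nonneg fun x _ => (Real.exp_pos _).le, ← Real.exp_sum, hE]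
    simp only [one_mul, Finset.sum_neg_distrib]
  rw [Measure.smul_apply, Measure.map_apply hf (MeasurableSet.univ_pi hA),
    Measure.restrict_apply (hf (MeasurableSet.univ_pi hA)), hbox, Measure.pi_pi,
    Finset.prod_congr rfl fun x _ => expMeasure_shift 1 (hv x) (hA x),
    Finset.prod_mul_distrib, hprod, smul_eq_mul, ← mul_assoc,
    ENNReal.inv_mul_cancel hE0 ENNReal.ofReal_ne_top, one_mul]

theorem expPi_shift {v : ι → ℝ} (hv : ∀ x, 0 ≤ v x) {G : Set (ι → ℝ)} (hG : MeasurableSet G) :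
    expPi ι {b | (∀ x, v x ≤ b x) ∧ (fun x => b x - v x) ∈ G} =
      ENNReal.ofReal (Real.exp (-∑ x, v x)) * expPi ι G := by
  have hf : Measurable fun (b : ι → ℝ) x => b x - v x := by fun_prop
  rw [← smul_eq_mul, ← Measure.smul_apply, ← expPi_restrict_map_sub hv, Measure.map_apply hf hG,
    Measure.restrict_apply (hf hG), Set.inter_comm]
  rfl

theorem prod_expPi_shift [MeasurableSpace α]
    (ν : Measure α) {s : α → ℝ} (hs : Measurable s) {w : ι → ℝ} (hw : ∀ x, 0 ≤ w x)
    {F : Set α} (hF : MeasurableSet F) (hF0 : ∀ a ∈ F, 0 ≤ s a) {G : Set (ι → ℝ)}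
    (hG : MeasurableSet G) :
    ν.prod (expPi ι) {z | z.1 ∈ F ∧ (∀ x, s z.1 * w x ≤ z.2 x) ∧
        (fun x => z.2 x - s z.1 * w x) ∈ G} =
      expPi ι G * ∫⁻ a in F, ENNReal.ofReal (Real.exp (-(s a * ∑ x, w x))) ∂ν := by
  have hle : MeasurableSet {z : α × (ι → ℝ) | ∀ x, s z.1 * w x ≤ z.2 x} := by
    rw [Set.ofPred_forall]
    exact MeasurableSet.iInter fun x => measurableSet_le (by fun_prop) (by fun_prop)
  have hsub : Measurable fun z : α × (ι → ℝ) => fun x => z.2 x - s z.1 * w x := by fun_prop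
  have hexp : Measurable fun a => ENNReal.ofReal (Real.exp (-(s a * ∑ x, w x))) := by fun_prop
  have hmeas : MeasurableSet {z : α × (ι → ℝ) | z.1 ∈ F ∧ (∀ x, s z.1 * w x ≤ z.2 x) ∧
      (fun x => z.2 x - s z.1 * w x) ∈ G} := (measurable_fst hF).inter (hle.inter (hsub hG))
  rw [Measure.prod_apply hmeas, ← lintegral_indicator hF,
    ← lintegral_const_mul _ (hexp.indicator hF)]
  refine lintegral_congr fun a => ?_
  by_cases ha : a ∈ F
  · rw [Set.indicator_of_mem ha, mul_comm, Finset.mul_sum,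
      ← expPi_shift (fun x => mul_nonneg (hF0 a ha) (hw x)) hG]
    congr 1
    ext b
    simp [ha]
  · rw [Set.indicator_of_notMem ha, mul_zero]
    exact measure_mono_null (t := ∅) (fun b hb => ha hb.1) measure_empty

theorem lintegral_exp_neg_tail_le {s : (ι → ℝ) → ℝ} (hs : Measurable s)
    (hs2 : ∀ a, s (fun i => a i / 2) = s a / 2) {F : Set (ι → ℝ)} (hF : MeasurableSet F)
    (hF2 : ∀ a, (fun i => a i / 2) ∈ F ↔ a ∈ F) {W : ℝ} (hW : 0 ≤ W) (T : ℝ) :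
    ∫⁻ a in F ∩ {a | T < s a}, ENNReal.ofReal (Real.exp (-(s a * W))) ∂expPi ι ≤
      ENNReal.ofReal (2 ^ Fintype.card ι * Real.exp (-(T * W / 2))) *
        ∫⁻ a in F, ENNReal.ofReal (Real.exp (-(s a * W))) ∂expPi ι := by
  set g : (ι → ℝ) → ℝ≥0∞ := F.indicator fun a => ENNReal.ofReal (Real.exp (-(s a * W))) with hg
  have hgm : Measurable g := Measurable.indicator (by fun_prop) hF
  have hTm : MeasurableSet {a | T < s a} := measurableSet_lt measurable_const hs
  have hhalf : Measurable fun (a : ι → ℝ) i => a i / 2 := by fun_prop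
  -- If `T < s a` then `s a * W ≥ T * W / 2 + s (a / 2) * W`.
  have hpoint (a) : (F ∩ {a | T < s a}).indicator
      (fun a => ENNReal.ofReal (Real.exp (-(s a * W)))) a ≤
      ENNReal.ofReal (Real.exp (-(T * W / 2))) * g (fun i => a i / 2) := by
    by_cases ha : a ∈ F ∩ {a | T < s a}
    · rw [Set.indicator_of_mem ha, hg, Set.indicator_of_mem ((hF2 a).2 ha.1), hs2,
        ← ENNReal.ofReal_mul (Real.exp_pos _).le, ← Real.exp_add]
      have : T < s a := ha.2
      exact ENNReal.ofReal_le_ofReal (Real.exp_le_exp.2 (by nlinarith))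
    · rw [Set.indicator_of_notMem ha]
      exact zero_le
  rw [← lintegral_indicator (hF.inter hTm), ← lintegral_indicator hF]
  calc _ ≤ ∫⁻ a, ENNReal.ofReal (Real.exp (-(T * W / 2))) * g (fun i => a i / 2) ∂expPi ι :=
        lintegral_mono hpoint
    _ = ENNReal.ofReal (Real.exp (-(T * W / 2))) *
          ∫⁻ a, g a ∂(expPi ι).map (fun a i => a i / 2) := by
        rw [lintegral_map hgm hhalf]
        exact lintegral_const_mul _ (hgm.comp hhalf)
    _ ≤ ENNReal.ofReal (Real.exp (-(T * W / 2))) *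
          ∫⁻ a, g a ∂((2 : ℝ≥0) ^ Fintype.card ι • expPi ι) := by
        gcongr
        exact map_half_expPi_le
    _ = _ := by
        rw [ENNReal.smul_def, lintegral_smul_measure, smul_eq_mul, ← mul_assoc,
          mul_comm (2 ^ _) (Real.exp _), ENNReal.ofReal_mul (Real.exp_pos _).le,
          ENNReal.ofReal_pow zero_le_two]
        norm_num [hg]

end ExponentialFamilies

section Moments

theorem integral_expMeasure_one_le {X : ℝ → ℝ} (hX0 : ∀ r, 0 ≤ X r)
    (hX : IntegrableOn X (Set.Ioi 0)) : ∫ r, X r ∂expMeasure 1 ≤ ∫ r in Set.Ioi 0, X r :=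
  integral_mono_measure expMeasure_one_le (.of_forall hX0) hX

theorem expMeasure_one_real_Iio_le {b : ℝ} (hb : 0 ≤ b) : (expMeasure 1).real (Set.Iio b) ≤ b := by
  refine ENNReal.toReal_le_of_le_ofReal hb ((expMeasure_one_le _).trans_eq ?_)
  rw [Measure.restrict_apply measurableSet_Iio, Set.Iio_inter_Ioi, Real.volume_Ioo, sub_zero]

/-- The function `min 1 ((a / r) ^ ρ)` of `r > 0`, continued by `1` to `r ≤ 0` so that it is
antitone. It bounds the ratio of the transformed frequency of a key to a reference level. -/
noncomputable def decay (ρ a r : ℝ) : ℝ := if r ≤ a then 1 else (a / r) ^ ρ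

variable {ρ a r : ℝ}

theorem decay_of_le (h : r ≤ a) : decay ρ a r = 1 := if_pos h

theorem decay_of_lt (h : a < r) : decay ρ a r = (a / r) ^ ρ := if_neg h.not_ge

theorem decay_of_lt' (ha : 0 ≤ a) (h : a < r) : decay ρ a r = a ^ ρ * r ^ (-ρ) := by
  have hr : 0 ≤ r := ha.trans h.le
  rw [decay_of_lt h, Real.div_rpow ha hr, Real.rpow_neg hr, div_eq_mul_inv]

theorem measurable_decay (ρ a : ℝ) : Measurable (decay ρ a) :=
  Measurable.ite measurableSet_Iic measurable_const
    ((measurable_const.div measurable_id).pow_const ρ)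

theorem decay_mem_Icc (hρ : 0 ≤ ρ) (ha : 0 ≤ a) (r : ℝ) : decay ρ a r ∈ Set.Icc (0 : ℝ) 1 := by
  rcases le_or_gt r a with h | h
  · simp [decay_of_le h]
  · have hr : 0 ≤ r := ha.trans h.le
    rw [decay_of_lt h]
    exact ⟨Real.rpow_nonneg (div_nonneg ha hr) _,
      Real.rpow_le_one (div_nonneg ha hr) (div_le_one_of_le₀ h.le hr) hρ⟩

theorem decay_antitone (hρ : 0 ≤ ρ) (ha : 0 ≤ a) : Antitone (decay ρ a) := by
  intro r r' hrr
  rcases le_or_gt r a with h | h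
  · exact (decay_mem_Icc hρ ha r').2.trans_eq (decay_of_le h).symm
  · rw [decay_of_lt h, decay_of_lt (h.trans_le hrr)]
    have hr : 0 < r := ha.trans_lt h
    exact Real.rpow_le_rpow (div_nonneg ha (hr.le.trans hrr))
      (div_le_div_of_nonneg_left ha hr hrr) hρ

theorem integrableOn_decay_Ioc : IntegrableOn (decay ρ a) (Set.Ioc 0 a) :=
  (integrableOn_const (C := (1 : ℝ)) (by simp)).congr_fun
    (fun _ hr => (decay_of_le hr.2).symm) measurableSet_Ioc

theorem setIntegral_decay_Ioc (ha : 0 ≤ a) : ∫ r in Set.Ioc 0 a, decay ρ a r = a := by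
  rw [setIntegral_congr_fun (g := fun _ => (1 : ℝ)) measurableSet_Ioc
    fun r hr => decay_of_le hr.2]
  simp [ha]

theorem integral_decay_le (hρ : 1 < ρ) (ha : 0 < a) :
    ∫ r, decay ρ a r ∂expMeasure 1 ≤ a * (ρ / (ρ - 1)) := by
  have hIoi : IntegrableOn (decay ρ a) (Set.Ioi a) :=
    IntegrableOn.congr_fun
      ((integrableOn_Ioi_rpow_of_lt (by linarith) ha).const_mul (a ^ ρ))
      (fun r hr => (decay_of_lt' ha.le hr).symm) measurableSet_Ioi
  have htail : ∫ r in Set.Ioi a, decay ρ a r = a / (ρ - 1) := by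
    rw [setIntegral_congr_fun measurableSet_Ioi fun r hr => decay_of_lt' ha.le hr,
      integral_const_mul, integral_Ioi_rpow_of_lt (by linarith) ha, mul_div_assoc', mul_neg,
      ← Real.rpow_add ha, show -ρ + 1 = -(ρ - 1) by ring, neg_div_neg_eq]
    simp
  have hunion : Set.Ioi 0 = Set.Ioc 0 a ∪ Set.Ioi a := (Set.Ioc_union_Ioi_eq_Ioi ha.le).symm
  calc ∫ r, decay ρ a r ∂expMeasure 1 ≤ ∫ r in Set.Ioi 0, decay ρ a r :=
        integral_expMeasure_one_le (fun r => (decay_mem_Icc (by linarith) ha.le r).1)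
          (hunion ▸ integrableOn_decay_Ioc.union hIoi)
    _ = a + a / (ρ - 1) := by
        rw [hunion, setIntegral_union (Set.Ioc_disjoint_Ioi le_rfl) measurableSet_Ioi
          integrableOn_decay_Ioc hIoi, setIntegral_decay_Ioc ha.le, htail]
    _ = a * (ρ / (ρ - 1)) := by
        have : ρ - 1 ≠ 0 := by linarith
        field_simp
        ring

variable {b : ℝ}

theorem integrableOn_decay_one_Ioc (ha : 0 < a) :
    IntegrableOn (decay 1 a) (Set.Ioc a b) := by
  have hinv : IntegrableOn (fun r : ℝ => a * r⁻¹) (Set.Ioc a b) :=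
    (ContinuousOn.integrableOn_Icc (continuousOn_const.mul
      (continuousOn_inv₀.mono fun r hr => (ha.trans_le hr.1).ne'))).mono_set Set.Ioc_subset_Icc_self
  refine hinv.congr_fun (fun r hr => ?_) measurableSet_Ioc
  rw [decay_of_lt hr.1, Real.rpow_one, div_eq_mul_inv]

theorem setIntegral_decay_one_Ioc (ha : 0 < a) (hab : a ≤ b) :
    ∫ r in Set.Ioc a b, decay 1 a r = a * Real.log (b / a) := by
  rw [setIntegral_congr_fun (g := fun r => a * r⁻¹) measurableSet_Ioc fun r hr => by
      rw [decay_of_lt hr.1, Real.rpow_one, div_eq_mul_inv],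
    integral_const_mul, ← intervalIntegral.integral_of_le hab,
    integral_inv_of_pos ha (ha.trans_le hab)]

theorem integral_indicator_decay_one_le (ha : 0 < a) (hab : a ≤ b) :
    ∫ r, (Set.Iic b).indicator (decay 1 a) r ∂expMeasure 1 ≤ a * (1 + Real.log (b / a)) := by
  have hset : Set.Iic b ∩ Set.Ioi 0 = Set.Ioc 0 a ∪ Set.Ioc a b := by
    rw [Set.Ioc_union_Ioc_eq_Ioc ha.le hab, Set.Iic_inter_Ioi]
  have hint : IntegrableOn ((Set.Iic b).indicator (decay 1 a)) (Set.Ioi 0) := by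
    rw [IntegrableOn, integrable_indicator_iff measurableSet_Iic, IntegrableOn,
      Measure.restrict_restrict measurableSet_Iic, hset]
    exact integrableOn_decay_Ioc.union (integrableOn_decay_one_Ioc ha)
  refine (integral_expMeasure_one_le (Set.indicator_nonneg fun r _ =>
    (decay_mem_Icc zero_le_one ha.le r).1) hint).trans_eq ?_
  rw [integral_indicator measurableSet_Iic, Measure.restrict_restrict measurableSet_Iic, hset,
    setIntegral_union (Set.Ioc_disjoint_Ioc_of_le le_rfl) measurableSet_Ioc
      integrableOn_decay_Ioc (integrableOn_decay_one_Ioc ha),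
    setIntegral_decay_Ioc ha.le, setIntegral_decay_one_Ioc ha hab]
  ring

theorem integral_decay_one_le (ha : 0 < a) {N : ℝ} (hN : 1 ≤ N) :
    ∫ r, decay 1 a r ∂expMeasure 1 ≤ a * (1 + Real.log N) + 1 / N := by
  have hN0 : 0 < N := by linarith
  have haN : a ≤ N * a := le_mul_of_one_le_left ha.le hN
  have hmem := decay_mem_Icc zero_le_one ha.le
  set Y : ℝ → ℝ := (Set.Iic (N * a)).indicator (decay 1 a) with hY
  have hle (r) : decay 1 a r ≤ Y r + 1 / N := by
    rcases le_or_gt r (N * a) with hr | hr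
    · rw [hY, Set.indicator_of_mem (by exact hr)]
      exact le_add_of_nonneg_right (by positivity)
    · rw [hY, Set.indicator_of_notMem (by exact hr.not_ge), zero_add,
        decay_of_lt (haN.trans_lt hr), Real.rpow_one,
        div_le_div_iff₀ (ha.trans (haN.trans_lt hr)) hN0]
      linarith
  have hYint : Integrable Y (expMeasure 1) :=
    (integrable_of_mem_Icc_zero_one (measurable_decay 1 a) hmem).indicator measurableSet_Iic
  calc ∫ r, decay 1 a r ∂expMeasure 1 ≤ ∫ r, (Y r + 1 / N) ∂expMeasure 1 :=
        integral_mono (integrable_of_mem_Icc_zero_one (measurable_decay 1 a) hmem)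
          (hYint.add (integrable_const _)) hle
    _ = ∫ r, Y r ∂expMeasure 1 + 1 / N := by
        rw [integral_add hYint (integrable_const _)]
        simp
    _ ≤ a * (1 + Real.log N) + 1 / N := by
        gcongr
        simpa [mul_div_cancel_right₀ _ ha.ne'] using integral_indicator_decay_one_le ha haN

end Moments

section Concentration

variable {ι : Type*} [Fintype ι]

theorem expPi_le_sum_le_exp {g : ι → ℝ → ℝ} (hg : ∀ x, Measurable (g x))
    (h01 : ∀ x r, g x r ∈ Set.Icc (0 : ℝ) 1) {μ t k : ℝ}
    (hμ : ∑ x, ∫ r, g x r ∂expMeasure 1 ≤ μ) (ht : 2 * μ + k ≤ t) :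
    expPi ι {b | t ≤ ∑ x, g x (b x)} ≤ ENNReal.ofReal (Real.exp (-k)) := by
  have hind : iIndepFun (fun (x : ι) (b : ι → ℝ) => g x (b x)) (expPi ι) :=
    iIndepFun_pi (X := g) fun x => (hg x).aemeasurable
  have hmean (x) : ∫ b : ι → ℝ, g x (b x) ∂expPi ι = ∫ r, g x r ∂expMeasure 1 :=
    integral_comp_eval (μ := fun _ : ι => expMeasure 1) (hg x).aestronglyMeasurable
  have hchernoff := measureReal_le_sum_le_exp (X := fun (x : ι) (b : ι → ℝ) => g x (b x))
    (fun x => (hg x).comp (measurable_pi_apply x)) (fun x b => h01 x (b x)) hind Finset.univ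
    (μ := μ) (θ := 1) (by simpa only [hmean] using hμ) zero_le_one t
  have hμ0 : 0 ≤ μ :=
    (Finset.sum_nonneg fun x _ => integral_nonneg fun r => (h01 x r).1).trans hμ
  rw [← ofReal_measureReal]
  refine ENNReal.ofReal_le_ofReal (hchernoff.trans (Real.exp_le_exp.2 ?_))
  nlinarith [Real.exp_one_lt_three]

theorem measurableSet_le_sum {g : ι → ℝ → ℝ} (hg : ∀ x, Measurable (g x)) (t : ℝ) :
    MeasurableSet {b : ι → ℝ | t ≤ ∑ x, g x (b x)} :=
  measurableSet_le measurable_const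
    (Finset.measurable_sum _ fun x _ => (hg x).comp (measurable_pi_apply x))

end Concentration

section OrderStatistics

open scoped ENNReal

variable {ι : Type*} {k : ℕ} {c : Fin k → ℝ} {j : Fin k} {w : ι → ℝ}

/-- The vectors `a ≥ 0` whose weighted coordinates `a i / c i` are in increasing order. -/
def orderedCone (c : Fin k → ℝ) : Set (Fin k → ℝ) :=
  {a | (∀ i, 0 ≤ a i) ∧ Monotone fun i => a i / c i}

/-- The event that the weighted variables `z.1 i / c i` are in increasing order and that all
`z.2 x / w x` are at least `z.1 j / c j`. For the last index `j` it says which `k` of all weighted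
variables are smallest, and in which order. -/
def smallestEvent (c : Fin k → ℝ) (j : Fin k) (w : ι → ℝ) : Set ((Fin k → ℝ) × (ι → ℝ)) :=
  {z | z.1 ∈ orderedCone c ∧ ∀ x, z.1 j / c j * w x ≤ z.2 x}

theorem measurableSet_orderedCone (c : Fin k → ℝ) : MeasurableSet (orderedCone c) := by
  simp only [orderedCone, Monotone, Set.ofPred_and, Set.ofPred_forall]
  refine .inter (.iInter fun i => ?_) (.iInter fun i => .iInter fun i' => .iInter fun _ => ?_) <;>
    exact measurableSet_le (by fun_prop) (by fun_prop)

theorem half_mem_orderedCone {a : Fin k → ℝ} :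
    (fun i => a i / 2) ∈ orderedCone c ↔ a ∈ orderedCone c := by
  simp only [orderedCone, Set.mem_ofPred_eq, Monotone, div_right_comm _ (2 : ℝ),
    div_le_div_iff_of_pos_right (two_pos (α := ℝ))]
  exact and_congr_left'
    (forall_congr' fun i => ⟨fun h => by linarith, fun h => by linarith⟩)

theorem measurableSet_smallestEvent [Countable ι] (c : Fin k → ℝ) (j : Fin k) (w : ι → ℝ) :
    MeasurableSet (smallestEvent c j w) := by
  have hle : MeasurableSet {z : (Fin k → ℝ) × (ι → ℝ) | ∀ x, z.1 j / c j * w x ≤ z.2 x} := by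
    rw [Set.ofPred_forall]
    exact .iInter fun x => measurableSet_le (by fun_prop) (by fun_prop)
  exact (measurable_fst (measurableSet_orderedCone c)).inter hle

/-- What remains of the variables `z.2` beyond the level of `z.1 j / c j`. -/
noncomputable def excess (c : Fin k → ℝ) (j : Fin k) (w : ι → ℝ) (z : (Fin k → ℝ) × (ι → ℝ)) :
    ι → ℝ :=
  fun x => z.2 x - z.1 j / c j * w x

variable [Fintype ι]

/-- The event that `z.1 j / c j` and the next weighted variable `z.2 x / w x` are at most `M`, while
fewer than `513 * k` of the `z.2 x / w x` are below `16 * M` and their decayed sum is below `Λ`. -/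
def balancedEvent (c : Fin k → ℝ) (j : Fin k) (w : ι → ℝ) (M ρ Λ : ℝ) :
    Set ((Fin k → ℝ) × (ι → ℝ)) :=
  {z | z.1 j / c j ≤ M ∧ (∃ x, z.2 x ≤ M * w x) ∧
    ∑ x, (Set.Iio (16 * (M * w x))).indicator 1 (z.2 x) < 513 * (k : ℝ) ∧
    ∑ x, decay ρ (M * w x) (z.2 x) < Λ}

theorem prod_excess_mem_eq_mul_lintegral (hc : 0 < c j) (hw : ∀ x, 0 ≤ w x) {F : Set (Fin k → ℝ)}
    (hF : MeasurableSet F) {G : Set (ι → ℝ)} (hG : MeasurableSet G) :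
    (expPi (Fin k)).prod (expPi ι)
        {z | z ∈ smallestEvent c j w ∧ z.1 ∈ F ∧ excess c j w z ∈ G} =
      expPi ι G * ∫⁻ a in orderedCone c ∩ F,
        ENNReal.ofReal (Real.exp (-(a j / c j * ∑ x, w x))) ∂expPi (Fin k) := by
  rw [← prod_expPi_shift (expPi (Fin k)) (s := fun a => a j / c j) (by fun_prop) hw
    ((measurableSet_orderedCone c).inter hF) (fun a ha => div_nonneg (ha.1.1 j) hc.le) hG]
  congr 1
  ext z
  simp only [smallestEvent, Set.mem_ofPred_eq, Set.mem_inter_iff]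
  tauto

theorem prod_smallestEvent (hc : 0 < c j) (hw : ∀ x, 0 ≤ w x) :
    (expPi (Fin k)).prod (expPi ι) (smallestEvent c j w) =
      ∫⁻ a in orderedCone c,
        ENNReal.ofReal (Real.exp (-(a j / c j * ∑ x, w x))) ∂expPi (Fin k) := by
  simpa using prod_excess_mem_eq_mul_lintegral hc hw .univ .univ

-- The exponential law is memoryless.
theorem prod_excess_mem (hc : 0 < c j) (hw : ∀ x, 0 ≤ w x) {G : Set (ι → ℝ)}
    (hG : MeasurableSet G) :
    (expPi (Fin k)).prod (expPi ι) {z | z ∈ smallestEvent c j w ∧ excess c j w z ∈ G} =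
      expPi ι G * (expPi (Fin k)).prod (expPi ι) (smallestEvent c j w) := by
  rw [prod_smallestEvent hc hw]
  simpa using prod_excess_mem_eq_mul_lintegral hc hw .univ hG

theorem two_le_exp_natCast (hk : 1 ≤ k) : 2 ≤ Real.exp k := by
  have : (1 : ℝ) ≤ k := by exact_mod_cast hk
  linarith [Real.add_one_le_exp (k : ℝ)]

theorem prod_smallestEvent_tail_le (hc : 0 < c j) (hw : ∀ x, 0 ≤ w x) {M : ℝ}
    (hMW : M * ∑ x, w x = 16 * k) :
    (expPi (Fin k)).prod (expPi ι) {z | z ∈ smallestEvent c j w ∧ M / 2 < z.1 j / c j} ≤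
      ENNReal.ofReal (Real.exp (-k) / 2) *
        (expPi (Fin k)).prod (expPi ι) (smallestEvent c j w) := by
  have hs : Measurable fun a : Fin k → ℝ => a j / c j := by fun_prop
  have hsplit := prod_excess_mem_eq_mul_lintegral hc hw
    (measurableSet_lt (measurable_const (a := M / 2)) hs) .univ
  have htail := lintegral_exp_neg_tail_le hs (fun a => div_right_comm _ _ _)
    (measurableSet_orderedCone c) (fun a => half_mem_orderedCone)
    (W := ∑ x, w x) (Finset.sum_nonneg fun x _ => hw x) (M / 2)
  have hexp : (2 : ℝ) ^ k * Real.exp (-(M / 2 * (∑ x, w x) / 2)) ≤ Real.exp (-k) / 2 := by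
    have hpow : (2 : ℝ) ^ k ≤ Real.exp k := by
      rw [← Real.exp_one_pow]
      gcongr
      simpa using two_le_exp_natCast le_rfl
    rw [show M / 2 * (∑ x, w x) / 2 = 4 * k by linarith, le_div_iff₀ two_pos]
    calc 2 ^ k * Real.exp (-(4 * (k : ℝ))) * 2
        ≤ Real.exp k * Real.exp (-(4 * (k : ℝ))) * Real.exp k := by
          gcongr
          exact two_le_exp_natCast j.pos
      _ = Real.exp (-(2 * (k : ℝ))) := by rw [← Real.exp_add, ← Real.exp_add]; congr 1; ring
      _ ≤ Real.exp (-k) := Real.exp_le_exp.2 (by linarith [k.cast_nonneg (α := ℝ)])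
  simp only [Set.mem_univ, and_true, Set.mem_ofPred_eq, measure_univ, one_mul] at hsplit
  rw [hsplit, prod_smallestEvent hc hw]
  refine htail.trans (mul_le_mul_left (ENNReal.ofReal_le_ofReal ?_) _)
  rwa [Fintype.card_fin]

theorem expPi_forall_le_le_half_exp (hk : 1 ≤ k) (hw : ∀ x, 0 ≤ w x) {M : ℝ} (hM : 0 ≤ M)
    (hMW : M * ∑ x, w x = 16 * k) :
    expPi ι {b | ∀ x, M / 2 * w x ≤ b x} ≤ ENNReal.ofReal (Real.exp (-k) / 2) := by
  have hshift := expPi_shift (v := fun x => M / 2 * w x)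
    (fun x => mul_nonneg (by linarith) (hw x)) MeasurableSet.univ
  simp only [Set.mem_univ, and_true, measure_univ, mul_one] at hshift
  rw [hshift, ← Finset.mul_sum, show M / 2 * ∑ x, w x = 8 * k by linarith]
  refine ENNReal.ofReal_le_ofReal ?_
  rw [le_div_iff₀ two_pos]
  calc Real.exp (-(8 * (k : ℝ))) * 2 ≤ Real.exp (-(8 * (k : ℝ))) * Real.exp k := by
        gcongr
        exact two_le_exp_natCast hk
    _ = Real.exp (-(7 * (k : ℝ))) := by rw [← Real.exp_add]; congr 1; ring
    _ ≤ Real.exp (-k) := Real.exp_le_exp.2 (by linarith [k.cast_nonneg (α := ℝ)])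

theorem measurable_indicator_Iio (b : ℝ) : Measurable ((Set.Iio b).indicator (1 : ℝ → ℝ)) :=
  measurable_one.indicator measurableSet_Iio

theorem expPi_card_lt_le_exp (hw : ∀ x, 0 ≤ w x) {M : ℝ} (hM : 0 ≤ M)
    (hMW : M * ∑ x, w x = 16 * k) :
    expPi ι {b | 513 * (k : ℝ) ≤ ∑ x, (Set.Iio (16 * (M * w x))).indicator 1 (b x)} ≤
      ENNReal.ofReal (Real.exp (-k)) := by
  refine expPi_le_sum_le_exp (μ := 256 * k) (fun x => measurable_indicator_Iio _)
    (fun x r => ?_) ?_ (by linarith)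
  · exact ⟨Set.indicator_nonneg (fun _ _ => zero_le_one) r,
      Set.indicator_le' (fun _ _ => le_rfl) (fun _ _ => zero_le_one) r⟩
  · calc ∑ x, ∫ r, (Set.Iio (16 * (M * w x))).indicator 1 r ∂expMeasure 1
        ≤ ∑ x, 16 * (M * w x) := Finset.sum_le_sum fun x _ => by
          rw [integral_indicator_one measurableSet_Iio]
          exact expMeasure_one_real_Iio_le
            (mul_nonneg (by norm_num) (mul_nonneg hM (hw x)))
      _ = 256 * k := by rw [← Finset.mul_sum, ← Finset.mul_sum, hMW]; ring

theorem smallestEvent_sdiff_balancedEvent_subset (hc : 0 < c j) (hw : ∀ x, 0 ≤ w x) {M ρ Λ : ℝ}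
    (hM : 0 ≤ M) (hρ : 0 ≤ ρ) :
    smallestEvent c j w \ balancedEvent c j w M ρ Λ ⊆
      ({z | z ∈ smallestEvent c j w ∧ M / 2 < z.1 j / c j} ∪
        {z | z ∈ smallestEvent c j w ∧ excess c j w z ∈ {b | ∀ x, M / 2 * w x ≤ b x}}) ∪
      ({z | z ∈ smallestEvent c j w ∧ excess c j w z ∈
          {b | 513 * (k : ℝ) ≤ ∑ x, (Set.Iio (16 * (M * w x))).indicator 1 (b x)}} ∪
        {z | z ∈ smallestEvent c j w ∧ excess c j w z ∈
          {b | Λ ≤ ∑ x, decay ρ (M * w x) (b x)}}) := by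
  rintro z ⟨hz, hbad⟩
  by_contra hcon
  simp only [Set.mem_union, Set.mem_ofPred_eq, hz, true_and, not_or, not_lt, not_le,
    not_forall] at hcon
  obtain ⟨⟨hs, x, hx⟩, hcount, hdecay⟩ := hcon
  have hle (x) : excess c j w z x ≤ z.2 x :=
    sub_le_self _ (mul_nonneg (div_nonneg (hz.1.1 j) hc.le) (hw x))
  refine hbad ⟨by linarith, ⟨x, ?_⟩, ?_, ?_⟩
  · have : z.1 j / c j * w x ≤ M / 2 * w x := mul_le_mul_of_nonneg_right hs (hw x)
    simp only [excess] at hx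
    linarith
  · refine (Finset.sum_le_sum fun x _ => ?_).trans_lt hcount
    by_cases hx : z.2 x < 16 * (M * w x)
    · rw [Set.indicator_of_mem (by exact hx), Set.indicator_of_mem (by exact (hle x).trans_lt hx)]
      exact le_rfl
    · rw [Set.indicator_of_notMem (by exact hx)]
      exact Set.indicator_nonneg (fun _ _ => zero_le_one) _
  · exact (Finset.sum_le_sum fun x _ =>
      decay_antitone hρ (mul_nonneg hM (hw x)) (hle x)).trans_lt hdecay

theorem prod_smallestEvent_sdiff_balancedEvent_le (hc : 0 < c j) (hw : ∀ x, 0 ≤ w x)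
    {M ρ μ Λ : ℝ} (hM : 0 ≤ M) (hMW : M * ∑ x, w x = 16 * k) (hρ : 0 ≤ ρ)
    (hμ : ∑ x, ∫ r, decay ρ (M * w x) r ∂expMeasure 1 ≤ μ) (hΛ : 2 * μ + k ≤ Λ) :
    (expPi (Fin k)).prod (expPi ι) (smallestEvent c j w \ balancedEvent c j w M ρ Λ) ≤
      ENNReal.ofReal (3 * Real.exp (-k)) *
        (expPi (Fin k)).prod (expPi ι) (smallestEvent c j w) := by
  have hexcess {G : Set (ι → ℝ)} (hG : MeasurableSet G) {β : ℝ≥0∞} (hβ : expPi ι G ≤ β) :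
      (expPi (Fin k)).prod (expPi ι) {z | z ∈ smallestEvent c j w ∧ excess c j w z ∈ G} ≤
        β * (expPi (Fin k)).prod (expPi ι) (smallestEvent c j w) := by
    rw [prod_excess_mem hc hw hG]
    gcongr
  have hfirst := prod_smallestEvent_tail_le hc hw hMW
  have hnext := hexcess (measurableSet_Ici (a := fun x => M / 2 * w x))
    (expPi_forall_le_le_half_exp j.pos hw hM hMW)
  have hcount := hexcess (measurableSet_le_sum (fun x => measurable_indicator_Iio _) _)
    (expPi_card_lt_le_exp hw hM hMW)
  have hdecay := hexcess (measurableSet_le_sum (fun x => measurable_decay ρ (M * w x)) Λ)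
    (expPi_le_sum_le_exp (fun x => measurable_decay ρ (M * w x))
      (fun x => decay_mem_Icc hρ (mul_nonneg hM (hw x))) hμ hΛ)
  refine (measure_mono (smallestEvent_sdiff_balancedEvent_subset hc hw hM hρ)).trans
    ((measure_union_le _ _).trans ((add_le_add
      ((measure_union_le _ _).trans (add_le_add hfirst hnext))
      ((measure_union_le _ _).trans (add_le_add hcount hdecay))).trans_eq ?_))
  have hexp := (Real.exp_pos (-(k : ℝ))).le
  rw [← add_mul, ← add_mul, ← add_mul, ← ENNReal.ofReal_add (by positivity) (by positivity),
    ← ENNReal.ofReal_add hexp hexp, ← ENNReal.ofReal_add (by positivity) (by positivity)]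
  congr 2
  ring

end OrderStatistics

/-! ### Ranking keys -/

section TopKeys

variable {κ : Type*}

/-- The position of a key in the order that `rank` counts in: by decreasing value of `f`, ties
being broken by the linear order of the keys. -/
def precedence (f : κ → ℝ≥0) (x : κ) : ℝ≥0ᵒᵈ ×ₗ κ := toLex (OrderDual.toDual (f x), x)

theorem precedence_injective (f : κ → ℝ≥0) : Function.Injective (precedence f) :=
  fun _ _ h => (Prod.mk.inj (toLex.injective h)).2

variable [LinearOrder κ] {s t : Finset κ} {f g : κ → ℝ≥0} {x y : κ} {m : ℕ}

theorem precedence_lt_of_lt (h : f y < f x) : precedence f x < precedence f y :=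
  Prod.Lex.toLex_lt_toLex.2 (.inl (OrderDual.toDual_lt_toDual.2 h))

theorem rank_eq_card_precedence_lt (s : Finset κ) (f : κ → ℝ≥0) (x : κ) :
    rank s f x = (s.filter fun y => precedence f y < precedence f x).card := by
  rw [rank]
  congr 1
  ext y
  simp [precedence, Prod.Lex.toLex_lt_toLex]

theorem rank_mono (h : s ⊆ t) (f : κ → ℝ≥0) (x : κ) : rank s f x ≤ rank t f x := by
  simp only [rank_eq_card_precedence_lt]
  exact Finset.card_le_card (Finset.filter_subset_filter _ h)

theorem rank_congr (h : ∀ y ∈ s, f y = g y) (hx : x ∈ s) : rank s f x = rank s g x := by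
  rw [rank, rank, Finset.filter_congr fun y hy => by rw [h y hy, h x hx]]

theorem rank_lt_rank (hx : x ∈ s) (h : precedence f x < precedence f y) :
    rank s f x < rank s f y := by
  simp only [rank_eq_card_precedence_lt]
  refine Finset.card_lt_card (Finset.ssubset_iff_of_subset ?_ |>.2 ⟨x, ?_, ?_⟩)
  · exact Finset.monotone_filter_right s fun z _ hz => hz.trans h
  · exact Finset.mem_filter.2 ⟨hx, h⟩
  · simp

theorem rank_injOn (s : Finset κ) (f : κ → ℝ≥0) : Set.InjOn (rank s f) s := by
  intro x hx y hy h
  by_contra hne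
  rcases lt_or_gt_of_ne ((precedence_injective f).ne hne) with hlt | hlt
  · exact (rank_lt_rank hx hlt).ne h
  · exact (rank_lt_rank hy hlt).ne' h

theorem rank_lt_card (hx : x ∈ s) : rank s f x < s.card := by
  rw [rank_eq_card_precedence_lt]
  exact Finset.card_lt_card (Finset.filter_ssubset.2 ⟨x, hx, lt_irrefl _⟩)

theorem image_rank (s : Finset κ) (f : κ → ℝ≥0) : s.image (rank s f) = Finset.range s.card := by
  refine Finset.eq_of_subset_of_card_le ?_ ?_
  · exact Finset.image_subset_iff.2 fun x hx => Finset.mem_range.2 (rank_lt_card hx)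
  · rw [Finset.card_image_of_injOn (rank_injOn s f), Finset.card_range]

theorem le_of_rank_le (hx : x ∈ s) (h : rank s f y ≤ rank s f x) : f x ≤ f y := by
  by_contra! hlt
  exact (rank_lt_rank hx (precedence_lt_of_lt hlt)).not_ge h

theorem mem_topKeys : x ∈ topKeys m s f ↔ x ∈ s ∧ rank s f x < m := Finset.mem_filter

theorem topKeys_subset (m : ℕ) (s : Finset κ) (f : κ → ℝ≥0) : topKeys m s f ⊆ s :=
  Finset.filter_subset _ _

theorem le_rank_of_notMem_topKeys (hx : x ∈ s) (hm : x ∉ topKeys m s f) : m ≤ rank s f x := by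
  by_contra! h
  exact hm (mem_topKeys.2 ⟨hx, h⟩)

theorem topKeys_congr (h : ∀ y ∈ s, f y = g y) : topKeys m s f = topKeys m s g :=
  Finset.filter_congr fun _ hx => by rw [rank_congr h hx]

theorem nextLargest_congr (h : ∀ y ∈ s, f y = g y) : nextLargest m s f = nextLargest m s g := by
  rw [nextLargest, nextLargest, topKeys_congr h]
  exact Finset.sup_congr rfl fun y hy => h y (Finset.mem_sdiff.1 hy).1

theorem card_topKeys (m : ℕ) (s : Finset κ) (f : κ → ℝ≥0) :
    (topKeys m s f).card = min m s.card := by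
  calc (topKeys m s f).card = ((topKeys m s f).image (rank s f)).card :=
        (Finset.card_image_of_injOn ((rank_injOn s f).mono (topKeys_subset m s f))).symm
    _ = ((Finset.range s.card).filter (· < m)).card := by
        rw [← image_rank s f, Finset.filter_image, topKeys]
    _ = (Finset.range (min m s.card)).card := by
        congr 1
        ext i
        simp [and_comm]
    _ = min m s.card := Finset.card_range _

theorem card_topKeys_le (m : ℕ) (s : Finset κ) (f : κ → ℝ≥0) : (topKeys m s f).card ≤ m :=
  (card_topKeys m s f).trans_le (min_le_left _ _)

theorem card_topKeys_of_notMem (hx : x ∈ s) (hm : x ∉ topKeys m s f) :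
    (topKeys m s f).card = m := by
  rw [card_topKeys, min_eq_left ((le_rank_of_notMem_topKeys hx hm).trans (rank_lt_card hx).le)]

theorem le_of_mem_topKeys_of_notMem (hx : x ∈ s) (hxm : x ∉ topKeys m s f)
    (hy : y ∈ topKeys m s f) : f x ≤ f y :=
  le_of_rank_le hx ((mem_topKeys.1 hy).2.le.trans (le_rank_of_notMem_topKeys hx hxm))

theorem mem_topKeys_of_subset (hst : s ⊆ t) (hxs : x ∈ s) (hx : x ∈ topKeys m t f) :
    x ∈ topKeys m s f :=
  mem_topKeys.2 ⟨hxs, (rank_mono hst f x).trans_lt (mem_topKeys.1 hx).2⟩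

theorem topKeys_eq_of_subset (hts : t ⊆ s) (h : topKeys m s f ⊆ t) :
    topKeys m t f = topKeys m s f := by
  refine (Finset.eq_of_subset_of_card_le (fun x hx => ?_) ?_).symm
  · exact mem_topKeys_of_subset hts (h hx) hx
  · rw [card_topKeys, card_topKeys]
    exact min_le_min_left _ (Finset.card_le_card hts)

theorem exists_mem_sdiff_topKeys (hx : m < (t.filter fun y => f x ≤ f y).card) :
    ∃ z ∈ t \ topKeys m t f, f x ≤ f z := by
  obtain ⟨z, hz, hz'⟩ :=
    Finset.exists_mem_notMem_of_card_lt_card ((card_topKeys_le m t f).trans_lt hx)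
  rw [Finset.mem_filter] at hz
  exact ⟨z, Finset.mem_sdiff.2 ⟨hz.1, hz'⟩, hz.2⟩

end TopKeys

/-! ### Data sets and aggregations -/

section DataSets

variable {κ κ' : Type*}

theorem Aggregation.dataset_map (g : DataElement κ → DataElement κ') (a : Aggregation κ) :
    (a.map g).dataset = a.dataset.map g := by
  induction a with
  | empty => rfl
  | process a e ih => simp [Aggregation.map, Aggregation.dataset, ih]
  | merge a b iha ihb => simp [Aggregation.map, Aggregation.dataset, iha, ihb]

variable [DecidableEq κ]

@[simp] theorem freq_zero (x : κ) : freq (0 : Multiset (DataElement κ)) x = 0 := by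
  simp [freq]

theorem freq_cons (e : DataElement κ) (D : Multiset (DataElement κ)) (x : κ) :
    freq (e ::ₘ D) x = freq D x + if e.key = x then e.val else 0 := by
  by_cases h : e.key = x <;> simp [freq, h, add_comm]

theorem freq_add (D D' : Multiset (DataElement κ)) (x : κ) :
    freq (D + D') x = freq D x + freq D' x := by
  simp [freq]

@[simp] theorem keys_zero : keys (0 : Multiset (DataElement κ)) = ∅ := rfl

theorem keys_cons (e : DataElement κ) (D : Multiset (DataElement κ)) :
    keys (e ::ₘ D) = insert e.key (keys D) := by
  simp [keys]

theorem keys_add (D D' : Multiset (DataElement κ)) :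
    keys (D + D') = keys D ∪ keys D' := by
  simp [keys]

theorem mem_keys_of_mem {D : Multiset (DataElement κ)} {e : DataElement κ} (he : e ∈ D) :
    e.key ∈ keys D :=
  Multiset.mem_toFinset.2 (Multiset.mem_map_of_mem _ he)

theorem freq_eq_zero_of_notMem {D : Multiset (DataElement κ)} {x : κ} (h : x ∉ keys D) :
    freq D x = 0 := by
  have hD : D.filter (fun e => e.key = x) = 0 :=
    Multiset.filter_eq_nil.2 fun e he hex => h (hex ▸ mem_keys_of_mem he)
  simp [freq, hD]

end DataSets

/-! ### The structure of the second pass -/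

section TopSketch

variable {κ : Type*} [LinearOrder κ] {m : ℕ} {prio : κ → ℝ≥0} {D : Multiset (DataElement κ)}
  {T : TopState κ} {s : Finset κ} {x : κ}

/-- The state that the top-`m` structure should have after the data set `D`: the `m` keys of
highest priority with their exact frequencies. -/
structure IsTopState (m : ℕ) (prio : κ → ℝ≥0) (D : Multiset (DataElement κ))
    (T : TopState κ) : Prop where
  keys_eq : T.keys = topKeys m (keys D) prio
  val_eq : ∀ x ∈ T.keys, T.val x = freq D x

-- A key that is not stored but survives among more keys does not occur in `D`, so that the value
-- `0` that is read off for it is exact.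
theorem IsTopState.val_eq_freq (hT : IsTopState m prio D T) (hs : keys D ⊆ s)
    (hx : x ∈ topKeys m s prio) : T.val x = freq D x := by
  by_cases hxT : x ∈ T.keys
  · exact hT.val_eq x hxT
  · rw [T.val_eq_zero x hxT, freq_eq_zero_of_notMem fun hxD => hxT ?_]
    exact hT.keys_eq ▸ mem_topKeys_of_subset hs hxD hx

theorem IsTopState.mem_keys (hT : IsTopState m prio D T) (hs : keys D ⊆ s) (hxD : x ∈ keys D)
    (hx : x ∈ topKeys m s prio) : x ∈ T.keys :=
  hT.keys_eq ▸ mem_topKeys_of_subset hs hxD hx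

theorem IsTopState.keys_subset (hT : IsTopState m prio D T) : T.keys ⊆ keys D :=
  hT.keys_eq ▸ topKeys_subset _ _ _

theorem isTopState_retain {v : κ → ℝ} (hs : s ⊆ keys D) (hsub : topKeys m (keys D) prio ⊆ s)
    (hv : ∀ x ∈ topKeys m (keys D) prio, v x = freq D x) :
    IsTopState m prio D (retain m prio s v) := by
  have hkeys : topKeys m s prio = topKeys m (keys D) prio := topKeys_eq_of_subset hs hsub
  refine ⟨hkeys, fun x hx => ?_⟩
  rw [← hv x (hkeys ▸ hx)]
  exact if_pos hx

theorem IsTopState.process (hT : IsTopState m prio D T) (e : DataElement κ) :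
    IsTopState m prio (e ::ₘ D) ((topSketch m prio).process T e) := by
  have hsub : keys D ⊆ keys (e ::ₘ D) := keys_cons e D ▸ Finset.subset_insert _ _
  refine isTopState_retain ?_ (fun x hx => ?_) fun x hx => ?_
  · exact keys_cons e D ▸ Finset.insert_subset_insert _ hT.keys_subset
  · rcases Finset.mem_insert.1 (keys_cons e D ▸ topKeys_subset _ _ _ hx) with rfl | hxD
    · exact Finset.mem_insert_self _ _
    · exact Finset.mem_insert_of_mem (hT.mem_keys hsub hxD hx)
  · rw [freq_cons, hT.val_eq_freq hsub hx]

theorem IsTopState.merge {D' : Multiset (DataElement κ)} {T' : TopState κ}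
    (hT : IsTopState m prio D T) (hT' : IsTopState m prio D' T') :
    IsTopState m prio (D + D') ((topSketch m prio).merge T T') := by
  have hsub : keys D ⊆ keys (D + D') := keys_add D D' ▸ Finset.subset_union_left
  have hsub' : keys D' ⊆ keys (D + D') := keys_add D D' ▸ Finset.subset_union_right
  refine isTopState_retain ?_ (fun x hx => ?_) fun x hx => ?_
  · exact keys_add D D' ▸ Finset.union_subset_union hT.keys_subset hT'.keys_subset
  · rcases Finset.mem_union.1 (keys_add D D' ▸ topKeys_subset _ _ _ hx) with hxD | hxD
    · exact Finset.mem_union_left _ (hT.mem_keys hsub hxD hx)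
    · exact Finset.mem_union_right _ (hT'.mem_keys hsub' hxD hx)
  · rw [freq_add, hT.val_eq_freq hsub hx, hT'.val_eq_freq hsub' hx]

theorem isTopState_run (m : ℕ) (prio : κ → ℝ≥0) (a : Aggregation κ) :
    IsTopState m prio a.dataset ((topSketch m prio).run a) := by
  induction a with
  | empty => exact ⟨rfl, fun x hx => absurd hx (Finset.notMem_empty x)⟩
  | process a e ih => exact ih.process e
  | merge a b iha ihb => exact iha.merge ihb

theorem card_keys_topSketch_run_le (m : ℕ) (prio : κ → ℝ≥0) (a : Aggregation κ) :
    ((topSketch m prio).run a).keys.card ≤ m := by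
  rw [(isTopState_run m prio a).keys_eq]
  exact card_topKeys_le _ _ _

end TopSketch

/-! ### Exactness of the two-pass sample -/

section Exactness

variable {κ : Type*} [LinearOrder κ] {k m : ℕ} {s t : Finset κ} {f prio : κ → ℝ≥0} {ε : ℝ} {x y : κ}

theorem le_three_mul_of_notMem_topKeys (herr : ∀ x ∈ s, |(prio x : ℝ) - f x| ≤ ε)
    (hm : (s.filter fun x => ε < f x).card < m) (hx : x ∈ s) (hxm : x ∉ topKeys m s prio) :
    (f x : ℝ) ≤ 3 * ε := by
  by_contra! hlt
  refine hm.not_ge ?_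
  rw [← card_topKeys_of_notMem hx hxm]
  refine Finset.card_le_card fun y hy => ?_
  have hys : y ∈ s := topKeys_subset _ _ _ hy
  have hxy : (prio x : ℝ) ≤ prio y := NNReal.coe_le_coe.2 (le_of_mem_topKeys_of_notMem hx hxm hy)
  have hxerr := abs_le.1 (herr x hx)
  have hyerr := abs_le.1 (herr y hys)
  exact Finset.mem_filter.2 ⟨hys, by linarith⟩

theorem lt_card_filter_le_of_notMem_topKeys (hkm : k < m)
    (herr : ∀ x ∈ s, |(prio x : ℝ) - f x| ≤ ε) (hm : (s.filter fun x => ε < f x).card < m)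
    (hk : k < (s.filter fun x => 3 * ε < f x).card ∨ ε = 0) (hx : x ∈ s)
    (hxm : x ∉ topKeys m s prio) :
    k < ((topKeys m s prio).filter fun y => f x ≤ f y).card := by
  have hsmall : ∀ {y}, y ∈ s → y ∉ topKeys m s prio → (f y : ℝ) ≤ 3 * ε :=
    le_three_mul_of_notMem_topKeys herr hm
  rcases hk with hk | rfl
  · refine hk.trans_le (Finset.card_le_card fun y hy => ?_)
    rw [Finset.mem_filter] at hy ⊢
    exact ⟨not_imp_comm.1 (hsmall hy.1) hy.2.not_ge,
      NNReal.coe_le_coe.1 ((hsmall hx hxm).trans hy.2.le)⟩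
  · have hfx : f x = 0 :=
      NNReal.coe_eq_zero.1 (le_antisymm (by simpa using hsmall hx hxm) (f x).coe_nonneg)
    simpa [hfx, card_topKeys_of_notMem hx hxm] using hkm

theorem le_of_mem_topKeys_of_dominated (hdom : ∀ y ∈ s, y ∉ t → ∃ z ∈ t \ topKeys k t f, f y ≤ f z)
    (hx : x ∈ topKeys k t f) (hy : y ∈ s) (hyk : y ∉ topKeys k t f) : f y ≤ f x := by
  by_cases hyt : y ∈ t
  · exact le_of_mem_topKeys_of_notMem hyt hyk hx
  · obtain ⟨z, hz, hyz⟩ := hdom y hy hyt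
    rw [Finset.mem_sdiff] at hz
    exact hyz.trans (le_of_mem_topKeys_of_notMem hz.1 hz.2 hx)

theorem nextLargest_eq_sup_of_dominated (hts : t ⊆ s)
    (hdom : ∀ y ∈ s, y ∉ t → ∃ z ∈ t \ topKeys k t f, f y ≤ f z) :
    nextLargest k t f = (s \ topKeys k t f).sup f := by
  refine le_antisymm (Finset.sup_mono (Finset.sdiff_subset_sdiff hts subset_rfl)) ?_
  refine Finset.sup_le fun y hy => ?_
  rw [Finset.mem_sdiff] at hy
  by_cases hyt : y ∈ t
  · exact Finset.le_sup (Finset.mem_sdiff.2 ⟨hyt, hy.2⟩)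
  · obtain ⟨z, hz, hyz⟩ := hdom y hy.1 hyt
    exact hyz.trans (Finset.le_sup hz)

theorem transformed_congr {κ : Type*} {p : ℝ} {r v v' : κ → ℝ} {x : κ} (h : v x = v' x) :
    transformed p r v x = transformed p r v' x := by
  rw [transformed, transformed, h]

-- The margin `3 ε` against `ε` leaves room for an error of `ε` in each of the two estimates that
-- are compared when a key is ejected. If `ε = 0`, the estimates are exact.
theorem isExactSample_twoPassSample {σ : Type*} {n : ℕ} (R : FrequencySketch n σ) {p : ℝ}
    {keyHash : κ → Fin n} {r : κ → ℝ} {D : Multiset (DataElement κ)}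
    {a₁ a₂ : Aggregation κ} (h₂ : a₂.dataset = D) (hkm : k < m)
    (herr : ∀ x ∈ keys D, |‖R.est (passOne R p keyHash r a₁) (keyHash x)‖ -
      transformed p r (freq D) x| ≤ ε)
    (hm : ((keys D).filter fun x => ε < transformed p r (freq D) x).card < m)
    (hk : k < ((keys D).filter fun x => 3 * ε < transformed p r (freq D) x).card ∨ ε = 0) :
    IsExactSample p k r D (twoPassSample R p k m keyHash r a₁ a₂) := by
  subst h₂
  set D := a₂.dataset
  set f : κ → ℝ≥0 := transformed p r (freq D)
  set T : TopState κ := passTwo R p m keyHash r a₁ a₂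
  have hT : IsTopState m _ D T := isTopState_run _ _ _
  have hdom : ∀ y ∈ keys D, y ∉ T.keys → ∃ z ∈ T.keys \ topKeys k T.keys f, f y ≤ f z := by
    intro y hy hyT
    rw [hT.keys_eq] at hyT ⊢
    exact exists_mem_sdiff_topKeys
      (lt_card_filter_le_of_notMem_topKeys hkm herr hm hk hy hyT)
  have hcongr : ∀ x ∈ T.keys, transformed p r T.val x = f x :=
    fun x hx => transformed_congr (hT.val_eq x hx)
  have hkeys : (twoPassSample R p k m keyHash r a₁ a₂).keys = topKeys k T.keys f :=
    topKeys_congr hcongr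
  have hthreshold : (twoPassSample R p k m keyHash r a₁ a₂).threshold = nextLargest k T.keys f :=
    nextLargest_congr hcongr
  constructor
  case subset => exact hkeys ▸ (topKeys_subset _ _ _).trans hT.keys_subset
  case card => rw [hkeys, card_topKeys, hT.keys_eq, card_topKeys, ← min_assoc, min_eq_left hkm.le]
  case top =>
    rw [hkeys]
    exact fun x hx y hy hyk => le_of_mem_topKeys_of_dominated hdom hx hy hyk
  case val => exact hkeys ▸ fun x hx => hT.val_eq x (topKeys_subset _ _ _ hx)
  case threshold => rw [hthreshold, hkeys, nextLargest_eq_sup_of_dominated hT.keys_subset hdom]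

end Exactness

/-! ### The elements of the first pass -/

section OutputElements

variable {κ : Type*} [DecidableEq κ] {n : ℕ}

theorem freq_map_outputElement (p : ℝ) (keyHash : κ → Fin n) (r : κ → ℝ)
    (D : Multiset (DataElement κ)) {s : Finset κ} (hs : keys D ⊆ s) (z : Fin n) :
    freq (D.map (outputElement p keyHash r)) z =
      ∑ x ∈ s with keyHash x = z, freq D x / r x ^ (1 / p) := by
  induction D using Multiset.induction_on with
  | empty => simp
  | cons e D ih =>
    rw [keys_cons, Finset.insert_subset_iff] at hs
    rw [Multiset.map_cons, freq_cons, ih hs.2]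
    simp only [freq_cons, add_div, Finset.sum_add_distrib, ite_div, zero_div, Finset.sum_ite_eq,
      Finset.mem_filter, hs.1, true_and, outputElement]
    rfl

theorem freq_map_outputElement_of_injOn (p : ℝ) {keyHash : κ → Fin n} (r : κ → ℝ)
    {D : Multiset (DataElement κ)} (hinj : Set.InjOn keyHash (keys D)) {x : κ}
    (hx : x ∈ keys D) :
    freq (D.map (outputElement p keyHash r)) (keyHash x) = freq D x / r x ^ (1 / p) := by
  have hfiber : (keys D).filter (fun y => keyHash y = keyHash x) = {x} := by
    ext y
    simp only [Finset.mem_filter, Finset.mem_singleton]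
    exact ⟨fun hy => hinj hy.1 hx hy.2, by rintro rfl; exact ⟨hx, rfl⟩⟩
  rw [freq_map_outputElement p keyHash r D subset_rfl, hfiber, Finset.sum_singleton]

theorem freq_map_outputElement_of_notMem (p : ℝ) {keyHash : κ → Fin n} (r : κ → ℝ)
    {D : Multiset (DataElement κ)} {z : Fin n} (hz : z ∉ (keys D).image keyHash) :
    freq (D.map (outputElement p keyHash r)) z = 0 := by
  rw [freq_map_outputElement p keyHash r D subset_rfl, Finset.filter_eq_empty_iff.2,
    Finset.sum_empty]
  exact fun x hx hxz => hz (Finset.mem_image.2 ⟨x, hx, hxz⟩)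

end OutputElements

/-! ### CountSketch -/

section Median

variable {d : ℕ} {f : Fin d → ℝ} {a b v ε : ℝ}

theorem median_eq_sort (hd : 0 < d) (f : Fin d → ℝ) :
    median f = f (Tuple.sort f ⟨d / 2, Nat.div_lt_self hd one_lt_two⟩) := dif_pos hd

theorem median_le_of_card_lt (h : (Finset.univ.filter fun i => b < f i).card < d - d / 2) :
    median f ≤ b := by
  have hd : 0 < d := by omega
  by_contra! hlt
  rw [median_eq_sort hd] at hlt
  refine h.not_ge ?_
  calc d - d / 2 = ((Finset.Ici (⟨d / 2, Nat.div_lt_self hd one_lt_two⟩ : Fin d)).image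
        (Tuple.sort f)).card := by
        rw [Finset.card_image_of_injective _ (Tuple.sort f).injective, Fin.card_Ici]
    _ ≤ _ := Finset.card_le_card <| Finset.image_subset_iff.2 fun j hj => Finset.mem_filter.2
        ⟨Finset.mem_univ _, hlt.trans_le (Tuple.monotone_sort f (Finset.mem_Ici.1 hj))⟩

theorem le_median_of_card_le (hd : 0 < d)
    (h : (Finset.univ.filter fun i => f i < a).card ≤ d / 2) : a ≤ median f := by
  by_contra! hlt
  rw [median_eq_sort hd] at hlt
  refine (Nat.lt_succ_of_le h).not_ge ?_
  calc d / 2 + 1 = ((Finset.Iic (⟨d / 2, Nat.div_lt_self hd one_lt_two⟩ : Fin d)).image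
        (Tuple.sort f)).card := by
        rw [Finset.card_image_of_injective _ (Tuple.sort f).injective, Fin.card_Iic]
    _ ≤ _ := Finset.card_le_card <| Finset.image_subset_iff.2 fun j hj => Finset.mem_filter.2
        ⟨Finset.mem_univ _, (Tuple.monotone_sort f (Finset.mem_Iic.1 hj)).trans_lt hlt⟩

theorem abs_median_sub_le (h : (Finset.univ.filter fun i => ε < |f i - v|).card < d - d / 2) :
    |median f - v| ≤ ε := by
  have hupper : (Finset.univ.filter fun i => v + ε < f i) ⊆
      Finset.univ.filter fun i => ε < |f i - v| :=
    Finset.monotone_filter_right _ fun i _ hi => lt_abs.2 (.inl (by linarith))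
  have hlower : (Finset.univ.filter fun i => f i < v - ε) ⊆
      Finset.univ.filter fun i => ε < |f i - v| :=
    Finset.monotone_filter_right _ fun i _ hi => lt_abs.2 (.inr (by linarith))
  have hle := median_le_of_card_lt ((Finset.card_le_card hupper).trans_lt h)
  have hge := le_median_of_card_le (by omega) ((Finset.card_le_card hlower).trans (by omega))
  exact abs_le.2 ⟨by linarith, by linarith⟩

end Median

section CountSketch

variable {n d w : ℕ}

/-- The estimate of the frequency of `x` from a single row of `CountSketch`, with bucket hash `h`
and sign hash `s`, when the frequencies are `f`. -/
noncomputable def rowEstimate (h : Fin n → Fin w) (s : Fin n → Bool) (f : Fin n → ℝ)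
    (x : Fin n) : ℝ :=
  sgn (s x) * ∑ y with h y = h x, sgn (s y) * f y

theorem countSketch_run (h : Fin d → Fin n → Fin w) (s : Fin d → Fin n → Bool)
    (a : Aggregation (Fin n)) (i : Fin d) (b : Fin w) :
    (countSketch d w h s).run a i b =
      ∑ y with h i y = b, sgn (s i y) * freq a.dataset y := by
  induction a with
  | empty => simp [ComposableSketch.run, countSketch, Aggregation.dataset]
  | process a e ih =>
    change (countSketch d w h s).run a i b +
      (if h i e.key = b then sgn (s i e.key) * e.val else 0) = _
    rw [ih, Aggregation.dataset]
    simp [freq_cons, mul_add, Finset.sum_add_distrib]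
  | merge a a' iha ihb =>
    change (countSketch d w h s).run a i b + (countSketch d w h s).run a' i b = _
    rw [iha, ihb, Aggregation.dataset]
    simp only [freq_add, mul_add, Finset.sum_add_distrib]

theorem countSketch_est_run (h : Fin d → Fin n → Fin w) (s : Fin d → Fin n → Bool)
    (a : Aggregation (Fin n)) (x : Fin n) :
    (countSketch d w h s).est ((countSketch d w h s).run a) x =
      median fun i => rowEstimate (h i) (s i) (freq a.dataset) x := by
  change (median fun i => sgn (s i x) * (countSketch d w h s).run a i (h i x)) = _
  simp only [countSketch_run, rowEstimate]

end CountSketch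

/-! ### Counters -/

section Counters

variable {n m : ℕ}

theorem le_nextLargest_of_notMem {κ : Type*} [LinearOrder κ] {s : Finset κ} {f : κ → ℝ≥0} {x : κ}
    (hx : x ∈ s) (hm : x ∉ topKeys m s f) : f x ≤ nextLargest m s f :=
  Finset.le_sup (Finset.mem_sdiff.2 ⟨hx, hm⟩)

theorem exists_card_eq_of_nextLargest_ne_zero {κ : Type*} [LinearOrder κ] {s : Finset κ}
    {f : κ → ℝ≥0} (h : nextLargest m s f ≠ 0) :
    ∃ t ⊆ s, t.card = m + 1 ∧ ∀ x ∈ t, nextLargest m s f ≤ f x := by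
  have hne : (s \ topKeys m s f).Nonempty :=
    Finset.nonempty_iff_ne_empty.2 fun hempty => h (by rw [nextLargest, hempty]; rfl)
  obtain ⟨z, hz, hzmax⟩ := Finset.exists_mem_eq_sup _ hne f
  obtain ⟨hzs, hzm⟩ := Finset.mem_sdiff.1 hz
  refine ⟨insert z (topKeys m s f), ?_, ?_, fun x hx => ?_⟩
  · exact Finset.insert_subset hzs (topKeys_subset _ _ _)
  · rw [Finset.card_insert_of_notMem hzm, card_topKeys_of_notMem hzs hzm]
  · rw [nextLargest, hzmax]
    rcases Finset.mem_insert.1 hx with rfl | hx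
    · exact le_rfl
    · exact le_of_mem_topKeys_of_notMem hzs hzm hx

theorem sum_reduceCounters_add_le (c : Fin n → ℝ≥0) :
    ∑ x, reduceCounters m c x + (m + 1) * nextLargest m Finset.univ c ≤ ∑ x, c x := by
  rcases eq_or_ne (nextLargest m Finset.univ c) 0 with hzero | hne
  · simp only [reduceCounters, hzero, tsub_zero, mul_zero, add_zero, le_refl]
  · obtain ⟨t, -, hcard, ht⟩ := exists_card_eq_of_nextLargest_ne_zero hne
    have hsum : (m + 1) * nextLargest m Finset.univ c =
        ∑ x, if x ∈ t then nextLargest m Finset.univ c else 0 := by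
      simp [hcard]
    rw [hsum, ← Finset.sum_add_distrib]
    refine Finset.sum_le_sum fun x _ => ?_
    rw [reduceCounters]
    split_ifs with hx
    · rw [tsub_add_cancel_of_le (ht x hx)]
    · rw [add_zero]
      exact tsub_le_self

theorem card_reduceCounters_ne_zero_le (c : Fin n → ℝ≥0) :
    (Finset.univ.filter fun x => reduceCounters m c x ≠ 0).card ≤ m := by
  refine (Finset.card_le_card fun x hx => ?_).trans (card_topKeys_le m Finset.univ c)
  by_contra hxm
  exact (Finset.mem_filter.1 hx).2
    (tsub_eq_zero_of_le (le_nextLargest_of_notMem (Finset.mem_univ x) hxm))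

theorem counters_words_run_le (a : Aggregation (Fin n)) :
    (counters n m).words ((counters n m).run a) ≤ 2 * m := by
  refine Nat.mul_le_mul_left 2 ?_
  cases a with
  | empty => simp [ComposableSketch.run, counters]
  | process a e => exact card_reduceCounters_ne_zero_le _
  | merge a b => exact card_reduceCounters_ne_zero_le _

/-- The invariant of the counter-based sketch: counters `c` for the frequencies `f`, each of which
has lost at most `Δ`, where every loss of `δ` by a counter comes with a loss of `(m + 1) δ` by the
sum of all counters. -/
structure IsCounterState (m : ℕ) (f : Fin n → ℝ) (c : Fin n → ℝ≥0) (Δ : ℝ) : Prop where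
  sub_le : ∀ x, f x - Δ ≤ c x
  le : ∀ x, (c x : ℝ) ≤ f x
  sum_add_le : ∑ x, (c x : ℝ) + (m + 1) * Δ ≤ ∑ x, f x

variable {f f' : Fin n → ℝ} {c c' : Fin n → ℝ≥0} {Δ Δ' : ℝ}

theorem IsCounterState.reduce (h : IsCounterState m f c Δ) :
    IsCounterState m f (reduceCounters m c) (Δ + nextLargest m Finset.univ c) where
  sub_le x := by
    have hle : (c x : ℝ) ≤ reduceCounters m c x + nextLargest m Finset.univ c := by
      exact_mod_cast (le_tsub_add : c x ≤ c x - nextLargest m Finset.univ c + _)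
    linarith [h.sub_le x]
  le x := (NNReal.coe_le_coe.2 tsub_le_self).trans (h.le x)
  sum_add_le := by
    have hsum : ∑ x, (reduceCounters m c x : ℝ) + (m + 1) * (nextLargest m Finset.univ c : ℝ) ≤
        ∑ x, (c x : ℝ) := by exact_mod_cast sum_reduceCounters_add_le c
    linarith [h.sum_add_le]

theorem IsCounterState.add (h : IsCounterState m f c Δ) (h' : IsCounterState m f' c' Δ') :
    IsCounterState m (fun x => f x + f' x) (fun x => c x + c' x) (Δ + Δ') where
  sub_le x := by
    push_cast
    linarith [h.sub_le x, h'.sub_le x]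
  le x := by
    push_cast
    exact add_le_add (h.le x) (h'.le x)
  sum_add_le := by
    push_cast
    rw [Finset.sum_add_distrib, Finset.sum_add_distrib]
    linarith [h.sum_add_le, h'.sum_add_le]

theorem isCounterState_toNNReal (m : ℕ) (hf : ∀ x, 0 ≤ f x) :
    IsCounterState m f (fun x => (f x).toNNReal) 0 where
  sub_le x := by simp
  le x := (Real.coe_toNNReal _ (hf x)).le
  sum_add_le := by simp [hf]

theorem exists_isCounterState_run (m : ℕ) {a : Aggregation (Fin n)}
    (ha : ∀ e ∈ a.dataset, 0 ≤ e.val) :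
    ∃ Δ, IsCounterState m (freq a.dataset) ((counters n m).run a) Δ := by
  induction a with
  | empty =>
    refine ⟨0, ?_⟩
    have hzero := isCounterState_toNNReal (f := freq (0 : Multiset (DataElement (Fin n)))) m
      fun x => (freq_zero x).ge
    simp only [freq_zero, Real.toNNReal_zero] at hzero
    exact hzero
  | process a e ih =>
    obtain ⟨Δ, hΔ⟩ := ih fun e' he' => ha e' (Multiset.mem_cons_of_mem he')
    have he : 0 ≤ e.val := ha e (Multiset.mem_cons_self _ _)
    have hsingle : IsCounterState m (fun x => if e.key = x then e.val else 0)
        (fun x => if e.key = x then e.val.toNNReal else 0) 0 := by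
      simpa only [apply_ite Real.toNNReal, Real.toNNReal_zero] using
        isCounterState_toNNReal m fun x => ite_nonneg he le_rfl
    rw [Aggregation.dataset, funext (freq_cons e a.dataset)]
    exact ⟨_, (hΔ.add hsingle).reduce⟩
  | merge a b iha ihb =>
    obtain ⟨Δ, hΔ⟩ := iha fun e he => ha e (Multiset.mem_add.2 (.inl he))
    obtain ⟨Δ', hΔ'⟩ := ihb fun e he => ha e (Multiset.mem_add.2 (.inr he))
    rw [Aggregation.dataset, funext (freq_add a.dataset b.dataset)]
    exact ⟨_, (hΔ.add hΔ').reduce⟩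

theorem IsCounterState.loss_le (h : IsCounterState m f c Δ) (J : Finset (Fin n)) :
    (m + 1 - J.card) * Δ ≤ ∑ x ∈ Finset.univ \ J, f x := by
  have hJ : ∑ x ∈ J, (f x - Δ) ≤ ∑ x, (c x : ℝ) :=
    (Finset.sum_le_sum fun x _ => h.sub_le x).trans
      (Finset.sum_le_sum_of_subset_of_nonneg (Finset.subset_univ _) fun x _ _ => (c x).2)
  rw [Finset.sum_sub_distrib, Finset.sum_const, nsmul_eq_mul] at hJ
  have hsplit := Finset.sum_sdiff (f := f) (Finset.subset_univ J)
  linarith [h.sum_add_le]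

theorem abs_counters_est_sub_le {a : Aggregation (Fin n)} (ha : ∀ e ∈ a.dataset, 0 ≤ e.val)
    {J : Finset (Fin n)} (hJ : J.card ≤ m) {ε : ℝ}
    (hε : ∑ x ∈ Finset.univ \ J, freq a.dataset x ≤ (m + 1 - J.card) * ε) (x : Fin n) :
    |(counters n m).est ((counters n m).run a) x - freq a.dataset x| ≤ ε := by
  obtain ⟨Δ, hΔ⟩ := exists_isCounterState_run m ha
  have hcard : (J.card : ℝ) ≤ m := by exact_mod_cast hJ
  have hle : Δ ≤ ε := le_of_mul_le_mul_left ((hΔ.loss_le J).trans hε) (by linarith)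
  change |((counters n m).run a x : ℝ) - _| ≤ ε
  rw [abs_le]
  constructor <;> linarith [hΔ.sub_le x, hΔ.le x]

end Counters

/-! ### The error of `CountSketch` -/

theorem measureReal_lt_abs_le_of_integral_sq_le {Ω : Type*} [MeasurableSpace Ω] {P : Measure Ω}
    [IsFiniteMeasure P] {Z : Ω → ℝ} (hZ : Integrable (fun ω => Z ω ^ 2) P) {ε q : ℝ} (hε : 0 ≤ ε)
    (hq : 0 ≤ q) (h : ∫ ω, Z ω ^ 2 ∂P ≤ q * ε ^ 2) : P.real {ω | ε < |Z ω|} ≤ q := by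
  rcases hε.eq_or_lt with rfl | hε'
  · have hzero : (fun ω => Z ω ^ 2) =ᵐ[P] 0 :=
      (integral_eq_zero_iff_of_nonneg (fun ω => sq_nonneg _) hZ).1
        (le_antisymm (by simpa using h) (integral_nonneg fun ω => sq_nonneg _))
    have hnull : P {ω | 0 < |Z ω|} = 0 := by
      refine measure_mono_null (fun ω hω => ?_) hzero
      exact fun h0 => (abs_pos.1 hω) (pow_eq_zero_iff two_ne_zero |>.1 h0)
    rw [measureReal_def, hnull]
    exact hq
  · have hmarkov := mul_meas_ge_le_integral_of_nonneg (.of_forall fun ω => sq_nonneg (Z ω)) hZ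
      (ε ^ 2)
    have hmono : P.real {ω | ε < |Z ω|} ≤ P.real {ω | ε ^ 2 ≤ Z ω ^ 2} :=
      measureReal_mono fun ω (hω : ε < |Z ω|) =>
        (pow_le_pow_left₀ hε hω.le 2).trans_eq (sq_abs (Z ω))
    refine hmono.trans (le_of_mul_le_mul_left (hmarkov.trans (h.trans_eq (mul_comm _ _))) ?_)
    positivity

section RowNoise

variable {n w : ℕ}

theorem sgn_mul_self (b : Bool) : sgn b * sgn b = 1 := by cases b <;> simp [sgn]

theorem abs_sgn (b : Bool) : |sgn b| = 1 := by cases b <;> simp [sgn]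

/-- The contribution of the keys in `A` to the counter of `x` in a row of `CountSketch`. -/
def rowNoise (h : Fin n → Fin w) (s : Fin n → Bool) (f : Fin n → ℝ) (x : Fin n)
    (A : Finset (Fin n)) : ℝ :=
  ∑ y ∈ A with h y = h x, sgn (s y) * f y

theorem abs_rowEstimate_sub {h : Fin n → Fin w} {x : Fin n} {J : Finset (Fin n)}
    (hJ : ∀ y ∈ J.erase x, h y ≠ h x) (s : Fin n → Bool) (f : Fin n → ℝ) :
    |rowEstimate h s f x - f x| = |rowNoise h s f x ((Finset.univ \ J).erase x)| := by
  have hfilter : ({y | h y = h x} : Finset (Fin n)) =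
      insert x (((Finset.univ \ J).erase x).filter fun y => h y = h x) := by
    ext y
    by_cases hyx : y = x
    · simp [hyx]
    · have := hJ y
      simp only [Finset.mem_erase, hyx, ne_eq, not_false_eq_true, true_and] at this
      simp only [Finset.mem_filter, Finset.mem_univ, true_and, Finset.mem_insert, hyx,
        Finset.mem_erase, ne_eq, not_false_eq_true, Finset.mem_sdiff, false_or]
      tauto
  rw [rowEstimate, hfilter, Finset.sum_insert (by simp), mul_add, ← mul_assoc, sgn_mul_self,
    one_mul, add_sub_cancel_left, abs_mul, abs_sgn, one_mul, rowNoise]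

theorem rowNoise_sq (h : Fin n → Fin w) (s : Fin n → Bool) (f : Fin n → ℝ) (x : Fin n)
    (A : Finset (Fin n)) :
    rowNoise h s f x A ^ 2 = ∑ y ∈ A, ∑ z ∈ A,
      f y * f z * ((if h y = h x ∧ h z = h x then 1 else 0) * (sgn (s y) * sgn (s z))) := by
  rw [rowNoise, Finset.sum_filter, sq, Finset.sum_mul_sum]
  refine Finset.sum_congr rfl fun y _ => Finset.sum_congr rfl fun z _ => ?_
  by_cases hy : h y = h x <;> by_cases hz : h z = h x <;> simp [hy, hz]
  ring

end RowNoise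

section Hash

namespace IsCountSketchHash

variable {Ω : Type*} [MeasurableSpace Ω] {P : Measure Ω} {n d w : ℕ}
  {h : Fin d → Fin n → Ω → Fin w} {s : Fin d → Fin n → Ω → Bool}

theorem measurable_row (H : IsCountSketchHash P h s) (i : Fin d) :
    Measurable fun ω =>
      ((fun y => h i y ω, fun y => s i y ω) : (Fin n → Fin w) × (Fin n → Bool)) :=
  (measurable_pi_lambda _ (H.measurable_h i)).prodMk (measurable_pi_lambda _ (H.measurable_s i))

theorem measurableSet_row (H : IsCountSketchHash P h s) (i : Fin d)
    (p : (Fin n → Fin w) → (Fin n → Bool) → Prop) :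
    MeasurableSet {ω | p (fun y => h i y ω) (fun y => s i y ω)} :=
  H.measurable_row i (Set.toFinite {g : _ × _ | p g.1 g.2}).measurableSet

variable [IsProbabilityMeasure P]

theorem integrable_row (H : IsCountSketchHash P h s) (i : Fin d)
    (g : (Fin n → Fin w) → (Fin n → Bool) → ℝ) :
    Integrable (fun ω => g (fun y => h i y ω) (fun y => s i y ω)) P :=
  Integrable.comp_measurable
    (Integrable.of_finite (f := fun a : (Fin n → Fin w) × (Fin n → Bool) => g a.1 a.2))
    (H.measurable_row i)

theorem measureReal_collision (H : IsCountSketchHash P h s) (i : Fin d) {x y : Fin n}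
    (hxy : y ≠ x) : P.real {ω | h i y ω = h i x ω} = 1 / w := by
  have hunion : {ω | h i y ω = h i x ω} =
      ⋃ b ∈ (Finset.univ : Finset (Fin w)), (h i y ⁻¹' {b} ∩ h i x ⁻¹' {b}) := by
    ext ω
    simp [eq_comm]
  have hbucket (b : Fin w) : P.real (h i y ⁻¹' {b} ∩ h i x ⁻¹' {b}) = 1 / w * (1 / w) := by
    rw [measureReal_def, (H.pairwise_h i y x hxy).measure_inter_preimage_eq_mul _ _
      (measurableSet_singleton b) (measurableSet_singleton b), ENNReal.toReal_mul]
    exact congrArg₂ _ (H.uniform_h i y b) (H.uniform_h i x b)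
  rw [hunion, measureReal_biUnion_finset]
  · rcases eq_or_ne (w : ℝ) 0 with hw | hw
    · simp [hbucket, hw]
    · simp only [hbucket, Finset.sum_const, Finset.card_univ, Fintype.card_fin, nsmul_eq_mul]
      field_simp
  · exact fun b _ b' _ hbb =>
      Set.disjoint_left.2 fun ω hb hb' => hbb (hb.1.symm.trans hb'.1)
  · exact fun b _ => (H.measurable_h i y (measurableSet_singleton b)).inter
      (H.measurable_h i x (measurableSet_singleton b))

theorem integral_sgn (H : IsCountSketchHash P h s) (i : Fin d) (x : Fin n) :
    ∫ ω, sgn (s i x ω) ∂P = 0 := by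
  have htrue : MeasurableSet (s i x ⁻¹' {true}) := H.measurable_s i x (measurableSet_singleton _)
  have hsgn (ω) : sgn (s i x ω) = 2 * (s i x ⁻¹' {true}).indicator 1 ω - 1 := by
    cases hs : s i x ω <;> norm_num [sgn, Set.indicator_apply, hs]
  have hhalf : P.real (s i x ⁻¹' {true}) = 1 / 2 := H.uniform_s i x true
  simp_rw [hsgn]
  rw [integral_sub, integral_const_mul, integral_indicator_one htrue, hhalf]
  · simp
  · exact ((integrable_const 1).indicator htrue).const_mul 2
  · exact integrable_const 1

theorem integral_sgn_mul_sgn (H : IsCountSketchHash P h s) (i : Fin d) {x y : Fin n}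
    (hxy : x ≠ y) : ∫ ω, sgn (s i x ω) * sgn (s i y ω) ∂P = 0 := by
  have hsgn : Measurable sgn := measurable_of_finite _
  have hprod := ((H.pairwise_s i x y hxy).comp hsgn hsgn).integral_fun_mul_eq_mul_integral
    (hsgn.comp (H.measurable_s i x)).aestronglyMeasurable
    (hsgn.comp (H.measurable_s i y)).aestronglyMeasurable
  simp only [Function.comp_def] at hprod
  rw [hprod, H.integral_sgn, zero_mul]

theorem integral_mul_sgn_mul_sgn (H : IsCountSketchHash P h s) (i : Fin d)
    (g : (Fin n → Fin w) → ℝ) {x y : Fin n} (hxy : x ≠ y) :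
    ∫ ω, g (fun z => h i z ω) * (sgn (s i x ω) * sgn (s i y ω)) ∂P = 0 := by
  have hg : Measurable g := measurable_of_finite _
  have hsgn : Measurable fun b : Fin n → Bool => sgn (b x) * sgn (b y) := measurable_of_finite _
  have hprod := ((H.indep_h_s i).comp hg hsgn).integral_fun_mul_eq_mul_integral
    (hg.comp (measurable_pi_lambda _ (H.measurable_h i))).aestronglyMeasurable
    (hsgn.comp (measurable_pi_lambda _ (H.measurable_s i))).aestronglyMeasurable
  simp only [Function.comp_def] at hprod
  rw [hprod, H.integral_sgn_mul_sgn i hxy, mul_zero]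

theorem integral_rowNoise_sq (H : IsCountSketchHash P h s) (i : Fin d) (f : Fin n → ℝ)
    {x : Fin n} {A : Finset (Fin n)} (hA : x ∉ A) :
    ∫ ω, rowNoise (fun y => h i y ω) (fun y => s i y ω) f x A ^ 2 ∂P =
      (∑ y ∈ A, f y ^ 2) / w := by
  have hint (y z) := H.integrable_row i fun g b =>
    f y * f z * ((if g y = g x ∧ g z = g x then 1 else 0) * (sgn (b y) * sgn (b z)))
  simp_rw [rowNoise_sq]
  rw [integral_finsetSum _ fun y _ => integrable_finsetSum _ fun z _ => hint y z, Finset.sum_div]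
  refine Finset.sum_congr rfl fun y hy => ?_
  rw [integral_finsetSum _ fun z _ => hint y z, Finset.sum_eq_single_of_mem y hy]
  · have hindicator (ω) : (if h i y ω = h i x ω ∧ h i y ω = h i x ω then (1 : ℝ) else 0) =
        {ω | h i y ω = h i x ω}.indicator 1 ω := by
      simp [Set.indicator_apply]
    simp_rw [sgn_mul_self, mul_one, hindicator]
    rw [integral_const_mul, integral_indicator_one (H.measurableSet_row i fun g _ => g y = g x),
      H.measureReal_collision i (ne_of_mem_of_not_mem hy hA), mul_one_div, sq]
  · intro z _ hzy
    rw [integral_const_mul, H.integral_mul_sgn_mul_sgn i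
      (fun g => if g y = g x ∧ g z = g x then 1 else 0) hzy.symm, mul_zero]

theorem measureReal_exists_collision_le (H : IsCountSketchHash P h s) (i : Fin d) (x : Fin n)
    {J : Finset (Fin n)} {q : ℝ} (hq : 0 ≤ q) (hJ : (J.card : ℝ) ≤ q * w) :
    P.real {ω | ∃ y ∈ J.erase x, h i y ω = h i x ω} ≤ q := by
  have hunion : {ω | ∃ y ∈ J.erase x, h i y ω = h i x ω} =
      ⋃ y ∈ J.erase x, {ω | h i y ω = h i x ω} := by
    ext ω
    simp only [Set.mem_iUnion, Set.mem_ofPred_eq, exists_prop]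
  calc P.real {ω | ∃ y ∈ J.erase x, h i y ω = h i x ω}
      ≤ ∑ y ∈ J.erase x, P.real {ω | h i y ω = h i x ω} :=
        hunion ▸ measureReal_biUnion_finset_le _ _
    _ = (J.erase x).card / w := by
        rw [Finset.sum_congr rfl fun y hy => H.measureReal_collision i (Finset.ne_of_mem_erase hy),
          Finset.sum_const, nsmul_eq_mul, mul_one_div]
    _ ≤ q := div_le_of_le_mul₀ w.cast_nonneg hq
        ((Nat.cast_le.2 (Finset.card_le_card (Finset.erase_subset x J))).trans hJ)

/-- The keys of `J` are large but few, so that they are not likely to collide with `x`; the noise of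
the other keys is controlled by its second moment. -/
theorem measureReal_lt_abs_rowEstimate_sub_le (H : IsCountSketchHash P h s) (i : Fin d) (x : Fin n)
    {f : Fin n → ℝ} {J : Finset (Fin n)} {ε q : ℝ} (hε : 0 ≤ ε) (hq : 0 ≤ q)
    (hJ : (J.card : ℝ) ≤ q * w) (hf : ∑ y ∈ Finset.univ \ J, f y ^ 2 ≤ q * ε ^ 2 * w) :
    P.real {ω | ε < |rowEstimate (fun y => h i y ω) (fun y => s i y ω) f x - f x|} ≤ 2 * q := by
  set A : Finset (Fin n) := (Finset.univ \ J).erase x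
  have hnoise : P.real {ω | ε < |rowNoise (fun y => h i y ω) (fun y => s i y ω) f x A|} ≤ q := by
    refine measureReal_lt_abs_le_of_integral_sq_le
      (H.integrable_row i fun g b => rowNoise g b f x A ^ 2) hε hq ?_
    rw [H.integral_rowNoise_sq i f (Finset.notMem_erase _ _)]
    refine div_le_of_le_mul₀ w.cast_nonneg (by positivity) (le_trans ?_ hf)
    exact Finset.sum_le_sum_of_subset_of_nonneg (Finset.erase_subset _ _)
      fun y _ _ => sq_nonneg _
  have hsub : {ω | ε < |rowEstimate (fun y => h i y ω) (fun y => s i y ω) f x - f x|} ⊆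
      {ω | ∃ y ∈ J.erase x, h i y ω = h i x ω} ∪
        {ω | ε < |rowNoise (fun y => h i y ω) (fun y => s i y ω) f x A|} := by
    intro ω hω
    by_cases hcol : ∃ y ∈ J.erase x, h i y ω = h i x ω
    · exact .inl hcol
    · refine .inr (lt_of_lt_of_eq hω (abs_rowEstimate_sub (fun y hy heq => hcol ?_) _ f))
      exact ⟨y, hy, heq⟩
  calc _ ≤ _ := measureReal_mono hsub
    _ ≤ _ := measureReal_union_le _ _
    _ ≤ q + q := add_le_add (H.measureReal_exists_collision_le i x hq hJ) hnoise
    _ = 2 * q := (two_mul q).symm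

/-- The mean number of bad rows is at most `d * exp (-4)`. -/
theorem measureReal_half_le_card_le_exp (H : IsCountSketchHash P h s) (x : Fin n)
    {f : Fin n → ℝ} {J : Finset (Fin n)} {ε : ℝ} (hε : 0 ≤ ε)
    (hJ : (J.card : ℝ) ≤ Real.exp (-4) / 2 * w)
    (hf : ∑ y ∈ Finset.univ \ J, f y ^ 2 ≤ Real.exp (-4) / 2 * ε ^ 2 * w) :
    P.real {ω | d - d / 2 ≤ (Finset.univ.filter fun i =>
      ε < |rowEstimate (fun y => h i y ω) (fun y => s i y ω) f x - f x|).card} ≤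
      Real.exp (-d) := by
  set bad : Set ((Fin n → Fin w) × (Fin n → Bool)) := {g | ε < |rowEstimate g.1 g.2 f x - f x|}
  set X : Fin d → Ω → ℝ := fun i ω => bad.indicator 1 (fun y => h i y ω, fun y => s i y ω) with hX
  have hmeas : Measurable (bad.indicator (1 : (Fin n → Fin w) × (Fin n → Bool) → ℝ)) :=
    measurable_of_finite _
  have hmem (i ω) : X i ω ∈ Set.Icc (0 : ℝ) 1 :=
    ⟨Set.indicator_nonneg (fun _ _ => zero_le_one) _,
      Set.indicator_le' (fun _ _ => le_rfl) (fun _ _ => zero_le_one) _⟩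
  have hmean : ∑ i, ∫ ω, X i ω ∂P ≤ d * Real.exp (-4) := by
    refine (Finset.sum_le_card_nsmul _ _ (Real.exp (-4)) fun i _ => ?_).trans_eq (by simp)
    have hrow := H.measureReal_lt_abs_rowEstimate_sub_le i x hε (by positivity) hJ hf
    rw [mul_div_cancel₀ _ two_ne_zero] at hrow
    exact (integral_indicator_one (H.measurable_row i (Set.toFinite bad).measurableSet)).trans_le
      hrow
  have hchernoff : P.real {ω | (d : ℝ) / 2 ≤ ∑ i, X i ω} ≤ _ :=
    measureReal_le_sum_le_exp (fun i => hmeas.comp (H.measurable_row i)) hmem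
      (H.indep_rows.comp (fun _ => bad.indicator 1) fun _ => hmeas) Finset.univ hmean
      (θ := 4) (by norm_num) _
  refine (measureReal_mono fun ω hω => ?_).trans (hchernoff.trans (Real.exp_le_exp.2 ?_))
  · have hsum : ∑ i, X i ω = ((Finset.univ.filter fun i =>
        ε < |rowEstimate (fun y => h i y ω) (fun y => s i y ω) f x - f x|).card : ℝ) := by
      simp only [hX, Set.indicator_apply, Pi.one_apply, Finset.sum_boole]
      rfl
    have hhalf : d ≤ 2 * (Finset.univ.filter fun i =>
        ε < |rowEstimate (fun y => h i y ω) (fun y => s i y ω) f x - f x|).card := by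
      simp only [Set.mem_ofPred_eq] at hω
      lia
    rw [Set.mem_ofPred_eq, hsum, div_le_iff₀' two_pos]
    exact_mod_cast hhalf
  · have hexp : Real.exp 4 * Real.exp (-4) = 1 := by rw [← Real.exp_add]; simp
    have : 0 ≤ (d : ℝ) * Real.exp (-4) := by positivity
    linear_combination (d : ℝ) * hexp + this

theorem measureReal_exists_half_le_card_le (H : IsCountSketchHash P h s) {f : Fin n → ℝ}
    {J : Finset (Fin n)} {ε : ℝ} (hε : 0 ≤ ε) (hJ : (J.card : ℝ) ≤ Real.exp (-4) / 2 * w)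
    (hf : ∑ y ∈ Finset.univ \ J, f y ^ 2 ≤ Real.exp (-4) / 2 * ε ^ 2 * w) :
    P.real {ω | ∃ x, d - d / 2 ≤ (Finset.univ.filter fun i =>
      ε < |rowEstimate (fun y => h i y ω) (fun y => s i y ω) f x - f x|).card} ≤
      n * Real.exp (-d) := by
  rw [Set.ofPred_exists]
  refine (measureReal_iUnion_fintype_le _).trans ?_
  exact (Finset.sum_le_card_nsmul _ _ _ fun x _ =>
    H.measureReal_half_le_card_le_exp x hε hJ hf).trans_eq (by simp)

end IsCountSketchHash

end Hash

/-! ### Transformed frequencies and the top keys -/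

section Transformed

variable {κ : Type*} {p : ℝ} {r v : κ → ℝ} {x y : κ}

theorem measurable_transformed (p : ℝ) (v : κ → ℝ) (x : κ) :
    Measurable fun r : κ → ℝ => transformed p r v x := by
  unfold transformed
  exact (measurable_const.div ((measurable_pi_apply x).pow_const _)).nnnorm

theorem transformed_eq_zero (h : v x = 0) : transformed p r v x = 0 := by
  simp [transformed, h]

theorem ne_zero_of_transformed_pos (h : 0 < transformed p r v x) : v x ≠ 0 :=
  fun hv => h.ne' (transformed_eq_zero hv)

theorem transformed_pos (hr : 0 < r x) (hv : v x ≠ 0) : 0 < transformed p r v x := by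
  rw [transformed, nnnorm_pos]
  exact div_ne_zero hv (Real.rpow_pos_of_pos hr _).ne'

theorem coe_transformed (hp : 0 < p) (hr : 0 < r x) :
    (transformed p r v x : ℝ) = (|v x| ^ p / r x) ^ (1 / p) := by
  rw [transformed, coe_nnnorm, norm_div, Real.norm_eq_abs, Real.norm_eq_abs,
    abs_of_pos (Real.rpow_pos_of_pos hr _), Real.div_rpow (by positivity) hr.le,
    ← Real.rpow_mul (abs_nonneg _), mul_one_div_cancel hp.ne', Real.rpow_one]

theorem le_transformed_iff (hp : 0 < p) (hr : 0 < r x) {c : ℝ} (hc : 0 ≤ c) :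
    c ≤ transformed p r v x ↔ r x * c ^ p ≤ |v x| ^ p := by
  rw [coe_transformed hp hr, one_div, Real.le_rpow_inv_iff_of_pos hc (by positivity) hp,
    le_div_iff₀ hr, mul_comm]

theorem lt_transformed_iff (hp : 0 < p) (hr : 0 < r x) {c : ℝ} (hc : 0 ≤ c) :
    c < transformed p r v x ↔ r x * c ^ p < |v x| ^ p := by
  rw [coe_transformed hp hr, one_div, Real.lt_rpow_inv_iff_of_pos hc (by positivity) hp,
    lt_div_iff₀ hr, mul_comm]

theorem transformed_le_transformed_iff (hp : 0 < p) (hx : 0 < r x) (hy : 0 < r y)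
    (hvx : v x ≠ 0) (hvy : v y ≠ 0) :
    transformed p r v y ≤ transformed p r v x ↔ r x / |v x| ^ p ≤ r y / |v y| ^ p := by
  have hwx : 0 < |v x| ^ p := Real.rpow_pos_of_pos (abs_pos.2 hvx) _
  have hwy : 0 < |v y| ^ p := Real.rpow_pos_of_pos (abs_pos.2 hvy) _
  rw [← NNReal.coe_le_coe, coe_transformed hp hx, coe_transformed hp hy,
    Real.rpow_le_rpow_iff (by positivity) (by positivity) (by positivity),
    div_le_div_iff₀ hy hx, div_le_div_iff₀ hwx hwy, mul_comm, mul_comm (|v x| ^ p)]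

end Transformed

section TopTuple

variable {κ : Type*} [LinearOrder κ]

theorem measurableSet_isTopTuple (p : ℝ) {k : ℕ} (D : Multiset (DataElement κ)) (t : Fin k → κ) :
    MeasurableSet {r : κ → ℝ | IsTopTuple p r D t} := by
  have hset : {r : κ → ℝ | IsTopTuple p r D t} = {r | (Function.Injective t ∧ ∀ i, t i ∈ keys D) ∧
      (∀ i j, i ≤ j → transformed p r (freq D) (t j) ≤ transformed p r (freq D) (t i)) ∧
      ∀ y ∈ keys D, y ∉ Set.range t → ∀ i,
        transformed p r (freq D) y ≤ transformed p r (freq D) (t i)} :=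
    Set.ext fun r => ⟨fun h => ⟨⟨h.injective, h.mem⟩, h.antitone, h.top⟩,
      fun h => ⟨h.1.1, h.1.2, h.2.1, h.2.2⟩⟩
  have hle (x y) : MeasurableSet
      {r : κ → ℝ | transformed p r (freq D) x ≤ transformed p r (freq D) y} :=
    measurableSet_le (measurable_transformed _ _ _) (measurable_transformed _ _ _)
  rw [hset]
  simp only [Set.ofPred_and, Set.ofPred_forall]
  exact .inter ((MeasurableSet.const _).inter (.iInter fun _ => .const _))
    (.inter (.iInter fun i => .iInter fun j => .iInter fun _ => hle _ _)
      ((keys D).measurableSet_biInter fun y _ => .iInter fun _ => .iInter fun i => hle _ _))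

/-- The keys of non-zero frequency, which are the ones with a positive transformed frequency. -/
noncomputable def support (D : Multiset (DataElement κ)) : Finset κ :=
  (keys D).filter fun x => freq D x ≠ 0

variable {p : ℝ} {D : Multiset (DataElement κ)} {r : κ → ℝ} {x : κ}

theorem mem_support : x ∈ support D ↔ x ∈ keys D ∧ freq D x ≠ 0 := Finset.mem_filter

theorem mem_support_of_transformed_pos (hx : x ∈ keys D) (h : 0 < transformed p r (freq D) x) :
    x ∈ support D :=
  mem_support.2 ⟨hx, ne_zero_of_transformed_pos h⟩

theorem rpow_abs_freq_pos (p : ℝ) (hx : x ∈ support D) : 0 < |freq D x| ^ p :=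
  Real.rpow_pos_of_pos (abs_pos.2 (mem_support.1 hx).2) _

variable {k : ℕ} {t t' : Fin k → κ}

theorem IsTopTuple.mem_support (h : IsTopTuple p r D t) (hr : ∀ x ∈ keys D, 0 < r x)
    (hk : k < (support D).card) (i : Fin k) : t i ∈ support D := by
  have hcard : (Finset.univ.image t).card < (support D).card :=
    (Finset.card_image_le.trans_eq (Finset.card_fin k)).trans_lt hk
  obtain ⟨y, hy, hyt⟩ := Finset.exists_mem_notMem_of_card_lt_card hcard
  rw [WORp.mem_support] at hy
  have htop := h.top y hy.1 (by simpa using hyt) i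
  exact mem_support_of_transformed_pos (h.mem i) ((transformed_pos (hr y hy.1) hy.2).trans_le htop)

theorem IsTopTuple.card_filter_lt (h : IsTopTuple p r D t)
    (hinj : Set.InjOn (transformed p r (freq D)) (support D)) (hts : ∀ i, t i ∈ support D)
    (i : Fin k) : ((keys D).filter fun y =>
      transformed p r (freq D) (t i) < transformed p r (freq D) y).card = i := by
  have himage : ((keys D).filter fun y =>
      transformed p r (freq D) (t i) < transformed p r (freq D) y) = (Finset.Iio i).image t := by
    ext y
    simp only [Finset.mem_filter, Finset.mem_image, Finset.mem_Iio]
    constructor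
    · rintro ⟨hy, hlt⟩
      by_cases hyt : y ∈ Set.range t
      · obtain ⟨i', rfl⟩ := hyt
        exact ⟨i', not_le.1 fun hle => hlt.not_ge (h.antitone hle), rfl⟩
      · exact absurd (h.top y hy hyt i) hlt.not_ge
    · rintro ⟨i', hi', rfl⟩
      refine ⟨h.mem i', lt_of_le_of_ne (h.antitone hi'.le) fun heq => ?_⟩
      exact hi'.ne' (h.injective (hinj (hts i) (hts i') heq))
  rw [himage, Finset.card_image_of_injective _ h.injective, Fin.card_Iio]

theorem IsTopTuple.transformed_le (h : IsTopTuple p r D t) (h' : IsTopTuple p r D t')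
    (hinj : Set.InjOn (transformed p r (freq D)) (support D)) (hts : ∀ i, t i ∈ support D)
    (hts' : ∀ i, t' i ∈ support D) (i : Fin k) :
    transformed p r (freq D) (t' i) ≤ transformed p r (freq D) (t i) := by
  by_contra! hlt
  have hssub : (keys D).filter (fun y =>
      transformed p r (freq D) (t' i) < transformed p r (freq D) y) ⊂ (keys D).filter fun y =>
      transformed p r (freq D) (t i) < transformed p r (freq D) y := by
    refine Finset.ssubset_iff_of_subset
      (Finset.monotone_filter_right _ fun y _ hy => hlt.trans hy) |>.2 ⟨t' i, ?_, ?_⟩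
    · exact Finset.mem_filter.2 ⟨h'.mem i, hlt⟩
    · exact fun hmem => lt_irrefl _ (Finset.mem_filter.1 hmem).2
  have hcard := Finset.card_lt_card hssub
  rw [h.card_filter_lt hinj hts, h'.card_filter_lt hinj hts'] at hcard
  exact lt_irrefl _ hcard

theorem IsTopTuple.unique (h : IsTopTuple p r D t) (h' : IsTopTuple p r D t')
    (hr : ∀ x ∈ keys D, 0 < r x) (hk : k < (support D).card)
    (hinj : Set.InjOn (transformed p r (freq D)) (support D)) : t = t' := by
  have hts := h.mem_support hr hk
  have hts' := h'.mem_support hr hk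
  exact funext fun i => hinj (hts i) (hts' i)
    (le_antisymm (h'.transformed_le h hinj hts' hts i) (h.transformed_le h' hinj hts hts' i))

theorem exists_isTopTuple (p : ℝ) (r : κ → ℝ) (hk : k ≤ (keys D).card) :
    ∃ t : Fin k → κ, IsTopTuple p r D t := by
  set f := transformed p r (freq D)
  have hrank (i : Fin k) : ∃ x ∈ keys D, rank (keys D) f x = i := by
    rw [← Finset.mem_image, image_rank]
    exact Finset.mem_range.2 (i.2.trans_le hk)
  choose t ht hrank using hrank
  refine ⟨t, fun i j hij => ?_, ht, fun i j hij => ?_, fun y hy hyt i => ?_⟩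
  · exact Fin.ext (by rw [← hrank i, ← hrank j, hij])
  · exact le_of_rank_le (ht j) (by rw [hrank, hrank]; exact hij)
  · refine le_of_rank_le hy ?_
    rw [hrank]
    by_contra! hlt
    exact hyt ⟨⟨_, hlt.trans i.2⟩, rank_injOn (keys D) f (ht _) hy (hrank _)⟩

end TopTuple

section Concentrated

variable {κ : Type*} [LinearOrder κ]

/-- The randomizations for which the two-pass method is bound to succeed when the first pass has
error at most `ε`: more than `k` keys have transformed frequencies larger than `3 * ε` (unless
`ε = 0`), fewer than `m` keys have transformed frequencies larger than `ε`, and the `q`-th moment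
of the transformed frequencies of the other keys is at most `L * ε ^ q`. -/
def concentrated (p q L : ℝ) (k m : ℕ) (D : Multiset (DataElement κ)) (ε : ℝ) : Set (κ → ℝ) :=
  {r | (∀ x ∈ keys D, 0 < r x) ∧
    (k < ((keys D).filter fun x => 3 * ε < transformed p r (freq D) x).card ∨ ε = 0) ∧
    ((keys D).filter fun x => ε < transformed p r (freq D) x).card < m ∧
    ∑ x ∈ keys D with transformed p r (freq D) x ≤ ε, (transformed p r (freq D) x : ℝ) ^ q ≤
      L * ε ^ q}

theorem measurableSet_card_filter {ι α : Type*} [MeasurableSpace α] (s : Finset ι)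
    {V : ι → Set α} [∀ a, DecidablePred fun x => a ∈ V x] (hV : ∀ x, MeasurableSet (V x))
    (Q : ℕ → Prop) :
    MeasurableSet {a | Q (s.filter fun x => a ∈ V x).card} := by
  have hcard : Measurable fun a => ∑ x ∈ s, if a ∈ V x then 1 else 0 :=
    Finset.measurable_sum _ fun x _ => Measurable.ite (hV x) measurable_const measurable_const
  simp_rw [Finset.card_filter]
  exact hcard (MeasurableSpace.measurableSet_top (s := {i | Q i}))

theorem measurableSet_concentrated (p q L : ℝ) (k m : ℕ) (D : Multiset (DataElement κ)) (ε : ℝ) :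
    MeasurableSet (concentrated p q L k m D ε) := by
  classical
  have htr (x) : Measurable fun r : κ → ℝ => (transformed p r (freq D) x : ℝ) :=
    (measurable_transformed p (freq D) x).coe_nnreal_real
  have hcard (c : ℝ) (Q : ℕ → Prop) : MeasurableSet
      {r | Q ((keys D).filter fun x => c < transformed p r (freq D) x).card} := by
    convert measurableSet_card_filter (keys D)
      (V := fun x => {r : κ → ℝ | c < transformed p r (freq D) x})
      (fun x => measurableSet_lt measurable_const (htr x)) Q
    exact Iff.rfl
  have hsum : Measurable fun r : κ → ℝ => ∑ x ∈ keys D with transformed p r (freq D) x ≤ ε,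
      (transformed p r (freq D) x : ℝ) ^ q := by
    simp_rw [Finset.sum_filter]
    exact Finset.measurable_sum _ fun x _ => Measurable.ite
      (measurableSet_le (htr x) measurable_const) ((htr x).pow_const q) measurable_const
  simp only [concentrated, Set.ofPred_and, Set.ofPred_or, Set.ofPred_forall]
  refine .inter ?_ (.inter (.union ?_ (.const _)) (.inter ?_ ?_))
  · exact (keys D).measurableSet_biInter fun x _ =>
      measurableSet_lt measurable_const (measurable_pi_apply x)
  · exact hcard (3 * ε) fun i => k < i
  · exact hcard ε fun i => i < m
  · exact measurableSet_le hsum measurable_const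

theorem mem_concentrated_zero {p q : ℝ} (hq : 0 < q) (L : ℝ) (k : ℕ) {m : ℕ}
    {D : Multiset (DataElement κ)} {r : κ → ℝ} (hr : ∀ x ∈ keys D, 0 < r x)
    (hm : (support D).card < m) : r ∈ concentrated p q L k m D 0 := by
  refine ⟨hr, .inr rfl, lt_of_le_of_lt (Finset.card_le_card fun x hx => ?_) hm, ?_⟩
  · obtain ⟨hx, hpos⟩ := Finset.mem_filter.1 hx
    exact mem_support_of_transformed_pos hx hpos
  · rw [Real.zero_rpow hq.ne', mul_zero]
    refine Finset.sum_nonpos fun x hx => ?_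
    rw [le_antisymm (Finset.mem_filter.1 hx).2 (NNReal.coe_nonneg _), Real.zero_rpow hq.ne']

end Concentrated

namespace IsExpHash

section Law

variable {Ω κ : Type*} [MeasurableSpace Ω] {P : Measure Ω} {r : κ → Ω → ℝ}

theorem measurable_fun (H : IsExpHash P r) : Measurable fun ω x => r x ω :=
  measurable_pi_lambda _ H.measurable

theorem ae_pos (H : IsExpHash P r) (s : Finset κ) : ∀ᵐ ω ∂P, ∀ x ∈ s, 0 < r x ω := by
  rw [Filter.eventually_all_finset]
  refine fun x _ => ae_of_ae_map (H.measurable x).aemeasurable (p := fun y => 0 < y) ?_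
  rw [H.law x]
  exact ae_expMeasure_one_pos

variable [IsProbabilityMeasure P]

theorem map_pi (H : IsExpHash P r) {ι : Type*} [Fintype ι] {g : ι → κ}
    (hg : Function.Injective g) : P.map (fun ω i => r (g i) ω) = expPi ι := by
  refine ((iIndepFun_iff_map_fun_eq_pi_map fun i => (H.measurable (g i)).aemeasurable).1
    (H.indep.precomp hg)).trans ?_
  simp_rw [H.law]

theorem map_prod (H : IsExpHash P r) {ι : Type*} [Fintype ι] {t : ι → κ}
    (ht : Function.Injective t) (U : Finset κ) (hU : ∀ i, t i ∉ U) :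
    P.map (fun ω => ((fun i => r (t i) ω), (fun x : U => r x ω))) = (expPi ι).prod (expPi U) := by
  classical
  have hdisj : Disjoint (Finset.univ.image t) U :=
    Finset.disjoint_left.2 fun x hx => by
      obtain ⟨i, -, rfl⟩ := Finset.mem_image.1 hx
      exact hU i
  have hindep : IndepFun (fun ω i => r (t i) ω) (fun ω (x : U) => r x ω) P :=
    (H.indep.indepFun_finset _ _ hdisj H.measurable).comp
      (φ := fun (a : Finset.univ.image t → ℝ) (i : ι) =>
        a ⟨t i, Finset.mem_image_of_mem t (Finset.mem_univ i)⟩) (ψ := id)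
      (by fun_prop) measurable_id
  rw [(indepFun_iff_map_prod_eq_prod_map_map
    (measurable_pi_lambda _ fun i => H.measurable _).aemeasurable
    (measurable_pi_lambda _ fun i => H.measurable _).aemeasurable).1 hindep,
    H.map_pi ht, H.map_pi Subtype.val_injective]

theorem ae_ne (H : IsExpHash P r) {x y : κ} (hxy : x ≠ y) (c : ℝ) :
    ∀ᵐ ω ∂P, r x ω ≠ c * r y ω := by
  refine ae_of_ae_map ((H.measurable x).prodMk (H.measurable y)).aemeasurable
    (p := fun z : ℝ × ℝ => z.1 ≠ c * z.2) ?_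
  rw [(indepFun_iff_map_prod_eq_prod_map_map (H.measurable x).aemeasurable
    (H.measurable y).aemeasurable).1 (H.indep.indepFun hxy), H.law, H.law, ae_iff]
  simp only [ne_eq, not_not]
  rw [Measure.prod_apply_symm
    (measurableSet_eq_fun measurable_fst (measurable_snd.const_mul c))]
  exact (lintegral_congr fun b => measure_singleton (c * b)).trans lintegral_zero

theorem ae_injOn [LinearOrder κ] (H : IsExpHash P r) {p : ℝ} (hp : 0 < p)
    (D : Multiset (DataElement κ)) :
    ∀ᵐ ω ∂P, Set.InjOn (transformed p (fun x => r x ω) (freq D)) (support D) := by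
  have hne : ∀ᵐ ω ∂P, ∀ x ∈ support D, ∀ y ∈ support D, x ≠ y →
      r x ω ≠ |freq D x| ^ p / |freq D y| ^ p * r y ω := by
    simp only [Filter.eventually_all_finset]
    intro x _ y _
    by_cases hxy : x = y
    · exact .of_forall fun ω h => absurd hxy h
    · exact (H.ae_ne hxy _).mono fun ω h _ => h
  filter_upwards [hne, H.ae_pos (keys D)] with ω hne hpos x hx y hy heq
  by_contra hxy
  refine hne x hx y hy hxy ?_
  have hwx := rpow_abs_freq_pos p hx
  have hwy := rpow_abs_freq_pos p hy
  rw [Finset.mem_coe, mem_support] at hx hy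
  have hle {x y : κ} := transformed_le_transformed_iff (r := fun x => r x ω) (v := freq D)
    (x := x) (y := y) hp
  have hratio := le_antisymm ((hle (hpos x hx.1) (hpos y hy.1) hx.2 hy.2).1 heq.ge)
    ((hle (hpos y hy.1) (hpos x hx.1) hy.2 hx.2).1 heq.le)
  rw [div_eq_div_iff hwx.ne' hwy.ne'] at hratio
  rw [div_mul_eq_mul_div, eq_div_iff hwy.ne', hratio, mul_comm]

end Law

end IsExpHash

/-! ### Concentration of the transformed frequencies -/

section ScaledThreshold

variable {κ : Type*} {p q M : ℝ} {r v : κ → ℝ} {x : κ}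

theorem four_rpow_le_sixteen (hq : q ≤ 2) : (4 : ℝ) ^ q ≤ 16 :=
  (Real.rpow_le_rpow_of_exponent_le (by norm_num) hq).trans_eq (by norm_num)

theorem rpow_neg_one_div_rpow (hp : p ≠ 0) (hM : 0 ≤ M) : (M ^ (-(1 / p))) ^ p = M⁻¹ := by
  rw [← Real.rpow_mul hM, neg_mul, one_div_mul_cancel hp, Real.rpow_neg_one]

theorem rpow_neg_one_div_le_transformed_iff (hp : 0 < p) (hM : 0 < M) (hr : 0 < r x) :
    M ^ (-(1 / p)) ≤ transformed p r v x ↔ r x ≤ M * |v x| ^ p := by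
  rw [le_transformed_iff hp hr (Real.rpow_nonneg hM.le _), rpow_neg_one_div_rpow hp.ne' hM.le,
    ← div_eq_mul_inv, div_le_iff₀ hM, mul_comm M]

theorem lt_of_rpow_neg_one_div_div_four_lt_transformed (hp : 0 < p) (hp2 : p ≤ 2) (hM : 0 < M)
    (hr : 0 < r x) (h : M ^ (-(1 / p)) / 4 < transformed p r v x) :
    r x < 16 * (M * |v x| ^ p) := by
  rw [lt_transformed_iff hp hr (by positivity), Real.div_rpow (by positivity) (by norm_num),
    rpow_neg_one_div_rpow hp.ne' hM.le, inv_eq_one_div, div_div, mul_one_div,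
    div_lt_iff₀ (by positivity)] at h
  calc r x < |v x| ^ p * (M * 4 ^ p) := h
    _ ≤ |v x| ^ p * (M * 16) := by gcongr; exact four_rpow_le_sixteen hp2
    _ = 16 * (M * |v x| ^ p) := by ring

theorem transformed_rpow_eq (hp : 0 < p) (hM : 0 < M) (hr : 0 < r x) (h : M * |v x| ^ p < r x) :
    (transformed p r v x : ℝ) ^ q =
      (M ^ (-(1 / p))) ^ q * decay (q / p) (M * |v x| ^ p) (r x) := by
  rw [decay_of_lt h, coe_transformed hp hr, ← Real.rpow_mul (by positivity), mul_div_assoc,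
    Real.mul_rpow hM.le (by positivity), ← mul_assoc, ← Real.rpow_mul hM.le, ← Real.rpow_add hM,
    one_div_mul_eq_div, neg_mul, one_div_mul_eq_div, neg_add_cancel, Real.rpow_zero, one_mul]

end ScaledThreshold

section Residual

variable {κ : Type*} [LinearOrder κ] {p q M : ℝ} {D : Multiset (DataElement κ)} {r : κ → ℝ}
  {k : ℕ} {t : Fin k → κ} {j : Fin k} {x : κ}

/-- The keys of non-zero frequency other than the keys of `t`. -/
noncomputable def residualKeys (D : Multiset (DataElement κ)) (t : Fin k → κ) : Finset κ :=
  support D \ Finset.univ.image t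

theorem mem_residualKeys : x ∈ residualKeys D t ↔ x ∈ support D ∧ x ∉ Set.range t := by
  simp [residualKeys]

/-- The randomization of the keys of `t`, and that of the residual keys. -/
def splitRandomization (D : Multiset (DataElement κ)) (t : Fin k → κ) (r : κ → ℝ) :
    (Fin k → ℝ) × (residualKeys D t → ℝ) :=
  (fun i => r (t i), fun x => r x)

theorem isTopTuple_iff_mem_smallestEvent (hp : 0 < p) (htinj : Function.Injective t)
    (hts : ∀ i, t i ∈ support D) (hj : ∀ i, i ≤ j) (hr : ∀ x ∈ keys D, 0 < r x) :
    IsTopTuple p r D t ↔ splitRandomization D t r ∈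
      smallestEvent (fun i => |freq D (t i)| ^ p) j fun x : residualKeys D t => |freq D x| ^ p := by
  have hle {x y} (hx : x ∈ support D) (hy : y ∈ support D) :
      transformed p r (freq D) y ≤ transformed p r (freq D) x ↔
        r x / |freq D x| ^ p ≤ r y / |freq D y| ^ p :=
    transformed_le_transformed_iff hp (hr x (mem_support.1 hx).1) (hr y (mem_support.1 hy).1)
      (mem_support.1 hx).2 (mem_support.1 hy).2
  constructor
  · refine fun h => ⟨⟨fun i => (hr _ (h.mem i)).le, fun i i' hi =>
      (hle (hts i) (hts i')).1 (h.antitone hi)⟩, fun ⟨x, hx⟩ => ?_⟩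
    obtain ⟨hxs, hxt⟩ := mem_residualKeys.1 hx
    rw [← le_div_iff₀ (rpow_abs_freq_pos p hxs)]
    exact (hle (hts j) hxs).1 (h.top x (mem_support.1 hxs).1 hxt j)
  · rintro ⟨⟨-, hmono⟩, hresidual⟩
    refine ⟨htinj, fun i => (mem_support.1 (hts i)).1, fun i i' hi =>
      (hle (hts i) (hts i')).2 (hmono hi), fun y hy hyt i => ?_⟩
    by_cases hys : y ∈ support D
    · refine (hle (hts i) hys).2 ((hmono (hj i)).trans ?_)
      rw [le_div_iff₀ (rpow_abs_freq_pos p hys)]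
      exact hresidual ⟨y, mem_residualKeys.2 ⟨hys, hyt⟩⟩
    · have hzero : ¬ 0 < transformed p r (freq D) y :=
        fun h => hys (mem_support_of_transformed_pos hy h)
      exact (not_lt.1 hzero).trans zero_le

theorem lt_card_filter_of_injective {s : Finset κ} (htinj : Function.Injective t)
    {Q : κ → Prop} [DecidablePred Q] (ht : ∀ i, t i ∈ s ∧ Q (t i)) (hx : x ∈ s ∧ Q x)
    (hxt : x ∉ Set.range t) : k < (s.filter Q).card := by
  have hcard : (insert x (Finset.univ.image t)).card = k + 1 := by
    rw [Finset.card_insert_of_notMem (by simpa using hxt),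
      Finset.card_image_of_injective _ htinj, Finset.card_fin]
  refine Nat.lt_of_succ_le (hcard.symm.trans_le ?_)
  refine Finset.card_le_card (Finset.insert_subset (Finset.mem_filter.2 hx) fun y hy => ?_)
  obtain ⟨i, -, rfl⟩ := Finset.mem_image.1 hy
  exact Finset.mem_filter.2 (ht i)

theorem card_filter_rpow_neg_one_div_div_four_lt_le (hp : 0 < p) (hp2 : p ≤ 2) (hM : 0 < M)
    (hr : ∀ x ∈ keys D, 0 < r x) (t : Fin k → κ) :
    ((keys D).filter fun x => M ^ (-(1 / p)) / 4 < transformed p r (freq D) x).card ≤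
      k + ((residualKeys D t).filter fun x => r x < 16 * (M * |freq D x| ^ p)).card := by
  have hsub : ((keys D).filter fun x => M ^ (-(1 / p)) / 4 < transformed p r (freq D) x) ⊆
      Finset.univ.image t ∪
        (residualKeys D t).filter fun x => r x < 16 * (M * |freq D x| ^ p) := by
    intro x hx
    obtain ⟨hxD, hlt⟩ := Finset.mem_filter.1 hx
    have hpos : 0 < transformed p r (freq D) x := lt_of_le_of_lt (b := M ^ (-(1 / p)) / 4)
      (by positivity) hlt
    by_cases hxt : x ∈ Set.range t
    · exact Finset.mem_union_left _ (by simpa using hxt)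
    · exact Finset.mem_union_right _ (Finset.mem_filter.2
        ⟨mem_residualKeys.2 ⟨mem_support_of_transformed_pos hxD hpos, hxt⟩,
          lt_of_rpow_neg_one_div_div_four_lt_transformed hp hp2 hM (hr x hxD) hlt⟩)
  refine (Finset.card_le_card hsub).trans ((Finset.card_union_le _ _).trans ?_)
  exact Nat.add_le_add_right (Finset.card_image_le.trans_eq (Finset.card_fin k)) _

theorem sum_transformed_rpow_le (hp : 0 < p) (hq : 0 < q) (hM : 0 < M)
    (hr : ∀ x ∈ keys D, 0 < r x) (ht : ∀ i, M ^ (-(1 / p)) ≤ transformed p r (freq D) (t i))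
    {ε : ℝ} (hε : ε < M ^ (-(1 / p))) :
    ∑ x ∈ keys D with transformed p r (freq D) x ≤ ε, (transformed p r (freq D) x : ℝ) ^ q ≤
      (M ^ (-(1 / p))) ^ q *
        ∑ x : residualKeys D t, decay (q / p) (M * |freq D x| ^ p) (r x) := by
  set τ := M ^ (-(1 / p))
  set f := transformed p r (freq D)
  have hkeys {x} (hx : x ∈ residualKeys D t) : x ∈ keys D :=
    (mem_support.1 (mem_residualKeys.1 hx).1).1
  rw [Finset.mul_sum, Finset.sum_coe_sort (residualKeys D t)
    fun x => τ ^ q * decay (q / p) (M * |freq D x| ^ p) (r x)]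
  calc ∑ x ∈ keys D with f x ≤ ε, (f x : ℝ) ^ q
      = ∑ x ∈ residualKeys D t with f x ≤ ε, (f x : ℝ) ^ q := by
        refine (Finset.sum_subset (Finset.filter_subset_filter _ fun x => hkeys) ?_).symm
        intro x hx hxU
        obtain ⟨hxD, hle⟩ := Finset.mem_filter.1 hx
        have hxt : x ∉ Set.range t := fun ⟨i, hi⟩ => (ht i).not_gt ((hi ▸ hle).trans_lt hε)
        have hzero : f x = 0 := by
          by_contra hne
          exact hxU (Finset.mem_filter.2 ⟨mem_residualKeys.2
            ⟨mem_support_of_transformed_pos hxD (pos_iff_ne_zero.2 hne), hxt⟩, hle⟩)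
        rw [hzero, NNReal.coe_zero, Real.zero_rpow hq.ne']
    _ = ∑ x ∈ residualKeys D t with f x ≤ ε, τ ^ q * decay (q / p) (M * |freq D x| ^ p) (r x) := by
        refine Finset.sum_congr rfl fun x hx => ?_
        obtain ⟨hxU, hle⟩ := Finset.mem_filter.1 hx
        refine transformed_rpow_eq hp hM (hr x (hkeys hxU)) (not_le.1 fun h => ?_)
        exact (hle.trans_lt hε).not_ge
          ((rpow_neg_one_div_le_transformed_iff hp hM (hr x (hkeys hxU))).2 h)
    _ ≤ ∑ x ∈ residualKeys D t, τ ^ q * decay (q / p) (M * |freq D x| ^ p) (r x) :=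
        Finset.sum_le_sum_of_subset_of_nonneg (Finset.filter_subset _ _) fun x _ _ =>
          mul_nonneg (by positivity)
            (decay_mem_Icc (by positivity) (by positivity) _).1

theorem mem_concentrated_of_mem_balancedEvent (hp : 0 < p) (hpq : p ≤ q) (hq : q ≤ 2)
    (htinj : Function.Injective t) (hts : ∀ i, t i ∈ support D) (hj : ∀ i, i ≤ j)
    (hr : ∀ x ∈ keys D, 0 < r x) (hM : 0 < M) {Λ : ℝ}
    (hsmallest : splitRandomization D t r ∈
      smallestEvent (fun i => |freq D (t i)| ^ p) j fun x : residualKeys D t => |freq D x| ^ p)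
    (hbalanced : splitRandomization D t r ∈
      balancedEvent (fun i => |freq D (t i)| ^ p) j (fun x : residualKeys D t => |freq D x| ^ p) M
        (q / p) Λ) :
    r ∈ concentrated p q (16 * Λ) k (600 * k) D (M ^ (-(1 / p)) / 4) := by
  set τ := M ^ (-(1 / p))
  have hτ0 : 0 < τ := Real.rpow_pos_of_pos hM _
  obtain ⟨hlast, ⟨⟨x, hxU⟩, hx⟩, hcount, hdecay⟩ := hbalanced
  have hle {x} (hx : x ∈ support D) : τ ≤ transformed p r (freq D) x ↔ r x ≤ M * |freq D x| ^ p :=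
    rpow_neg_one_div_le_transformed_iff hp hM (hr x (mem_support.1 hx).1)
  have htτ (i) : τ ≤ transformed p r (freq D) (t i) := by
    rw [hle (hts i), ← div_le_iff₀ (rpow_abs_freq_pos p (hts i))]
    exact (hsmallest.1.2 (hj i)).trans hlast
  refine ⟨hr, .inl ?_, ?_, ?_⟩
  · obtain ⟨hxs, hxt⟩ := mem_residualKeys.1 hxU
    have h34 : 3 * (τ / 4) < τ := by linarith
    exact lt_card_filter_of_injective htinj
      (fun i => ⟨(mem_support.1 (hts i)).1, h34.trans_le (htτ i)⟩)
      ⟨(mem_support.1 hxs).1, h34.trans_le ((hle hxs).2 hx)⟩ hxt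
  · have hcard : ((residualKeys D t).filter fun x => r x < 16 * (M * |freq D x| ^ p)).card <
        513 * k := by
      rw [← Nat.cast_lt (α := ℝ), Finset.card_filter, Nat.cast_sum, ← Finset.sum_coe_sort]
      simpa [Set.indicator_apply, splitRandomization] using hcount
    have := card_filter_rpow_neg_one_div_div_four_lt_le hp (hpq.trans hq) hM hr t
    lia
  · have hS : 0 ≤ ∑ x : residualKeys D t, decay (q / p) (M * |freq D x| ^ p) (r x) :=
      Finset.sum_nonneg fun x _ => (decay_mem_Icc
        (div_nonneg (hp.le.trans hpq) hp.le) (by positivity) _).1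
    calc _ ≤ τ ^ q * ∑ x : residualKeys D t, decay (q / p) (M * |freq D x| ^ p) (r x) :=
          sum_transformed_rpow_le hp (hp.trans_le hpq) hM hr htτ (by linarith)
      _ ≤ τ ^ q * Λ := by gcongr; exact hdecay.le
      _ ≤ τ ^ q * Λ * (16 / 4 ^ q) := le_mul_of_one_le_right
          (mul_nonneg (by positivity) (hS.trans hdecay.le))
          ((one_le_div (by positivity)).2 (four_rpow_le_sixteen hq))
      _ = 16 * Λ * (τ / 4) ^ q := by rw [Real.div_rpow hτ0.le (by norm_num)]; ring

end Residual

section Conditional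

/-- The factor of `k` in the bound for the moment of the residual keys. The logarithm is the price
of the first moment of the decay (`p = q`), which diverges without a cutoff. -/
noncomputable def residualBound (p q : ℝ) (n : ℕ) : ℝ :=
  if p < q then 32 * (q / (q - p)) + 1 else 32 * (1 + Real.log n) + 3

theorem two_mul_sum_integral_decay_add_le {p q : ℝ} (hp : 0 < p) (hpq : p ≤ q) {n k : ℕ}
    (hn : 1 ≤ n) {ι : Type*} [Fintype ι] (hι : Fintype.card ι ≤ n) {a : ι → ℝ} (ha : ∀ x, 0 < a x)
    (hsum : ∑ x, a x = 16 * k) (hk : 1 ≤ k) :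
    2 * ∑ x, ∫ r, decay (q / p) (a x) r ∂expMeasure 1 + k ≤ residualBound p q n * k := by
  unfold residualBound
  split_ifs with h
  · have hmean : ∑ x, ∫ r, decay (q / p) (a x) r ∂expMeasure 1 ≤
        16 * k * (q / p / (q / p - 1)) := by
      rw [← hsum, Finset.sum_mul]
      exact Finset.sum_le_sum fun x _ => integral_decay_le ((one_lt_div hp).2 h) (ha x)
    have hratio : q / p / (q / p - 1) = q / (q - p) := by
      rw [div_sub_one hp.ne', div_div_div_cancel_right₀ hp.ne']
    rw [hratio] at hmean
    linarith
  · have hqp : q / p = 1 := by rw [le_antisymm hpq (not_lt.1 h), div_self (by linarith)]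
    have hmean : ∑ x, ∫ r, decay (q / p) (a x) r ∂expMeasure 1 ≤
        16 * k * (1 + Real.log n) + Fintype.card ι * (1 / n) := by
      rw [hqp, ← hsum, Finset.sum_mul, ← nsmul_eq_mul, ← Finset.card_univ, ← Finset.sum_const,
        ← Finset.sum_add_distrib]
      exact Finset.sum_le_sum fun x _ => integral_decay_one_le (ha x) (Nat.one_le_cast.2 hn)
    have hcard : (Fintype.card ι : ℝ) * (1 / n) ≤ 1 := by
      rw [mul_one_div]
      exact div_le_one_of_le₀ (Nat.cast_le.2 hι) n.cast_nonneg
    have hk' : (1 : ℝ) ≤ k := Nat.one_le_cast.2 hk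
    linarith

variable {Ω κ : Type*} [MeasurableSpace Ω] {P : Measure Ω} [LinearOrder κ] {r : κ → Ω → ℝ}
  {p q : ℝ} {D : Multiset (DataElement κ)} {n k : ℕ}

theorem measure_isTopTuple_eq_zero (H : IsExpHash P r) {t : Fin k → κ}
    (hK : k < (support D).card) (ht : ¬ (Function.Injective t ∧ ∀ i, t i ∈ support D)) :
    P {ω | IsTopTuple p (fun x => r x ω) D t} = 0 := by
  refine measure_mono_null (t := {ω | ¬ ∀ x ∈ keys D, 0 < r x ω})
    (fun ω (hω : IsTopTuple _ _ _ _) hpos => ?_) (ae_iff.1 (H.ae_pos (keys D)))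
  exact ht ⟨hω.injective, hω.mem_support hpos hK⟩

theorem IsExpHash.ae_mem_concentrated_zero (H : IsExpHash P r) (p : ℝ) (hq : 0 < q) (L : ℝ)
    (k : ℕ) {m : ℕ} (hm : (support D).card < m) :
    ∀ᵐ ω ∂P, (fun x => r x ω) ∈ concentrated p q L k m D 0 :=
  (H.ae_pos (keys D)).mono fun _ hω => mem_concentrated_zero hq L k hω hm

variable [IsProbabilityMeasure P]

theorem measure_isTopTuple_sdiff_concentrated_le (H : IsExpHash P r) (hp : 0 < p) (hpq : p ≤ q)
    (hq : q ≤ 2) (hn : 1 ≤ n) (hDn : (keys D).card ≤ n) (hk : 1 ≤ k) {t : Fin k → κ}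
    (htinj : Function.Injective t) (hts : ∀ i, t i ∈ support D) {M : ℝ} (hM : 0 < M)
    (hMW : M * ∑ x : residualKeys D t, |freq D x| ^ p = 16 * k) :
    P ({ω | IsTopTuple p (fun x => r x ω) D t} \ {ω | (fun x => r x ω) ∈
        concentrated p q (16 * (residualBound p q n * k)) k (600 * k) D (M ^ (-(1 / p)) / 4)}) ≤
      ENNReal.ofReal (3 * Real.exp (-k)) * P {ω | IsTopTuple p (fun x => r x ω) D t} := by
  set c : Fin k → ℝ := fun i => |freq D (t i)| ^ p
  set w : residualKeys D t → ℝ := fun x => |freq D x| ^ p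
  set j : Fin k := ⟨k - 1, by lia⟩ with hj
  have hjle (i : Fin k) : i ≤ j := Fin.le_def.2 (by simp only [hj]; lia)
  have hw (x) : 0 < w x := rpow_abs_freq_pos p (mem_residualKeys.1 x.2).1
  have hcard : Fintype.card (residualKeys D t) ≤ n := by
    rw [Fintype.card_coe]
    exact (Finset.card_le_card fun x hx =>
      (mem_support.1 (mem_residualKeys.1 hx).1).1).trans hDn
  set Φ : Ω → (Fin k → ℝ) × (residualKeys D t → ℝ) :=
    fun ω => splitRandomization D t fun x => r x ω
  have hΦ : Measurable Φ := (measurable_pi_lambda _ fun i => H.measurable _).prodMk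
    (measurable_pi_lambda _ fun i => H.measurable _)
  have hlaw : P.map Φ = (expPi (Fin k)).prod (expPi (residualKeys D t)) :=
    H.map_prod htinj _ fun i hi => (mem_residualKeys.1 hi).2 ⟨i, rfl⟩
  have hiff : ∀ᵐ ω ∂P, IsTopTuple p (fun x => r x ω) D t ↔ Φ ω ∈ smallestEvent c j w :=
    (H.ae_pos (keys D)).mono fun ω => isTopTuple_iff_mem_smallestEvent hp htinj hts hjle
  calc _ ≤ P (Φ ⁻¹' (smallestEvent c j w \
          balancedEvent c j w M (q / p) (residualBound p q n * k))) := by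
        refine measure_mono_ae ?_
        filter_upwards [H.ae_pos (keys D), hiff] with ω hpos hω hmem
        exact ⟨hω.1 hmem.1, fun hbalanced => hmem.2 (mem_concentrated_of_mem_balancedEvent hp hpq hq
          htinj hts hjle hpos hM (hω.1 hmem.1) hbalanced)⟩
    _ ≤ P.map Φ (smallestEvent c j w \
          balancedEvent c j w M (q / p) (residualBound p q n * k)) :=
        Measure.le_map_apply hΦ.aemeasurable _
    _ ≤ ENNReal.ofReal (3 * Real.exp (-k)) * P.map Φ (smallestEvent c j w) := by
        rw [hlaw]
        exact prod_smallestEvent_sdiff_balancedEvent_le (rpow_abs_freq_pos p (hts j))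
          (fun x => (hw x).le) hM.le hMW (div_nonneg (hp.le.trans hpq) hp.le) le_rfl
          (two_mul_sum_integral_decay_add_le hp hpq hn hcard (fun x => mul_pos hM (hw x))
            (by rw [← Finset.mul_sum, hMW]) hk)
    _ = _ := by
        rw [Measure.map_apply hΦ (measurableSet_smallestEvent c j w)]
        congr 1
        exact measure_congr (hiff.mono fun ω hω => propext hω.symm)

theorem exists_concentrated_of_lt_card_support (H : IsExpHash P r) (hp : 0 < p) (hpq : p ≤ q)
    (hq : q ≤ 2) (hDn : (keys D).card ≤ n) (hk : 1 ≤ k) (hK : k < (support D).card)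
    (t : Fin k → κ) :
    ∃ ε, 0 ≤ ε ∧ (1 - 3 * Real.exp (-k)) * P.real {ω | IsTopTuple p (fun x => r x ω) D t} ≤
      P.real ({ω | IsTopTuple p (fun x => r x ω) D t} ∩ {ω | (fun x => r x ω) ∈
        concentrated p q (16 * (residualBound p q n * k)) k (600 * k) D ε}) := by
  by_cases ht : Function.Injective t ∧ ∀ i, t i ∈ support D
  swap
  · refine ⟨0, le_rfl, ?_⟩
    rw [measureReal_def, measure_isTopTuple_eq_zero H hK ht, ENNReal.toReal_zero, mul_zero]
    exact measureReal_nonneg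
  have hnonempty : Nonempty (residualKeys D t) := by
    have hcard : (Finset.univ.image t).card < (support D).card :=
      (Finset.card_image_le.trans_eq (Finset.card_fin k)).trans_lt hK
    obtain ⟨x, hx, hxt⟩ := Finset.exists_mem_notMem_of_card_lt_card hcard
    exact ⟨x, Finset.mem_sdiff.2 ⟨hx, hxt⟩⟩
  have hn : 1 ≤ n := by
    have : (support D).card ≤ (keys D).card := Finset.card_le_card (Finset.filter_subset _ _)
    lia
  have hW : 0 < ∑ x : residualKeys D t, |freq D x| ^ p :=
    Finset.sum_pos (fun x _ => rpow_abs_freq_pos p (mem_residualKeys.1 x.2).1)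
      Finset.univ_nonempty
  set M : ℝ := 16 * k / ∑ x : residualKeys D t, |freq D x| ^ p
  have hM : 0 < M := by positivity
  refine ⟨M ^ (-(1 / p)) / 4, by positivity, ?_⟩
  have hfail := ENNReal.toReal_mono (ENNReal.mul_ne_top ENNReal.ofReal_ne_top (measure_ne_top _ _))
    (measure_isTopTuple_sdiff_concentrated_le H hp hpq hq hn hDn hk ht.1 ht.2 hM
      (div_mul_cancel₀ _ hW.ne'))
  rw [ENNReal.toReal_mul, ENNReal.toReal_ofReal (by positivity)] at hfail
  have hsplit := measureReal_sdiff_add_inter (μ := P)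
    (s := {ω | IsTopTuple p (fun x => r x ω) D t}) (H.measurable_fun (measurableSet_concentrated
      p q (16 * (residualBound p q n * k)) k (600 * k) D (M ^ (-(1 / p)) / 4)))
  simp only [measureReal_def, Set.preimage] at hsplit hfail ⊢
  linarith

/-- The scale `ε` depends on `t`, since it is determined by the frequencies of the other keys. -/
theorem exists_concentrated (H : IsExpHash P r) (hp : 0 < p) (hpq : p ≤ q) (hq : q ≤ 2)
    (hDn : (keys D).card ≤ n) (hk : 1 ≤ k) (t : Fin k → κ) :
    ∃ ε, 0 ≤ ε ∧ (1 - 3 * Real.exp (-k)) * P.real {ω | IsTopTuple p (fun x => r x ω) D t} ≤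
      P.real ({ω | IsTopTuple p (fun x => r x ω) D t} ∩ {ω | (fun x => r x ω) ∈
        concentrated p q (16 * (residualBound p q n * k)) k (600 * k) D ε}) := by
  rcases lt_or_ge k (support D).card with hK | hK
  · exact exists_concentrated_of_lt_card_support H hp hpq hq hDn hk hK t
  · refine ⟨0, le_rfl, ?_⟩
    rw [measureReal_congr (inter_ae_eq_left_of_ae_eq_univ (Filter.eventuallyEq_univ.2
      (H.ae_mem_concentrated_zero p (hp.trans_le hpq) _ k (by lia))))]
    exact mul_le_of_le_one_left measureReal_nonneg (by linarith [Real.exp_pos (-k)])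

end Conditional

/-! ### Success probability -/

section Success

variable {Ω κ : Type*} [LinearOrder κ] {r : κ → Ω → ℝ} {p q γ : ℝ}
  {D : Multiset (DataElement κ)} {n k : ℕ}

theorem iUnion_isTopTuple_eq_univ (p : ℝ) (r : κ → Ω → ℝ) (hk : k ≤ (keys D).card) :
    ⋃ t : Fin k → keys D, {ω | IsTopTuple p (fun x => r x ω) D fun i => t i} = Set.univ := by
  refine Set.eq_univ_of_forall fun ω => Set.mem_iUnion.2 ?_
  obtain ⟨t, ht⟩ := exists_isTopTuple p (fun x => r x ω) hk
  exact ⟨fun i => ⟨t i, ht.mem i⟩, ht⟩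

variable [MeasurableSpace Ω] {P : Measure Ω} [IsProbabilityMeasure P]

theorem IsExpHash.aedisjoint_isTopTuple (H : IsExpHash P r) (hp : 0 < p)
    (hK : k < (support D).card) {t t' : Fin k → κ} (htt' : t ≠ t') :
    AEDisjoint P {ω | IsTopTuple p (fun x => r x ω) D t}
      {ω | IsTopTuple p (fun x => r x ω) D t'} := by
  refine measure_mono_null (t := {ω | ¬ ((∀ x ∈ keys D, 0 < r x ω) ∧
    Set.InjOn (transformed p (fun x => r x ω) (freq D)) (support D))})
    (fun ω hω hgood => htt' ?_) (ae_iff.1 ((H.ae_pos (keys D)).and (H.ae_injOn hp D)))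
  exact IsTopTuple.unique hω.1 hω.2 hgood.1 hK hgood.2

theorem mul_measureReal_isTopTuple_le (H : IsExpHash P r) (hp : 0 < p) (hpq : p ≤ q)
    (hq : q ≤ 2) (hDn : (keys D).card ≤ n) (hk : 1 ≤ k) (hγ : 0 ≤ γ) {A : Set Ω}
    (hA : ∀ ε, 0 ≤ ε → ∀ V ⊆ concentrated p q (16 * (residualBound p q n * k)) k (600 * k) D ε,
      MeasurableSet V → γ * P.real {ω | (fun x => r x ω) ∈ V} ≤
        P.real ({ω | (fun x => r x ω) ∈ V} ∩ A))
    (t : Fin k → κ) :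
    γ * (1 - 3 * Real.exp (-k)) * P.real {ω | IsTopTuple p (fun x => r x ω) D t} ≤
      P.real ({ω | IsTopTuple p (fun x => r x ω) D t} ∩ A) := by
  set L := 16 * (residualBound p q n * k)
  obtain ⟨ε, hε, hconcentrated⟩ := exists_concentrated H hp hpq hq hDn hk t
  set V : Set (κ → ℝ) := {r | IsTopTuple p r D t} ∩ concentrated p q L k (600 * k) D ε
  calc γ * (1 - 3 * Real.exp (-k)) * P.real {ω | IsTopTuple p (fun x => r x ω) D t}
      ≤ γ * P.real {ω | (fun x => r x ω) ∈ V} := by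
        rw [mul_assoc]
        exact mul_le_mul_of_nonneg_left hconcentrated hγ
    _ ≤ P.real ({ω | (fun x => r x ω) ∈ V} ∩ A) := hA ε hε V Set.inter_subset_right
        ((measurableSet_isTopTuple p D t).inter (measurableSet_concentrated p q L _ _ D ε))
    _ ≤ _ := measureReal_mono (Set.inter_subset_inter_left A fun ω hω => hω.1)

theorem mul_one_sub_exp_le_measureReal (H : IsExpHash P r) (hp : 0 < p) (hpq : p ≤ q)
    (hq : q ≤ 2) (hDn : (keys D).card ≤ n) (hk : 1 ≤ k) (hγ : 0 ≤ γ) {A : Set Ω}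
    (hA : ∀ ε, 0 ≤ ε → ∀ V ⊆ concentrated p q (16 * (residualBound p q n * k)) k (600 * k) D ε,
      MeasurableSet V → γ * P.real {ω | (fun x => r x ω) ∈ V} ≤
        P.real ({ω | (fun x => r x ω) ∈ V} ∩ A)) :
    γ * (1 - 3 * Real.exp (-k)) ≤ P.real A := by
  rcases le_or_gt (support D).card k with hK | hK
  · set L := 16 * (residualBound p q n * k)
    have hone : P.real {ω | (fun x => r x ω) ∈ concentrated p q L k (600 * k) D 0} = 1 := by
      rw [measureReal_congr (Filter.eventuallyEq_univ.2
        (H.ae_mem_concentrated_zero p (hp.trans_le hpq) L k (by lia))), probReal_univ]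
    calc γ * (1 - 3 * Real.exp (-k)) ≤ γ * 1 := by
          gcongr
          linarith [Real.exp_pos (-k)]
      _ ≤ P.real ({ω | (fun x => r x ω) ∈ concentrated p q L k (600 * k) D 0} ∩ A) :=
          hone ▸ hA 0 le_rfl _ subset_rfl (measurableSet_concentrated p q L _ _ D 0)
      _ ≤ P.real A := measureReal_mono Set.inter_subset_right
  · have hkD : k ≤ (keys D).card := hK.le.trans (Finset.card_le_card (Finset.filter_subset _ _))
    refine le_measureReal_of_mul_le_measureReal_inter
      (fun t => H.measurable_fun (measurableSet_isTopTuple p D _)) (fun t t' htt' => ?_)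
      (iUnion_isTopTuple_eq_univ p r hkD)
      fun t => mul_measureReal_isTopTuple_le H hp hpq hq hDn hk hγ hA fun i => t i
    refine H.aedisjoint_isTopTuple hp hK fun heq => htt' ?_
    exact funext fun i => Subtype.ext (congrFun heq i)

theorem succeedsWithProb_of_concentrated {σ : Type*} (H : IsExpHash P r) (hp : 0 < p)
    (hpq : p ≤ q) (hq : q ≤ 2) (hDn : (keys D).card ≤ n) (hk : 1 ≤ k) (hγ : 0 ≤ γ)
    {R : Ω → FrequencySketch n σ} {keyHash : κ → Fin n} {a₁ a₂ : Aggregation κ}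
    (hR : ∀ ε, 0 ≤ ε → ∀ V ⊆ concentrated p q (16 * (residualBound p q n * k)) k (600 * k) D ε,
      MeasurableSet V → γ * P.real {ω | (fun x => r x ω) ∈ V} ≤
        P.real ({ω | (fun x => r x ω) ∈ V} ∩ {ω | IsExactSample p k (fun x => r x ω) D
          (twoPassSample (R ω) p k (600 * k) keyHash (fun x => r x ω) a₁ a₂)})) :
    SucceedsWithProb P (γ * (1 - 3 * Real.exp (-k))) R p k (600 * k) keyHash r D a₁ a₂ := by
  refine ⟨mul_one_sub_exp_le_measureReal H hp hpq hq hDn hk hγ hR, fun t ht => ?_⟩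
  have htop : MeasurableSet {ω | IsTopTuple p (fun x => r x ω) D t} :=
    H.measurable_fun (measurableSet_isTopTuple p D t)
  rw [measureReal_def, cond_apply htop,
    ENNReal.toReal_mul, ENNReal.toReal_inv, ← measureReal_def, ← measureReal_def, inv_mul_eq_div]
  exact (le_div_iff₀ (ENNReal.toReal_pos ht (measure_ne_top _ _))).2
    (mul_measureReal_isTopTuple_le H hp hpq hq hDn hk hγ hR t)

end Success

/-! ### The first pass -/

section Sketches

variable {κ : Type*} [LinearOrder κ] {n k b : ℕ} {p q L ε : ℝ} {keyHash : κ → Fin n}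
  {r : κ → ℝ} {D : Multiset (DataElement κ)} {a₁ a₂ : Aggregation κ}

theorem isExactSample_of_concentrated {σ : Type*} (R : FrequencySketch n σ) (hkb : k < b)
    (hinj : Set.InjOn keyHash (keys D)) (h₂ : a₂.dataset = D)
    (hr : r ∈ concentrated p q L k b D ε)
    (herr : ∀ z, |R.est (passOne R p keyHash r a₁) z -
      freq (D.map (outputElement p keyHash r)) z| ≤ ε) :
    IsExactSample p k r D (twoPassSample R p k b keyHash r a₁ a₂) := by
  refine isExactSample_twoPassSample R h₂ hkb (fun x hx => ?_) hr.2.2.1 hr.2.1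
  have herr := herr (keyHash x)
  rw [freq_map_outputElement_of_injOn p r hinj hx] at herr
  exact (abs_norm_sub_norm_le _ _).trans herr

/-- The hashes of the keys with transformed frequencies larger than `ε`: the heavy hitters of the
first pass. -/
noncomputable def largeHashes (p ε : ℝ) (keyHash : κ → Fin n) (r : κ → ℝ)
    (D : Multiset (DataElement κ)) : Finset (Fin n) :=
  ((keys D).filter fun x => ε < transformed p r (freq D) x).image keyHash

theorem card_largeHashes_lt (keyHash : κ → Fin n) (hr : r ∈ concentrated p q L k b D ε) :
    (largeHashes p ε keyHash r D).card < b :=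
  Finset.card_image_le.trans_lt hr.2.2.1

theorem sum_compl_largeHashes_le (hinj : Set.InjOn keyHash (keys D)) (hq : 0 < q)
    (hr : r ∈ concentrated p q L k b D ε) :
    ∑ z ∈ Finset.univ \ largeHashes p ε keyHash r D,
      |freq (D.map (outputElement p keyHash r)) z| ^ q ≤ L * ε ^ q := by
  set s := (keys D).filter fun x => (transformed p r (freq D) x : ℝ) ≤ ε
  have hsD : s ⊆ keys D := Finset.filter_subset _ _
  have hsub : s.image keyHash ⊆ Finset.univ \ largeHashes p ε keyHash r D := by
    intro z hz
    obtain ⟨x, hx, rfl⟩ := Finset.mem_image.1 hz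
    refine Finset.mem_sdiff.2 ⟨Finset.mem_univ _, fun hlarge => ?_⟩
    obtain ⟨y, hy, hyx⟩ := Finset.mem_image.1 hlarge
    rw [Finset.mem_filter] at hx hy
    rw [hinj hy.1 hx.1 hyx] at hy
    exact hy.2.not_ge hx.2
  have hzero : ∀ z ∈ Finset.univ \ largeHashes p ε keyHash r D, z ∉ s.image keyHash →
      |freq (D.map (outputElement p keyHash r)) z| ^ q = 0 := by
    intro z hz hzs
    rw [freq_map_outputElement_of_notMem p r, abs_zero, Real.zero_rpow hq.ne']
    intro hzD
    obtain ⟨x, hx, rfl⟩ := Finset.mem_image.1 hzD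
    rcases le_or_gt (transformed p r (freq D) x : ℝ) ε with h | h
    · exact hzs (Finset.mem_image_of_mem _ (Finset.mem_filter.2 ⟨hx, h⟩))
    · exact (Finset.mem_sdiff.1 hz).2
        (Finset.mem_image_of_mem _ (Finset.mem_filter.2 ⟨hx, h⟩))
  rw [← Finset.sum_subset hsub hzero, Finset.sum_image (hinj.mono hsD)]
  refine (Finset.sum_congr rfl fun x hx => ?_).trans_le hr.2.2.2
  rw [freq_map_outputElement_of_injOn p r hinj (hsD hx)]
  rfl

theorem isExactSample_counters {m : ℕ} (hkb : k < b) (hD : ∀ e ∈ D, 0 ≤ e.val)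
    (hinj : Set.InjOn keyHash (keys D)) (h₁ : a₁.dataset = D) (h₂ : a₂.dataset = D) (hε : 0 ≤ ε)
    (hL : 0 ≤ L) (hm : b + L ≤ m) (hr : r ∈ concentrated p 1 L k b D ε) :
    IsExactSample p k r D (twoPassSample (counters n m) p k b keyHash r a₁ a₂) := by
  set J := largeHashes p ε keyHash r D
  have hJb : (J.card : ℝ) ≤ b := by exact_mod_cast (card_largeHashes_lt keyHash hr).le
  have hJm : J.card ≤ m := by
    rw [← Nat.cast_le (α := ℝ)]
    linarith
  have hdataset : (a₁.map (outputElement p keyHash r)).dataset =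
      D.map (outputElement p keyHash r) := by rw [Aggregation.dataset_map, h₁]
  have hnonneg : ∀ e ∈ D.map (outputElement p keyHash r), 0 ≤ e.val := by
    intro e' he'
    obtain ⟨e, he, rfl⟩ := Multiset.mem_map.1 he'
    exact div_nonneg (hD e he) (Real.rpow_nonneg (hr.1 _ (mem_keys_of_mem he)).le _)
  refine isExactSample_of_concentrated _ hkb hinj h₂ hr fun z => ?_
  rw [passOne, ← hdataset]
  refine abs_counters_est_sub_le (hdataset ▸ hnonneg) hJm ?_ z
  calc ∑ z ∈ Finset.univ \ J, freq (a₁.map (outputElement p keyHash r)).dataset z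
      ≤ ∑ z ∈ Finset.univ \ J, |freq (D.map (outputElement p keyHash r)) z| ^ (1 : ℝ) := by
        rw [hdataset]
        exact Finset.sum_le_sum fun z _ => (le_abs_self _).trans_eq (Real.rpow_one _).symm
    _ ≤ L * ε ^ (1 : ℝ) := sum_compl_largeHashes_le hinj one_pos hr
    _ ≤ (m + 1 - J.card) * ε := by
        rw [Real.rpow_one]
        gcongr
        linarith

theorem isExactSample_countSketch {d w : ℕ} {h : Fin d → Fin n → Fin w}
    {s : Fin d → Fin n → Bool} (hkb : k < b) (hinj : Set.InjOn keyHash (keys D))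
    (h₁ : a₁.dataset = D) (h₂ : a₂.dataset = D) (hr : r ∈ concentrated p q L k b D ε)
    (hrows : ∀ z, (Finset.univ.filter fun i => ε < |rowEstimate (h i) (s i)
        (freq (D.map (outputElement p keyHash r))) z -
      freq (D.map (outputElement p keyHash r)) z|).card < d - d / 2) :
    IsExactSample p k r D (twoPassSample (countSketch d w h s) p k b keyHash r a₁ a₂) := by
  refine isExactSample_of_concentrated _ hkb hinj h₂ hr fun z => ?_
  rw [passOne, countSketch_est_run, Aggregation.dataset_map, h₁]
  exact abs_median_sub_le (hrows z)

end Sketches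

/-! ### Success of `CountSketch` -/

section CountSketchSuccess

theorem measurable_freq_map_outputElement {κ : Type*} [LinearOrder κ] {n : ℕ} (p : ℝ)
    (keyHash : κ → Fin n) (D : Multiset (DataElement κ)) (z : Fin n) :
    Measurable fun r : κ → ℝ => freq (D.map (outputElement p keyHash r)) z := by
  simp_rw [fun r => freq_map_outputElement p keyHash r D subset_rfl z]
  exact Finset.measurable_sum _ fun x _ =>
    measurable_const.div ((measurable_pi_apply x).pow_const _)

theorem measurableSet_exists_le_card_rowEstimate {α : Type*} [MeasurableSpace α] {n d w : ℕ}
    {f : α → Fin n → ℝ} (hf : ∀ z, Measurable fun a => f a z) (ε : ℝ) (m : ℕ) :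
    MeasurableSet {z : α × ((Fin d → Fin n → Fin w) × (Fin d → Fin n → Bool)) |
      ∃ x, m ≤ (Finset.univ.filter fun i =>
        ε < |rowEstimate (z.2.1 i) (z.2.2 i) (f z.1) x - f z.1 x|).card} := by
  rw [Set.ofPred_exists]
  refine .iUnion fun x => ?_
  have hrow (i : Fin d) :
      MeasurableSet {z : α × ((Fin d → Fin n → Fin w) × (Fin d → Fin n → Bool)) |
        ε < |rowEstimate (z.2.1 i) (z.2.2 i) (f z.1) x - f z.1 x|} := by
    refine measurableSet_lt measurable_const (measurable_from_prod_countable_left fun η => ?_)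
    simp only [rowEstimate]
    fun_prop
  exact measurableSet_card_filter Finset.univ hrow (m ≤ ·)

theorem one_sub_mul_measureReal_le_countSketch {Ω κ : Type*} [MeasurableSpace Ω] [LinearOrder κ]
    {P : Measure Ω} [IsProbabilityMeasure P] {n k b d w : ℕ} {p L ε : ℝ} {keyHash : κ → Fin n}
    {D : Multiset (DataElement κ)} {a₁ a₂ : Aggregation κ} {r : κ → Ω → ℝ}
    {h : Fin d → Fin n → Ω → Fin w} {s : Fin d → Fin n → Ω → Bool} (hr : IsExpHash P r)
    (H : IsCountSketchHash P h s)
    (hind : IndepFun (fun ω x => r x ω)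
      (fun ω => ((fun i x => h i x ω), (fun i x => s i x ω))) P)
    (hkb : k < b) (hinj : Set.InjOn keyHash (keys D)) (h₁ : a₁.dataset = D) (h₂ : a₂.dataset = D)
    (hε : 0 ≤ ε) (hb : (b : ℝ) ≤ Real.exp (-4) / 2 * w) (hL : L ≤ Real.exp (-4) / 2 * w)
    {V : Set (κ → ℝ)} (hVc : V ⊆ concentrated p 2 L k b D ε) (hV : MeasurableSet V) :
    (1 - n * Real.exp (-d)) * P.real {ω | (fun x => r x ω) ∈ V} ≤
      P.real ({ω | (fun x => r x ω) ∈ V} ∩ {ω | IsExactSample p k (fun x => r x ω) D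
        (twoPassSample (countSketch d w (fun i x => h i x ω) (fun i x => s i x ω)) p k b
          keyHash (fun x => r x ω) a₁ a₂)}) := by
  have hhash : Measurable fun ω =>
      ((fun i x => h i x ω : Fin d → Fin n → Fin w), (fun i x => s i x ω)) :=
    (measurable_pi_lambda _ fun i => measurable_pi_lambda _ fun x => H.measurable_h i x).prodMk
      (measurable_pi_lambda _ fun i => measurable_pi_lambda _ fun x => H.measurable_s i x)
  set f : (κ → ℝ) → Fin n → ℝ := fun r' => freq (D.map (outputElement p keyHash r'))
  set A : Set ((κ → ℝ) × ((Fin d → Fin n → Fin w) × (Fin d → Fin n → Bool))) :=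
    {z | ∃ x, d - d / 2 ≤ (Finset.univ.filter fun i =>
      ε < |rowEstimate (z.2.1 i) (z.2.2 i) (f z.1) x - f z.1 x|).card}
  have hA : MeasurableSet A := measurableSet_exists_le_card_rowEstimate
    (measurable_freq_map_outputElement p keyHash D) ε (d - d / 2)
  have hbad (r' : κ → ℝ) (hr' : r' ∈ V) :
      P.real {ω | (r', (fun i x => h i x ω), (fun i x => s i x ω)) ∈ A} ≤ n * Real.exp (-d) := by
    refine H.measureReal_exists_half_le_card_le (f := f r')
      (J := largeHashes p ε keyHash r' D) hε ?_ ?_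
    · exact le_trans (mod_cast (card_largeHashes_lt keyHash (hVc hr')).le) hb
    · have hresidual := sum_compl_largeHashes_le hinj two_pos (hVc hr')
      simp only [Real.rpow_two, sq_abs] at hresidual
      exact hresidual.trans ((mul_le_mul_of_nonneg_right hL (sq_nonneg ε)).trans_eq (by ring))
  refine (one_sub_mul_measureReal_le_of_indepFun hr.measurable_fun hhash hind hV hA
    (by positivity) hbad).trans (measureReal_mono fun ω hω => ⟨hω.1, ?_⟩)
  refine isExactSample_countSketch hkb hinj h₁ h₂ (hVc hω.1) fun x => ?_
  by_contra! hge
  exact hω.2 ⟨x, hge⟩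

end CountSketchSuccess

/-! ### Sketch sizes -/

section Width

variable {p q : ℝ} {n k : ℕ}

theorem residualBound_nonneg (hp : 0 < p) (hpq : p ≤ q) (n : ℕ) : 0 ≤ residualBound p q n := by
  have hratio : 0 ≤ q / (q - p) := div_nonneg (hp.le.trans hpq) (sub_nonneg.2 hpq)
  unfold residualBound
  split_ifs <;> positivity

/-- The reciprocal of the parameter `ψ` of the residual heavy hitters, for which the sketch resolves
both the `600 * k` largest keys and the residual moment of order `q`. -/
noncomputable def widthFactor (p q : ℝ) (n : ℕ) : ℝ :=
  2 * Real.exp 4 * (600 + 16 * residualBound p q n)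

/-- The constant in the bounds for `widthFactor`. The first summand serves `p < q`, the second one
`p = q`, where `q / (q - p)` is the junk value `0`. -/
noncomputable def widthConstant (p q : ℝ) : ℝ :=
  2 * Real.exp 4 * (600 + 16 * (32 * (q / (q - p)) + 1)) + 2 * Real.exp 4 * 2832

theorem one_le_widthFactor (hp : 0 < p) (hpq : p ≤ q) (n : ℕ) : 1 ≤ widthFactor p q n := by
  have hresidual := residualBound_nonneg hp hpq n
  have hexp : 1 ≤ Real.exp 4 := Real.one_le_exp (by norm_num)
  unfold widthFactor
  nlinarith

theorem widthConstant_nonneg (hp : 0 < p) (hpq : p ≤ q) : 0 ≤ widthConstant p q := by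
  have hratio : 0 ≤ q / (q - p) := div_nonneg (hp.le.trans hpq) (sub_nonneg.2 hpq)
  unfold widthConstant
  positivity

theorem widthFactor_le_of_lt (h : p < q) (n : ℕ) : widthFactor p q n ≤ widthConstant p q := by
  rw [widthFactor, residualBound, if_pos h, widthConstant]
  exact le_add_of_nonneg_right (by positivity)

theorem one_le_two_mul_log (hn : 2 ≤ n) : 1 ≤ 2 * Real.log n := by
  have hmono : Real.log 2 ≤ Real.log n := Real.log_le_log two_pos (by exact_mod_cast hn)
  linarith [Real.log_two_gt_d9]

theorem widthFactor_le_of_eq (h : p = q) (hn : 2 ≤ n) :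
    widthFactor p q n ≤ widthConstant p q * Real.log n := by
  have hlog := one_le_two_mul_log hn
  calc widthFactor p q n
      = 2 * Real.exp 4 * (600 + 16 * (32 * (1 + Real.log n) + 3)) := by
        rw [widthFactor, residualBound, if_neg h.not_lt]
    _ ≤ 2 * Real.exp 4 * (2832 * Real.log n) := by
        gcongr
        linarith
    _ ≤ widthConstant p q * Real.log n := by
        rw [← mul_assoc, widthConstant, h, sub_self, div_zero]
        gcongr
        exact le_add_of_nonneg_left (by positivity)

theorem sketchWidth_le {K : ℝ} (hK : 1 ≤ K) (hk : 1 ≤ k) :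
    (sketchWidth 1 (k + 1) (1 / K) : ℝ) ≤ 3 * (k * K) := by
  have hk' : (1 : ℝ) ≤ k := by exact_mod_cast hk
  calc (sketchWidth 1 (k + 1) (1 / K) : ℝ) ≤ 1 * ((k + 1 : ℕ) : ℝ) / (1 / K) + 1 :=
        (Nat.ceil_lt_add_one (by positivity)).le
    _ = (k + 1) * K + 1 := by simp
    _ ≤ 3 * (k * K) := by nlinarith

theorem add_le_exp_mul_sketchWidth (hp : 0 < p) (hpq : p ≤ q) (n k : ℕ) :
    ((600 * k : ℕ) : ℝ) + 16 * (residualBound p q n * k) ≤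
      Real.exp (-4) / 2 * sketchWidth 1 (k + 1) (1 / widthFactor p q n) := by
  have hresidual := residualBound_nonneg hp hpq n
  have hexp : Real.exp (-4) * Real.exp 4 = 1 := by rw [← Real.exp_add]; simp
  calc ((600 * k : ℕ) : ℝ) + 16 * (residualBound p q n * k)
      = (600 + 16 * residualBound p q n) * k := by push_cast; ring
    _ ≤ (600 + 16 * residualBound p q n) * (k + 1) := by gcongr; linarith
    _ = Real.exp (-4) / 2 * (1 * ((k + 1 : ℕ) : ℝ) / (1 / widthFactor p q n)) := by
        rw [one_mul, div_div_eq_mul_div, div_one, widthFactor]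
        push_cast
        linear_combination (-(600 + 16 * residualBound p q n) * (k + 1)) * hexp
    _ ≤ _ := by
        gcongr
        exact Nat.le_ceil _

end Width

section Depth

variable {n : ℕ} {c : ℝ}

theorem log_div_rpow_neg (hn : n ≠ 0) (c : ℝ) :
    Real.log (n / (n : ℝ) ^ (-c)) = (1 + c) * Real.log n := by
  have hn' : (0 : ℝ) < n := by positivity
  rw [Real.log_div hn'.ne' (Real.rpow_pos_of_pos hn' _).ne', Real.log_rpow hn']
  ring

theorem sketchDepth_le (hc : 0 ≤ c) (hn : 2 ≤ n) :
    (sketchDepth 1 n ((n : ℝ) ^ (-c)) : ℝ) ≤ (3 + c) * Real.log n := by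
  have hlog := one_le_two_mul_log hn
  rw [sketchDepth, log_div_rpow_neg (by lia), one_mul]
  refine (Nat.ceil_lt_add_one (mul_nonneg (by linarith) (by linarith))).le.trans ?_
  linarith

theorem mul_exp_neg_sketchDepth_le (hn : n ≠ 0) (c : ℝ) :
    n * Real.exp (-(sketchDepth 1 n ((n : ℝ) ^ (-c)) : ℝ)) ≤ (n : ℝ) ^ (-c) := by
  have hn' : (0 : ℝ) < n := by positivity
  have hdepth : (1 + c) * Real.log n ≤ sketchDepth 1 n ((n : ℝ) ^ (-c)) := by
    rw [← log_div_rpow_neg hn c, sketchDepth, one_mul]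
    exact Nat.le_ceil _
  calc n * Real.exp (-(sketchDepth 1 n ((n : ℝ) ^ (-c)) : ℝ))
      ≤ n * Real.exp (-((1 + c) * Real.log n)) := by gcongr
    _ = Real.exp (Real.log n) * Real.exp (-((1 + c) * Real.log n)) := by rw [Real.exp_log hn']
    _ = (n : ℝ) ^ (-c) := by
      rw [← Real.exp_add, Real.rpow_def_of_pos hn']
      ring_nf

end Depth

section Sizes

variable {κ : Type*} [LinearOrder κ] {n k : ℕ} {p : ℝ}

theorem twoPassKeyStrings_le {σ : Type*} (R : FrequencySketch n σ) (p : ℝ) (keyHash : κ → Fin n)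
    (r : κ → ℝ) (a₁ a₂ : Aggregation κ) {b : ℕ} {C : ℝ} (hC : (b : ℝ) ≤ C) :
    (twoPassKeyStrings R p (b * k) keyHash r a₁ a₂ : ℝ) ≤ C * k :=
  calc (twoPassKeyStrings R p (b * k) keyHash r a₁ a₂ : ℝ) ≤ ((b * k : ℕ) : ℝ) :=
        Nat.cast_le.2 (card_keys_topSketch_run_le _ _ _)
    _ ≤ C * k := by
        rw [Nat.cast_mul]
        gcongr

theorem twoPassWords_le {σ : Type*} (R : FrequencySketch n σ) (p : ℝ) (m : ℕ)
    (keyHash : κ → Fin n) (r : κ → ℝ) (a₁ a₂ : Aggregation κ) :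
    twoPassWords R p m keyHash r a₁ a₂ ≤ R.words (passOne R p keyHash r a₁) + 2 * m :=
  Nat.add_le_add_left (Nat.mul_le_mul_left 2 (card_keys_topSketch_run_le _ _ _)) _

/-- The constant in the size bounds for the two-pass method with `CountSketch`. -/
noncomputable def countSketchConstant (p c : ℝ) : ℝ := 3 * ((3 + c) * widthConstant p 2) + 4800

/-- The constant in the size bounds for the two-pass method with `counters`. -/
noncomputable def countersConstant (p : ℝ) : ℝ := 6 * widthConstant p 1 + 2400

theorem le_countSketchConstant {c : ℝ} (hp : 0 < p) (hp2 : p ≤ 2) (hc : 0 ≤ c) :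
    ((600 : ℕ) : ℝ) ≤ countSketchConstant p c := by
  have hwidth := widthConstant_nonneg hp hp2
  have hnonneg : 0 ≤ (3 + c) * widthConstant p 2 := by positivity
  rw [countSketchConstant]
  norm_num
  linarith

theorem le_countersConstant (hp : 0 < p) (hp1 : p ≤ 1) :
    ((600 : ℕ) : ℝ) ≤ countersConstant p := by
  have hwidth := widthConstant_nonneg hp hp1
  rw [countersConstant]
  norm_num
  linarith

theorem twoPassWords_countSketch_le {c g : ℝ} {d w : ℕ} (hp : 0 < p) (hp2 : p ≤ 2) (hc : 0 ≤ c)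
    (hn : 2 ≤ n) (hk : 1 ≤ k) (hg : 1 ≤ 2 * g)
    (hwidth : widthFactor p 2 n ≤ widthConstant p 2 * g)
    (hd : d = sketchDepth 1 n ((n : ℝ) ^ (-c)))
    (hw : w = sketchWidth 1 (k + 1) (1 / widthFactor p 2 n)) (h : Fin d → Fin n → Fin w)
    (s : Fin d → Fin n → Bool) (keyHash : κ → Fin n) (r : κ → ℝ) (a₁ a₂ : Aggregation κ) :
    (twoPassWords (countSketch d w h s) p (600 * k) keyHash r a₁ a₂ : ℝ) ≤
      countSketchConstant p c * k * (g * Real.log n) := by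
  have hdepth : (d : ℝ) ≤ (3 + c) * Real.log n := hd ▸ sketchDepth_le hc hn
  have hwle : (w : ℝ) ≤ 3 * (k * (widthConstant p 2 * g)) := by
    refine (hw ▸ sketchWidth_le (one_le_widthFactor hp hp2 n) hk).trans ?_
    gcongr
  have hlog := one_le_two_mul_log hn
  calc (twoPassWords (countSketch d w h s) p (600 * k) keyHash r a₁ a₂ : ℝ)
      ≤ ((d * w + 2 * (600 * k) : ℕ) : ℝ) := Nat.cast_le.2 (twoPassWords_le _ p _ _ r a₁ a₂)
    _ = d * w + 1200 * k * (1 * 1) := by push_cast; ring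
    _ ≤ (3 + c) * Real.log n * (3 * (k * (widthConstant p 2 * g))) +
        1200 * k * (2 * g * (2 * Real.log n)) := by gcongr
    _ = _ := by
        rw [countSketchConstant]
        ring

theorem twoPassWords_counters_le {g : ℝ} {m : ℕ} (hp : 0 < p) (hp1 : p ≤ 1) (hk : 1 ≤ k)
    (hg : 1 ≤ 2 * g) (hwidth : widthFactor p 1 n ≤ widthConstant p 1 * g)
    (hm : m = sketchWidth 1 (k + 1) (1 / widthFactor p 1 n)) (keyHash : κ → Fin n) (r : κ → ℝ)
    (a₁ a₂ : Aggregation κ) :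
    (twoPassWords (counters n m) p (600 * k) keyHash r a₁ a₂ : ℝ) ≤
      countersConstant p * k * g := by
  have hmle : (m : ℝ) ≤ 3 * (k * (widthConstant p 1 * g)) := by
    refine (hm ▸ sketchWidth_le (one_le_widthFactor hp hp1 n) hk).trans ?_
    gcongr
  calc (twoPassWords (counters n m) p (600 * k) keyHash r a₁ a₂ : ℝ)
      ≤ ((2 * m + 2 * (600 * k) : ℕ) : ℝ) := Nat.cast_le.2
        ((twoPassWords_le _ p _ _ r a₁ a₂).trans (Nat.add_le_add_right (counters_words_run_le _) _))
    _ = 2 * m + 1200 * k * 1 := by push_cast; ring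
    _ ≤ 2 * (3 * (k * (widthConstant p 1 * g))) + 1200 * k * (2 * g) := by gcongr
    _ = _ := by
        rw [countersConstant]
        ring

end Sizes

/-! ### Success of the two-pass method -/

section TwoPassSuccess

variable {κ Ω : Type*} [LinearOrder κ] [MeasurableSpace Ω] {P : Measure Ω}
  [IsProbabilityMeasure P] {n k : ℕ} {p : ℝ} {keyHash : κ → Fin n}
  {D : Multiset (DataElement κ)} {a₁ a₂ : Aggregation κ} {r : κ → Ω → ℝ}

theorem card_keys_le_of_injOn (hinj : Set.InjOn keyHash (keys D)) : (keys D).card ≤ n := by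
  simpa using Finset.card_le_card_of_injOn keyHash (t := Finset.univ)
    (fun x _ => Finset.mem_coe.2 (Finset.mem_univ _)) hinj

theorem succeedsWithProb_countSketch {d w : ℕ} {δ : ℝ} {h : Fin d → Fin n → Ω → Fin w}
    {s : Fin d → Fin n → Ω → Bool} (hp : 0 < p) (hp2 : p ≤ 2) (hk : 1 ≤ k)
    (hdδ : n * Real.exp (-d) ≤ δ) (hδ : δ ≤ 1)
    (hw : w = sketchWidth 1 (k + 1) (1 / widthFactor p 2 n))
    (hinj : Set.InjOn keyHash (keys D)) (h₁ : a₁.dataset = D) (h₂ : a₂.dataset = D)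
    (hr : IsExpHash P r) (H : IsCountSketchHash P h s)
    (hind : IndepFun (fun ω x => r x ω)
      (fun ω => ((fun i x => h i x ω), (fun i x => s i x ω))) P) :
    SucceedsWithProb P ((1 - δ) * (1 - 3 * Real.exp (-k)))
      (fun ω => countSketch d w (fun i x => h i x ω) (fun i x => s i x ω)) p k (600 * k) keyHash
      r D a₁ a₂ := by
  have hwidth := add_le_exp_mul_sketchWidth hp hp2 n k
  have hresidual : 0 ≤ residualBound p 2 n * k :=
    mul_nonneg (residualBound_nonneg hp hp2 n) k.cast_nonneg
  have hkeys : (0 : ℝ) ≤ (600 * k : ℕ) := Nat.cast_nonneg _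
  rw [← hw] at hwidth
  refine succeedsWithProb_of_concentrated hr hp hp2 le_rfl (card_keys_le_of_injOn hinj) hk
    (sub_nonneg.2 hδ) fun ε hε V hVc hV => ?_
  refine le_trans ?_ (one_sub_mul_measureReal_le_countSketch hr H hind (by lia) hinj h₁ h₂ hε
    (by linarith) (by linarith) hVc hV)
  gcongr

theorem succeedsWithProb_counters {m : ℕ} (hp : 0 < p) (hp1 : p ≤ 1) (hk : 1 ≤ k)
    (hm : m = sketchWidth 1 (k + 1) (1 / widthFactor p 1 n)) (hD : ∀ e ∈ D, 0 ≤ e.val)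
    (hinj : Set.InjOn keyHash (keys D)) (h₁ : a₁.dataset = D) (h₂ : a₂.dataset = D)
    (hr : IsExpHash P r) :
    SucceedsWithProb P (1 - 3 * Real.exp (-k)) (fun _ => counters n m) p k (600 * k) keyHash r D
      a₁ a₂ := by
  have hresidual : 0 ≤ residualBound p 1 n * k :=
    mul_nonneg (residualBound_nonneg hp hp1 n) k.cast_nonneg
  have hwidth : ((600 * k : ℕ) : ℝ) + 16 * (residualBound p 1 n * k) ≤ m :=
    calc ((600 * k : ℕ) : ℝ) + 16 * (residualBound p 1 n * k) ≤ Real.exp (-4) / 2 * m :=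
          hm ▸ add_le_exp_mul_sketchWidth hp hp1 n k
      _ ≤ m := mul_le_of_le_one_left m.cast_nonneg
          (by linarith [Real.exp_le_one_iff.2 (by norm_num : (-4 : ℝ) ≤ 0)])
  rw [← one_mul (1 - 3 * Real.exp (-(k : ℝ)))]
  refine succeedsWithProb_of_concentrated hr hp hp1 one_le_two (card_keys_le_of_injOn hinj) hk
    zero_le_one fun ε hε V hVc _ => (one_mul _).trans_le (measureReal_mono fun ω hω => ⟨hω, ?_⟩)
  exact isExactSample_counters (by lia) hD hinj h₁ h₂ hε (by positivity) hwidth (hVc hω)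

end TwoPassSuccess

end WORp

theorem theorem2 :
    -- universal constants: the sketch constants `A₁`, `A₂`, and the factor `B` of the second pass
    ∃ (A₁ A₂ : ℝ) (B : ℕ), 0 < A₁ ∧ 0 < A₂ ∧ 0 < B ∧
    -- signed data, `CountSketch`, `0 < p ≤ 2`, for every exponent `c` of `1 / poly(n)`
    (∀ p : ℝ, 0 < p → p ≤ 2 → ∃ ψ : ℕ → ℕ → ℝ, (∀ n k, 0 < ψ n k) ∧
      ∀ c : ℝ, 0 < c → ∃ C : ℝ, ∀ n k : ℕ, 2 ≤ n → 1 ≤ k →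
      ∀ d w : ℕ, d = WORp.sketchDepth A₂ n ((n : ℝ) ^ (-c)) →
        w = WORp.sketchWidth A₁ (k + 1) (ψ n k) →
      ∀ (κ : Type*) [LinearOrder κ] (keyHash : κ → Fin n),
        -- sketch sizes, at all stages of all aggregations
        (∀ (h : Fin d → Fin n → Fin w) (s : Fin d → Fin n → Bool) (r : κ → ℝ)
            (a₁ a₂ : WORp.Aggregation κ),
          (p < 2 → (WORp.twoPassWords (WORp.countSketch d w h s) p (B * k) keyHash r a₁ a₂ : ℝ)
              ≤ C * k * Real.log n) ∧
          (p = 2 → (WORp.twoPassWords (WORp.countSketch d w h s) p (B * k) keyHash r a₁ a₂ : ℝ)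
              ≤ C * k * Real.log n ^ 2) ∧
          (WORp.twoPassKeyStrings (WORp.countSketch d w h s) p (B * k) keyHash r a₁ a₂ : ℝ)
              ≤ C * k) ∧
        -- success probability
        (∀ (D : Multiset (WORp.DataElement κ)) (a₁ a₂ : WORp.Aggregation κ),
          Set.InjOn keyHash (WORp.keys D) → a₁.dataset = D → a₂.dataset = D →
          ∀ (Ω : Type*) [MeasurableSpace Ω] (P : MeasureTheory.Measure Ω)
            [MeasureTheory.IsProbabilityMeasure P] (r : κ → Ω → ℝ)
            (h : Fin d → Fin n → Ω → Fin w) (s : Fin d → Fin n → Ω → Bool),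
            WORp.IsExpHash P r → WORp.IsCountSketchHash P h s →
            ProbabilityTheory.IndepFun (fun ω x => r x ω)
              (fun ω => ((fun i x => h i x ω), (fun i x => s i x ω))) P →
            WORp.SucceedsWithProb P ((1 - (n : ℝ) ^ (-c)) * (1 - 3 * Real.exp (-(k : ℝ))))
              (fun ω => WORp.countSketch d w (fun i x => h i x ω) (fun i x => s i x ω))
              p k (B * k) keyHash r D a₁ a₂)) ∧
    -- positive data, `Counters`, `0 < p ≤ 1`
    (∀ p : ℝ, 0 < p → p ≤ 1 → ∃ ψ : ℕ → ℕ → ℝ, (∀ n k, 0 < ψ n k) ∧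
      ∃ C : ℝ, ∀ n k : ℕ, 2 ≤ n → 1 ≤ k →
      ∀ m : ℕ, m = WORp.sketchWidth A₁ (k + 1) (ψ n k) →
      ∀ (κ : Type*) [LinearOrder κ] (keyHash : κ → Fin n),
        -- sketch sizes, at all stages of all aggregations
        (∀ (r : κ → ℝ) (a₁ a₂ : WORp.Aggregation κ),
          (p < 1 → (WORp.twoPassWords (WORp.counters n m) p (B * k) keyHash r a₁ a₂ : ℝ)
              ≤ C * k) ∧
          (p = 1 → (WORp.twoPassWords (WORp.counters n m) p (B * k) keyHash r a₁ a₂ : ℝ)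
              ≤ C * k * Real.log n) ∧
          (WORp.twoPassKeyStrings (WORp.counters n m) p (B * k) keyHash r a₁ a₂ : ℝ)
              ≤ C * k) ∧
        -- success probability
        (∀ (D : Multiset (WORp.DataElement κ)) (a₁ a₂ : WORp.Aggregation κ),
          (∀ e ∈ D, 0 < e.val) →
          Set.InjOn keyHash (WORp.keys D) → a₁.dataset = D → a₂.dataset = D →
          ∀ (Ω : Type*) [MeasurableSpace Ω] (P : MeasureTheory.Measure Ω)
            [MeasureTheory.IsProbabilityMeasure P] (r : κ → Ω → ℝ),
            WORp.IsExpHash P r →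
            WORp.SucceedsWithProb P (1 - 3 * Real.exp (-(k : ℝ)))
              (fun _ => WORp.counters n m) p k (B * k) keyHash r D a₁ a₂)) := by
  refine ⟨1, 1, 600, one_pos, one_pos, by norm_num, fun p hp hp2 => ?_, fun p hp hp1 => ?_⟩
  · refine ⟨fun n _ => 1 / WORp.widthFactor p 2 n,
      fun n _ => one_div_pos.2 (one_pos.trans_le (WORp.one_le_widthFactor hp hp2 n)),
      fun c hc => ⟨WORp.countSketchConstant p c, fun n k hn hk d w hd hw κ _ keyHash =>
        ⟨fun h s r a₁ a₂ => ⟨fun hlt => ?_, fun heq => ?_, ?_⟩, ?_⟩⟩⟩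
    · simpa only [one_mul] using WORp.twoPassWords_countSketch_le hp hp2 hc.le hn hk (g := 1)
        (by norm_num) (by simpa using WORp.widthFactor_le_of_lt hlt n) hd hw h s keyHash r a₁ a₂
    · simpa only [← sq] using WORp.twoPassWords_countSketch_le hp hp2 hc.le hn hk
        (WORp.one_le_two_mul_log hn) (WORp.widthFactor_le_of_eq heq hn) hd hw h s keyHash r a₁ a₂
    · exact WORp.twoPassKeyStrings_le _ p keyHash r a₁ a₂
        (WORp.le_countSketchConstant hp hp2 hc.le)
    · intro D a₁ a₂ hinj h₁ h₂ Ω _ P _ r h s hr H hind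
      exact WORp.succeedsWithProb_countSketch hp hp2 hk
        (hd ▸ WORp.mul_exp_neg_sketchDepth_le (by lia) c)
        (Real.rpow_le_one_of_one_le_of_nonpos (mod_cast one_le_two.trans hn)
          (neg_nonpos.2 hc.le)) hw hinj h₁ h₂ hr H hind
  · refine ⟨fun n _ => 1 / WORp.widthFactor p 1 n,
      fun n _ => one_div_pos.2 (one_pos.trans_le (WORp.one_le_widthFactor hp hp1 n)),
      WORp.countersConstant p, fun n k hn hk m hm κ _ keyHash =>
        ⟨fun r a₁ a₂ => ⟨fun hlt => ?_, fun heq => ?_, ?_⟩, ?_⟩⟩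
    · simpa only [mul_one] using WORp.twoPassWords_counters_le hp hp1 hk (g := 1)
        (by norm_num) (by simpa using WORp.widthFactor_le_of_lt hlt n) hm keyHash r a₁ a₂
    · exact WORp.twoPassWords_counters_le hp hp1 hk
        (WORp.one_le_two_mul_log hn) (WORp.widthFactor_le_of_eq heq hn) hm keyHash r a₁ a₂
    · exact WORp.twoPassKeyStrings_le _ p keyHash r a₁ a₂ (WORp.le_countersConstant hp hp1)
    · intro D a₁ a₂ hD hinj h₁ h₂ Ω _ P _ r hr
      exact WORp.succeedsWithProb_counters hp hp1 hk hm (fun e he => (hD e he).le) hinj h₁ h₂ hr
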